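/- Consider the Zakharov–Shabat system $v_t=-i\zeta\sigma_3v+Uv$ with $U_{11}=U_{22}=0$, $U_{12}=q(t)$, $U_{21}=-q(t)^*$, for a continuous $q\in L^1(\mathbb R)$. For $\operatorname{Im}\zeta\ge 0$ let $\phi,\psi$ be its Jost solutions, with $\phi e^{i\zeta t}\to(1,0)^T$ as $t\to-\infty$ and $\psi e^{-i\zeta t}\to(0,1)^T$ as $t\to+\infty$; for $\zeta\in\mathbb R$ let $\bar\psi$ be the solution with $\bar\psi e^{i\zeta t}\to(1,0)^T$ as $t\to+\infty$. Put $a=W(\phi,\psi)$ and $b=W(\bar\psi,\phi)$, where $W(u,v)=u_1v_2-u_2v_1$. Let $\zeta_1,\dots,\zeta_K$ be distinct points of the open upper half-plane and let $b_1,\dots,b_K\in\mathbb C\setminus\{0\}$. For $0\le j\le K$, $q$ is called a $j$-soliton potential with discrete spectrum $\mathfrak S_j=\{(\zeta_k,b_k):1\le k\le j\}$ if the zeros of $a$ in the open upper half-plane are exactly $\zeta_1,\dots,\zeta_j$, all of them simple, if $\phi(t;\zeta_k)=b_k\psi(t;\zeta_k)$ for $1\le k\le j$, and if $b=0$ on $\mathbb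 R$. For fixed $t$ define the Darboux iteration by $v_0(t;\zeta)=e^{-i\sigma_3\zeta t}$, $D_0=\sigma_0$ (the identity) and, for $1\le j\le K$, $$u^{(j-1)}=v_{j-1}(t;\zeta_j)\begin{pmatrix}1\\-b_j\end{pmatrix},\qquad \beta_{j-1}=\frac{u^{(j-1)}_1}{u^{(j-1)}_2}\in\mathbb C\cup\{\infty\},$$ $$M_j=\frac1{1+|\beta_{j-1}|^2}\begin{pmatrix}|\beta_{j-1}|^2\zeta_j+\zeta_j^*&(\zeta_j-\zeta_j^*)\beta_{j-1}\\(\zeta_j-\zeta_j^*)\beta_{j-1}^*&\zeta_j+|\beta_{j-1}|^2\zeta_j^*\end{pmatrix},\qquad M_j=\operatorname{diag}(\zeta_j,\zeta_j^*)\ \text{ if }\beta_{j-1}=\infty,$$ $$v_j(t;\zeta)=\frac{(\zeta\sigma_0-M_j)\,v_{j-1}(t;\zeta)}{\zeta-\zeta_j^*},\qquad D_j(t;\zeta)=(\zeta\sigma_0-M_j)D_{j-1}(t;\zeta)=\sum_{k=0}^{j}D^{(j)}_k(t)\zeta^k .$$ Let $d_0^{(k,j)}$ and $d_1^{(k,j)}$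 be the $(1,1)$ and the $(1,2)$ entry of $D_k^{(j)}$. **(A)** For every $0\le j\le K$ a $j$-soliton potential with discrete spectrum $\mathfrak S_j$ exists. Let $q_j$ be any such potential, for every $0\le j\le K$, and set $\mathcal E_j^{(-)}(t)=\int_{-\infty}^t|q_j|^2ds$, $\mathcal E_j^{(+)}(t)=\int_t^\infty|q_j|^2ds$. Then the following holds. 1. For $0\le j\le K$ and $\operatorname{Im}\zeta\ge0$, $(\phi,\psi)=v_j=\mu_jD_jv_0$ is the matrix Jost solution of $q_j$, with $\mu_j(\zeta)=\prod_{k=1}^j(\zeta-\zeta_k^*)^{-1}$; moreover $D^{(j)}_j=\sigma_0$ and, for $0\le k<j$, $D_k^{(j)}=\begin{pmatrix}d_0^{(k,j)}&d_1^{(k,j)}\\-d_1^{(k,j)*}&d_0^{(k,j)*}\end{pmatrix}$. 2. For $1\le j\le K$ and all $t$ (in particular for $j=K$), $q_j=2i\,d_1^{(j-1,j)}$, $\ \mathcal E_j^{(-)}=2i\,d_0^{(j-1,j)}+2i\sum_{k=1}^j\zeta_k^*$, and $\ \mathcal E_j^{(+)}=2i\,d_0^{(j-1,j)*}+2i\sum_{k=1}^j\zeta_k^*$.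 3. $q_0=0$, $\mathcal E_0^{(\pm)}=0$, and for $1\le j\le K$ and all $t$ one has $u^{(j-1)}\neq0$ and $$q_j=q_{j-1}-2i\frac{(\zeta_j-\zeta_j^*)\beta_{j-1}}{1+|\beta_{j-1}|^2},\qquad \mathcal E_j^{(\mp)}=\mathcal E_{j-1}^{(\mp)}+\frac{4\operatorname{Im}\zeta_j}{1+|\beta_{j-1}|^{\mp2}},$$ where $0^{-2}=\infty$, $\infty^{-2}=0$, $1/\infty=0$, and the fraction in the first formula is $0$ if $\beta_{j-1}=\infty$. 4. For $0\le j\le K$, $|q_j|^2$ is integrable and $\|q_j\|_2^2=4\sum_{k=1}^j\operatorname{Im}\zeta_k$. For $T_\pm>0$ the tail energy $\int_{\mathbb R\setminus[-T_-,T_+]}|q_K|^2dt$ equals $\mathcal E_K^{(-)}(-T_-)+\mathcal E_K^{(+)}(T_+)$. **(B)** Count as one operation each addition, subtraction, multiplication, division (by a nonzero number), complex conjugation and complex exponential, and each use of a constant $1$ or $i$. There is an absolute constant $C$ such that for every $K\ge1$ there are straight-line programs with at most $CK^2$ operations, depending only on $K$, which compute exactly: (i) from $(\zeta_k,b_k)_{k\le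 K}$ and $t\in\mathbb R$, all the coefficients $d_0^{(k,K)}(t)$ and $d_1^{(k,K)}(t)$, $0\le k<K$; (ii) from $(\zeta_k,b_k)_{k\le K}$ and $T_\pm>0$, all the partial energies $\mathcal E^{(-)}_j(-T_-)$ and $\mathcal E_j^{(+)}(T_+)$, $1\le j\le K$, the tail energy of $q_K$, and its fraction $\epsilon_{\mathrm{tails}}$ of the total energy $\|q_K\|_2^2$. -/

import Mathlib

open Complex MeasureTheory Filter Topology
open scoped Matrix ComplexConjugate ENNReal Polynomial

noncomputable section

namespace ZakharovShabat

/-! ## The Zakharov-Shabat scattering problem -/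

/-- The coefficient matrix `-i ζ σ₃ + U(t)` of the scattering problem,
`U₁₁ = U₂₂ = 0`, `U₁₂ = q(t)`, `U₂₁ = -q(t)^*`. -/
def zsMatrix (q : ℝ → ℂ) (z : ℂ) (t : ℝ) : Matrix (Fin 2) (Fin 2) ℂ :=
  !![-(I * z), q t; -conj (q t), I * z]

/-- `v` solves `v_t = -i ζ σ₃ v + U v` on the whole line. -/
def IsZSSolution (q : ℝ → ℂ) (z : ℂ) (v : ℝ → Fin 2 → ℂ) : Prop :=
  ∀ t : ℝ, HasDerivAt v (zsMatrix q z t *ᵥ v t) t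

/-- The Jost solution of the first kind `ψ`: `ψ e^{-iζt} → (0,1)` as `t → ∞`. -/
def IsJostPsi (q : ℝ → ℂ) (z : ℂ) (ψ : ℝ → Fin 2 → ℂ) : Prop :=
  IsZSSolution q z ψ ∧ Tendsto (fun t : ℝ => exp (-(I * z * t)) • ψ t) atTop (𝓝 ![0, 1])

/-- The Jost solution of the first kind `ψ̄`: `ψ̄ e^{iζt} → (1,0)` as `t → ∞`. -/
def IsJostPsiBar (q : ℝ → ℂ) (z : ℂ) (ψbar : ℝ → Fin 2 → ℂ) : Prop :=
  IsZSSolution q z ψbar ∧ Tendsto (fun t : ℝ => exp (I * z * t) • ψbar t) atTop (𝓝 ![1, 0])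

/-- The Jost solution of the second kind `φ`: `φ e^{iζt} → (1,0)` as `t → -∞`. -/
def IsJostPhi (q : ℝ → ℂ) (z : ℂ) (φ : ℝ → Fin 2 → ℂ) : Prop :=
  IsZSSolution q z φ ∧ Tendsto (fun t : ℝ => exp (I * z * t) • φ t) atBot (𝓝 ![1, 0])

/-- The Wronskian of two `ℂ²`-valued vectors. -/
def wronskian (u v : Fin 2 → ℂ) : ℂ := u 0 * v 1 - u 1 * v 0

/-- `a` is the scattering coefficient `a(ζ) = W(φ, ψ)` of `q` on the closed upper half-plane. -/
def IsScatteringA (q : ℝ → ℂ) (a : ℂ → ℂ) : Prop :=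
  ∀ z : ℂ, 0 ≤ z.im → ∃ φ ψ : ℝ → Fin 2 → ℂ,
    IsJostPhi q z φ ∧ IsJostPsi q z ψ ∧ ∀ t, a z = wronskian (φ t) (ψ t)

/-- `b` is the scattering coefficient `b(ξ) = W(ψ̄, φ)` of `q` on the real line. -/
def IsScatteringB (q : ℝ → ℂ) (b : ℝ → ℂ) : Prop :=
  ∀ ξ : ℝ, ∃ φ ψbar : ℝ → Fin 2 → ℂ,
    IsJostPhi q ξ φ ∧ IsJostPsiBar q ξ ψbar ∧ ∀ t, b ξ = wronskian (ψbar t) (φ t)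

/-- Admissible discrete data `(ζ_k, b_k)`, `k = 1, …, K`: the eigenvalues are distinct points of
the open upper half-plane and the norming constants are nonzero.
Only the values of `ζ` and `b` at `1, …, K` matter. -/
structure IsSpectralData (K : ℕ) (ζ b : ℕ → ℂ) : Prop where
  im_pos : ∀ k ∈ Finset.Icc 1 K, 0 < (ζ k).im
  norming_ne : ∀ k ∈ Finset.Icc 1 K, b k ≠ 0
  distinct : Set.InjOn ζ (Set.Icc 1 K)

/-- `q` is a `K`-soliton potential with discrete spectrum `{(ζ_k, b_k) : k = 1, …, K}`:
the eigenvalues (zeros of `a` in the open upper half-plane) are exactly the `ζ_k`, they are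
simple zeros, `b_k` is the norming constant at `ζ_k`, that is `φ(t; ζ_k) = b_k ψ(t; ζ_k)`, and
the reflection coefficient `ρ = b / a` vanishes on the real line. -/
def IsSolitonPotential (K : ℕ) (ζ b : ℕ → ℂ) (q : ℝ → ℂ) : Prop :=
  Continuous q ∧ Integrable q ∧
  (∃ a : ℂ → ℂ, IsScatteringA q a ∧
    (∀ z : ℂ, 0 < z.im → (a z = 0 ↔ ∃ k ∈ Finset.Icc 1 K, z = ζ k)) ∧
    (∀ k ∈ Finset.Icc 1 K, deriv a (ζ k) ≠ 0)) ∧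
  (∀ k ∈ Finset.Icc 1 K, ∃ φ ψ : ℝ → Fin 2 → ℂ,
    IsJostPhi q (ζ k) φ ∧ IsJostPsi q (ζ k) ψ ∧ ∀ t, φ t = b k • ψ t) ∧
  IsScatteringB q (fun _ => 0)

/-! ## Energies -/

/-- `E^{(-)}(t) = ∫_{-∞}^t |q(s)|² ds`. -/
def energyLeft (q : ℝ → ℂ) (t : ℝ) : ℝ := ∫ s in Set.Iic t, ‖q s‖ ^ 2

/-- `E^{(+)}(t) = ∫_t^∞ |q(s)|² ds`. -/
def energyRight (q : ℝ → ℂ) (t : ℝ) : ℝ := ∫ s in Set.Ioi t, ‖q s‖ ^ 2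

/-- `‖q‖₂²`. -/
def totalEnergy (q : ℝ → ℂ) : ℝ := ∫ s, ‖q s‖ ^ 2

/-- The energy of `q` outside the window `[-T₋, T₊]`. -/
def tailEnergy (q : ℝ → ℂ) (Tm Tp : ℝ) : ℝ := ∫ s in (Set.Icc (-Tm) Tp)ᶜ, ‖q s‖ ^ 2

/-! ## The Darboux transformation -/

/-- The seed solution `v₀(t; ζ) = e^{-i σ₃ ζ t}` of the null potential. -/
def seed (t : ℝ) (z : ℂ) : Matrix (Fin 2) (Fin 2) ℂ :=
  !![exp (-(I * z * t)), 0; 0, exp (I * z * t)]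

/-- The matrix subtracted from `ζ σ₀` in a Darboux matrix of degree one which adds the eigenvalue
`w`, as a function of a vector `u = (u₁, u₂)` that represents `β = u₁ / u₂` homogeneously.
The value at `u₂ = 0` is the one for `β = ∞`. -/
def darbouxShift (w : ℂ) (u : Fin 2 → ℂ) : Matrix (Fin 2) (Fin 2) ℂ :=
  ((‖u 0‖ ^ 2 + ‖u 1‖ ^ 2 : ℝ) : ℂ)⁻¹ •
    !![(‖u 0‖ ^ 2 : ℝ) * w + (‖u 1‖ ^ 2 : ℝ) * conj w, (w - conj w) * (u 0 * conj (u 1));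
       (w - conj w) * (conj (u 0) * u 1), (‖u 1‖ ^ 2 : ℝ) * w + (‖u 0‖ ^ 2 : ℝ) * conj w]

/-- For `u₂ ≠ 0` the matrix is the usual expression in `β = u₁ / u₂`. -/
theorem darbouxShift_eq (w : ℂ) (u : Fin 2 → ℂ) (β : ℂ) (hu : u 1 ≠ 0) (hβ : β = u 0 / u 1) :
    darbouxShift w u =
      !![((‖β‖ ^ 2 : ℝ) * w + conj w) / (1 + (‖β‖ ^ 2 : ℝ)),
           ((w - conj w) * β) / (1 + (‖β‖ ^ 2 : ℝ));
         ((w - conj w) * conj β) / (1 + (‖β‖ ^ 2 : ℝ)),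
           (w + conj w * (‖β‖ ^ 2 : ℝ)) / (1 + (‖β‖ ^ 2 : ℝ))] := by
  have h0 : u 0 = β * u 1 := by rw [hβ]; field_simp
  have hc : conj (u 1) ≠ 0 := by simpa using hu
  have hn : ((1 : ℂ) + β * conj β) ≠ 0 := by
    rw [Complex.mul_conj']
    exact_mod_cast (by positivity : (1 + ‖β‖ ^ 2 : ℝ) ≠ 0)
  have hd : (u 1 * conj (u 1)) ≠ 0 := mul_ne_zero hu hc
  unfold darbouxShift
  push_cast
  simp only [← Complex.mul_conj']
  rw [h0, map_mul]
  have e : β * u 1 * (conj β * conj (u 1)) + u 1 * conj (u 1)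
      = (u 1 * conj (u 1)) * (1 + β * conj β) := by ring
  rw [e]
  ext i j
  fin_cases i <;> fin_cases j <;>
    simp only [Matrix.smul_apply, smul_eq_mul, Matrix.of_apply, Matrix.cons_val', Matrix.cons_val_zero,
      Matrix.cons_val_one, Fin.zero_eta, Fin.mk_one, Matrix.cons_val_fin_one] <;>
    rw [inv_mul_eq_div, div_eq_div_iff (mul_ne_zero hd hn) hn] <;> ring

/-- The matrix Jost solutions `v_j(t; ζ) = (φ^{(j)}, ψ^{(j)})` produced by the iteration
`v_j = (ζ - ζ_j^*)⁻¹ D₁(t; ζ, S_j | S_{j-1}) v_{j-1}`,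
in which `D₁` is computed from `φ^{(j-1)}(t; ζ_j) - b_j ψ^{(j-1)}(t; ζ_j)`. -/
def darbouxJost (ζ b : ℕ → ℂ) (t : ℝ) : ℕ → ℂ → Matrix (Fin 2) (Fin 2) ℂ
  | 0 => seed t
  | j + 1 => fun z => (z - conj (ζ (j + 1)))⁻¹ •
      ((z • (1 : Matrix (Fin 2) (Fin 2) ℂ) -
        darbouxShift (ζ (j + 1)) (darbouxJost ζ b t j (ζ (j + 1)) *ᵥ ![1, -b (j + 1)])) *
        darbouxJost ζ b t j z)

/-- The vector `φ^{(j)}(t; ζ_{j+1}) - b_{j+1} ψ^{(j)}(t; ζ_{j+1})`, the quotient of whose two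
entries is `β_j(t; ζ_{j+1}, b_{j+1})`. -/
def betaVector (ζ b : ℕ → ℂ) (t : ℝ) (j : ℕ) : Fin 2 → ℂ :=
  darbouxJost ζ b t j (ζ (j + 1)) *ᵥ ![1, -b (j + 1)]

/-- `β_j(t; ζ_{j+1}, b_{j+1})` as a complex number; equal to `0` where the denominator vanishes. -/
def beta (ζ b : ℕ → ℂ) (t : ℝ) (j : ℕ) : ℂ := betaVector ζ b t j 0 / betaVector ζ b t j 1

/-- `|β_j(t; ζ_{j+1}, b_{j+1})|` as an element of `[0, ∞]`; equal to `∞` where only the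
denominator vanishes. -/
def betaAbs (ζ b : ℕ → ℂ) (t : ℝ) (j : ℕ) : ℝ≥0∞ :=
  ‖betaVector ζ b t j 0‖ₑ / ‖betaVector ζ b t j 1‖ₑ

/-- The Darboux matrix `D_j(t; ζ, S_j)`, a polynomial in the spectral parameter with matrix
coefficients: the ordered product of `j` Darboux matrices of degree one. -/
def darbouxPoly (ζ b : ℕ → ℂ) (t : ℝ) : ℕ → (Matrix (Fin 2) (Fin 2) ℂ)[X]
  | 0 => 1
  | j + 1 => (Polynomial.X -
      Polynomial.C (darbouxShift (ζ (j + 1)) (betaVector ζ b t j))) * darbouxPoly ζ b t j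

/-- The coefficient matrix `D_k^{(K)}(t)`. -/
def darbouxCoeff (ζ b : ℕ → ℂ) (t : ℝ) (K k : ℕ) : Matrix (Fin 2) (Fin 2) ℂ :=
  (darbouxPoly ζ b t K).coeff k

/-- `d_0^{(k,K)}(t)`. -/
def dZero (ζ b : ℕ → ℂ) (K k : ℕ) (t : ℝ) : ℂ := darbouxCoeff ζ b t K k 0 0

/-- `d_1^{(k,K)}(t)`. -/
def dOne (ζ b : ℕ → ℂ) (K k : ℕ) (t : ℝ) : ℂ := darbouxCoeff ζ b t K k 0 1

/-- `D_K(t; ζ, S_K) = ∑_{k=0}^K D_k^{(K)}(t) ζ^k`. -/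
def darbouxMatrix (ζ b : ℕ → ℂ) (K : ℕ) (t : ℝ) (z : ℂ) : Matrix (Fin 2) (Fin 2) ℂ :=
  ∑ k ∈ Finset.range (K + 1), z ^ k • darbouxCoeff ζ b t K k

/-- `μ_K(ζ) = ∏_{k=1}^K (ζ - ζ_k^*)⁻¹`. -/
def darbouxMu (ζ : ℕ → ℂ) (K : ℕ) (z : ℂ) : ℂ := ∏ k ∈ Finset.Icc 1 K, (z - conj (ζ k))⁻¹

/-- The matrix `μ_K(ζ) D_K(t; ζ, S_K) v₀(t; ζ)`. -/
def darbouxSolution (ζ b : ℕ → ℂ) (K : ℕ) (t : ℝ) (z : ℂ) : Matrix (Fin 2) (Fin 2) ℂ :=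
  darbouxMu ζ K z • (darbouxMatrix ζ b K t z * seed t z)

/-! ## Operation counts

Straight-line programs over `ℂ`. Every instruction performs one operation on values stored
earlier and appends the result to the memory; indices are addresses in the memory, which starts
with the input. A program fails if it divides by zero or reads a nonexistent address. -/

/-- One elementary operation; the only constants are `1` and `i`. -/
inductive Instr where
  | one : Instr
  | imag : Instr
  | add : ℕ → ℕ → Instr
  | sub : ℕ → ℕ → Instr
  | mul : ℕ → ℕ → Instr
  | div : ℕ → ℕ → Instr
  | conj : ℕ → Instr
  | exp : ℕ → Instr

/-- The value computed by one instruction, `none` if it fails. -/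
def Instr.value (m : List ℂ) : Instr → Option ℂ
  | .one => some 1
  | .imag => some I
  | .add i j => m[i]?.bind fun x => m[j]?.map fun y => x + y
  | .sub i j => m[i]?.bind fun x => m[j]?.map fun y => x - y
  | .mul i j => m[i]?.bind fun x => m[j]?.map fun y => x * y
  | .div i j => m[i]?.bind fun x => m[j]?.bind fun y =>
      open Classical in if y = 0 then none else some (x / y)
  | .conj i => m[i]?.map fun x => starRingEnd ℂ x
  | .exp i => m[i]?.map fun x => Complex.exp x

/-- The memory after the execution of a program, `none` if some instruction fails. -/
def runProgram : List Instr → List ℂ → Option (List ℂ)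
  | [], m => some m
  | c :: cs, m => (c.value m).bind fun x => runProgram cs (m ++ [x])

/-- The program `prog`, started on `input`, terminates without failure and leaves the list
`output` at the addresses `outs`. -/
def ProgramComputes (prog : List Instr) (outs : List ℕ) (input output : List ℂ) : Prop :=
  ∃ m : List ℂ, runProgram prog input = some m ∧ outs.map (fun i => m[i]?) = output.map some

/-- The spectral data as an input list `ζ_1, …, ζ_K, b_1, …, b_K`. -/
def dataList (K : ℕ) (ζ b : ℕ → ℂ) : List ℂ :=
  (List.range K).map (fun k => ζ (k + 1)) ++ (List.range K).map (fun k => b (k + 1))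

end ZakharovShabat

end

open ZakharovShabat

/-! Existence. Let `u` solve the system for `q` at a point `w` of the upper half-plane, and let M
act as w on `u` and as the conjugate of w on the orthogonal complement of `u`. The entries of M
satisfy a closed differential equation in t, and it follows that multiplication by ζ - M carries
solutions for q to solutions for q - 2i M₁₂ (`IsZSSolution.darboux`). Iteration from the null
potential gives `darbouxPotential` and its matrix solution v_j. The determinant of v_j is a Blaschke
product; as the eigenvalues are distinct it is nonzero at the next one, so `betaVector` never
vanishes and the iteration does not break down. As t → -∞, M tends exponentially fast to diag(w^*,
w), which gives the Jost normalization of φ. Time reversal swaps the components and turns b into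
b⁻¹, which gives the behaviour of ψ at +∞. For real ζ, v_j is a scalar multiple of a quaternionic
matrix; its columns are orthogonal, hence b = 0.

Energies. The derivative of 2 Im M₁₁ is exactly the increment of |q|² in one step
(`norm_sub_two_I_mul_sq`), so the partial energies are telescoping sums. The next to leading
coefficient of D_j is minus the sum of the M's, and this yields the formulas in d₀ and d₁.

Uniqueness. The formulas must hold for every soliton potential with the given data, so such a
potential has to be unique. The energy balance bounds normalized Jost solutions by 1 in the closed
half-plane and makes their difference quotients in ζ Lipschitz, hence the solutions holomorphic; a
Riemann-Lebesgue estimate gives their limits as ζ → ∞. For two potentials with the same data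
consider the quotient (m n)(m' n')⁻¹ of their normalized Jost matrices at fixed t. Equal norming
constants remove its poles at the eigenvalues, b = 0 makes it unitary on the real line, and it tends
to the identity at infinity. By the maximum principle it is a contraction. Since |a| is the modulus
of a Blaschke product (`norm_eq_blaschke`), its determinant is unimodular, so it is an isometry at
an interior point; the strong maximum principle then forces it to be the identity. The Jost
solutions agree, and the differential equation returns q.

Cost. Besides the coefficients of D_j, the program carries the vectors v_j(ζ_k)(1, -b_k) for all k ≤
K. Each of these O(K) quantities is updated by a bounded number of operations, so K steps take
O(K²). -/

namespace ZakharovShabat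
section

/-! ### Normalized Jost solutions -/

/-- `(x, y) = e^{iζt} φ` for the Jost solution `φ` of the second kind. -/
structure IsNormalizedPhi (q : ℝ → ℂ) (z : ℂ) (x y : ℝ → ℂ) : Prop where
  deriv_fst : ∀ t, HasDerivAt x (q t * y t) t
  deriv_snd : ∀ t, HasDerivAt y (2 * I * z * y t - conj (q t) * x t) t
  lim_fst : Tendsto x atBot (𝓝 1)
  lim_snd : Tendsto y atBot (𝓝 0)

theorem hasDerivAt_exp_mul (c : ℂ) (t : ℝ) :
    HasDerivAt (fun s : ℝ => exp (c * s)) (c * exp (c * t)) t := by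
  have h : HasDerivAt (fun s : ℝ => c * (s : ℂ)) (c * 1) t :=
    (hasDerivAt_id t).ofReal_comp.const_mul c
  simpa [mul_comm] using h.cexp

theorem IsJostPhi.normalized {q : ℝ → ℂ} {z : ℂ} {φ : ℝ → Fin 2 → ℂ} (h : IsJostPhi q z φ) :
    IsNormalizedPhi q z (fun t => exp (I * z * t) * φ t 0) (fun t => exp (I * z * t) * φ t 1) := by
  have h0 := fun t => hasDerivAt_pi.1 (h.1 t) 0
  have h1 := fun t => hasDerivAt_pi.1 (h.1 t) 1
  have hl := tendsto_pi_nhds.1 h.2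
  refine ⟨fun t => ?_, fun t => ?_, by simpa using hl 0, by simpa using hl 1⟩
  · refine ((hasDerivAt_exp_mul (I * z) t).mul (h0 t)).congr_deriv ?_
    simp [zsMatrix, Matrix.mulVec, dotProduct, Fin.sum_univ_two]
    ring
  · refine ((hasDerivAt_exp_mul (I * z) t).mul (h1 t)).congr_deriv ?_
    simp [zsMatrix, Matrix.mulVec, dotProduct, Fin.sum_univ_two]
    ring

theorem hasDerivAt_reverse {f : ℝ → ℂ} {f' : ℂ} {t : ℝ} (h : HasDerivAt f f' (-t)) :
    HasDerivAt (fun s => f (-s)) (-f') t := by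
  simpa [Function.comp_def] using h.scomp t (hasDerivAt_neg t)

/-- Time reversal turns Jost solutions of the first kind into those of the second kind. -/
theorem IsJostPsi.normalized {q : ℝ → ℂ} {z : ℂ} {ψ : ℝ → Fin 2 → ℂ} (h : IsJostPsi q z ψ) :
    IsNormalizedPhi (fun t => conj (q (-t))) z
      (fun t => exp (I * z * t) * ψ (-t) 1) (fun t => exp (I * z * t) * ψ (-t) 0) := by
  have h0 := fun t => hasDerivAt_reverse (hasDerivAt_pi.1 (h.1 (-t)) 0)
  have h1 := fun t => hasDerivAt_reverse (hasDerivAt_pi.1 (h.1 (-t)) 1)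
  have hl := tendsto_pi_nhds.1 (h.2.comp tendsto_neg_atBot_atTop)
  refine ⟨fun t => ?_, fun t => ?_, by simpa using hl 1, by simpa using hl 0⟩
  · refine ((hasDerivAt_exp_mul (I * z) t).mul (h1 t)).congr_deriv ?_
    simp [zsMatrix, Matrix.mulVec, dotProduct, Fin.sum_univ_two]
    ring
  · refine ((hasDerivAt_exp_mul (I * z) t).mul (h0 t)).congr_deriv ?_
    simp [zsMatrix, Matrix.mulVec, dotProduct, Fin.sum_univ_two]
    ring

theorem hasDerivAt_norm_sq {f : ℝ → ℂ} {f' : ℂ} {t : ℝ} (h : HasDerivAt f f' t) :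
    HasDerivAt (fun s => ‖f s‖ ^ 2) (2 * (f' * conj (f t)).re) t := by
  have := h.norm_sq
  rwa [Complex.inner] at this

/-- The energy balance of the forced system. -/
theorem hasDerivAt_energy {q : ℝ → ℂ} {w : ℂ} {x y f : ℝ → ℂ} {t : ℝ}
    (hx : HasDerivAt x (q t * y t) t)
    (hy : HasDerivAt y (2 * I * w * y t - conj (q t) * x t + f t) t) :
    HasDerivAt (fun s => ‖x s‖ ^ 2 + ‖y s‖ ^ 2)
      (-4 * w.im * ‖y t‖ ^ 2 + 2 * (f t * conj (y t)).re) t := by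
  refine ((hasDerivAt_norm_sq hx).add (hasDerivAt_norm_sq hy)).congr_deriv ?_
  rw [← Complex.normSq_eq_norm_sq, Complex.normSq_apply]
  simp
  ring

/-- Takes the place of Gronwall's inequality: the data are prescribed at t = -∞, so a nonincreasing
quantity is controlled by its limit there, with no dependence on q. -/
theorem le_of_hasDerivAt_nonpos {F F' : ℝ → ℝ} {L : ℝ} (h : ∀ t, HasDerivAt F (F' t) t)
    (h' : ∀ t, F' t ≤ 0) (hl : Tendsto F atBot (𝓝 L)) (t : ℝ) : F t ≤ L := by
  have ha : Antitone F := antitone_of_hasDerivAt_nonpos h h'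
  exact ge_of_tendsto hl ((eventually_le_atBot t).mono fun s hs => ha hs)

namespace IsNormalizedPhi

variable {q : ℝ → ℂ} {z w : ℂ} {x y x' y' : ℝ → ℂ}

theorem energy_deriv (h : IsNormalizedPhi q z x y) (t : ℝ) :
    HasDerivAt (fun s => ‖x s‖ ^ 2 + ‖y s‖ ^ 2) (-4 * z.im * ‖y t‖ ^ 2) t := by
  simpa using hasDerivAt_energy (w := z) (f := fun _ => 0) (h.deriv_fst t)
    (by simpa using h.deriv_snd t)

theorem energy_lim (h : IsNormalizedPhi q z x y) :
    Tendsto (fun s => ‖x s‖ ^ 2 + ‖y s‖ ^ 2) atBot (𝓝 1) := by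
  simpa using (h.lim_fst.norm.pow 2).add (h.lim_snd.norm.pow 2)

/-- The coupling through q is skew-Hermitian and drops out of the energy balance; only the
dissipation from Im z ≥ 0 remains. -/
theorem energy_le (h : IsNormalizedPhi q z x y) (hz : 0 ≤ z.im) (t : ℝ) :
    ‖x t‖ ^ 2 + ‖y t‖ ^ 2 ≤ 1 :=
  le_of_hasDerivAt_nonpos h.energy_deriv
    (fun t => by nlinarith [mul_nonneg hz (sq_nonneg ‖y t‖)]) h.energy_lim t

theorem energy_eq (h : IsNormalizedPhi q z x y) (hz : z.im = 0) (t : ℝ) :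
    ‖x t‖ ^ 2 + ‖y t‖ ^ 2 = 1 := by
  refine le_antisymm (h.energy_le hz.ge t) ?_
  have := le_of_hasDerivAt_nonpos (fun t => (h.energy_deriv t).neg)
    (fun t => by simp [hz]) h.energy_lim.neg t
  simp only [Pi.neg_apply] at this
  linarith

theorem norm_fst_le (h : IsNormalizedPhi q z x y) (hz : 0 ≤ z.im) (t : ℝ) : ‖x t‖ ≤ 1 := by
  have := h.energy_le hz t
  nlinarith [norm_nonneg (x t), sq_nonneg ‖y t‖]

theorem norm_snd_le (h : IsNormalizedPhi q z x y) (hz : 0 ≤ z.im) (t : ℝ) : ‖y t‖ ≤ 1 := by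
  have := h.energy_le hz t
  nlinarith [norm_nonneg (y t), sq_nonneg ‖x t‖]

/-- The difference of solutions at z and at w solves the system at w with forcing 2i(z - w)y in the
second component, and starts from zero at -∞. For z = w this gives uniqueness. -/
theorem difference_deriv (h : IsNormalizedPhi q z x y) (h' : IsNormalizedPhi q w x' y') (t : ℝ) :
    HasDerivAt (fun s => ‖x s - x' s‖ ^ 2 + ‖y s - y' s‖ ^ 2)
      (-4 * w.im * ‖y t - y' t‖ ^ 2 + 2 * (2 * I * (z - w) * y t * conj (y t - y' t)).re) t :=
  hasDerivAt_energy (q := q) (w := w) (f := fun s => 2 * I * (z - w) * y s)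
    (((h.deriv_fst t).sub (h'.deriv_fst t)).congr_deriv (by ring))
    (((h.deriv_snd t).sub (h'.deriv_snd t)).congr_deriv (by ring))

theorem difference_lim (h : IsNormalizedPhi q z x y) (h' : IsNormalizedPhi q w x' y') :
    Tendsto (fun s => ‖x s - x' s‖ ^ 2 + ‖y s - y' s‖ ^ 2) atBot (𝓝 0) := by
  simpa using ((h.lim_fst.sub h'.lim_fst).norm.pow 2).add ((h.lim_snd.sub h'.lim_snd).norm.pow 2)

theorem unique (h : IsNormalizedPhi q z x y) (h' : IsNormalizedPhi q z x' y') (hz : 0 ≤ z.im)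
    (t : ℝ) : x t = x' t ∧ y t = y' t := by
  have := le_of_hasDerivAt_nonpos (h.difference_deriv h')
    (fun t => by simp only [sub_self]; simp; positivity) (h.difference_lim h') t
  have h1 := sq_nonneg ‖x t - x' t‖
  have h2 := sq_nonneg ‖y t - y' t‖
  constructor
  · rw [← sub_eq_zero, ← norm_eq_zero, ← sq_eq_zero_iff]; linarith
  · rw [← sub_eq_zero, ← norm_eq_zero, ← sq_eq_zero_iff]; linarith

end IsNormalizedPhi
end

/-! ### Dependence of Jost solutions on the spectral parameter -/

section

/-- Applied to difference quotients: a function that is Lipschitz on a punctured ball is Cauchy at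
the centre. Complex differentiability thus follows without knowing the derivative in advance. -/
theorem exists_tendsto_of_norm_sub_le {g : ℂ → ℂ} {w : ℂ} {C r : ℝ} (hr : 0 < r)
    (h : ∀ z z', z ∈ Metric.ball w r → z' ∈ Metric.ball w r → z ≠ w → z' ≠ w →
      ‖g z - g z'‖ ≤ C * ‖z - z'‖) : ∃ L, Tendsto g (𝓝[≠] w) (𝓝 L) := by
  rw [← cauchy_map_iff_exists_tendsto, Metric.cauchy_iff]
  refine ⟨inferInstance, fun ε hε => ?_⟩
  -- Two points of the ball of radius ρ are less than 2ρ apart, and |C| · 2ρ < ε.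
  set ρ := min r (ε / (2 * (|C| + 1))) with hρ
  have hρ0 : 0 < ρ := by positivity
  refine ⟨g '' (Metric.ball w ρ \ {w}), image_mem_map
    (sdiff_mem_nhdsWithin_compl (Metric.ball_mem_nhds w hρ0) _), ?_⟩
  rintro _ ⟨z, ⟨hz, hzw⟩, rfl⟩ _ ⟨z', ⟨hz', hzw'⟩, rfl⟩
  have hρr : ρ ≤ r := min_le_left _ _
  have h1 := h z z' (Metric.ball_subset_ball hρr hz) (Metric.ball_subset_ball hρr hz') hzw hzw'
  have h2 : ‖z - z'‖ < 2 * ρ := by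
    rw [← dist_eq_norm]
    have := dist_triangle_right z z' w
    rw [Metric.mem_ball] at hz hz'
    linarith
  rw [dist_eq_norm]
  have h3 : ρ * (2 * (|C| + 1)) ≤ ε := by
    rw [← le_div_iff₀ (by positivity)]; exact min_le_right _ _
  calc _ ≤ C * ‖z - z'‖ := h1
    _ ≤ |C| * ‖z - z'‖ := by gcongr; exact le_abs_self C
    _ ≤ |C| * (2 * ρ) := by gcongr
    _ < ε := by nlinarith

/-- The Volterra estimate for a scalar equation with nonincreasing homogeneous solutions. -/
theorem norm_le_integral_of_hasDerivAt {n h : ℝ → ℂ} {c : ℂ} {H : ℝ → ℝ} (hc : c.re ≤ 0)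
    (hn : ∀ t, HasDerivAt n (c * n t + h t) t) (hh : Continuous h) (hH : Integrable H)
    (hle : ∀ t, ‖h t‖ ≤ H t) (hl : Tendsto n atBot (𝓝 0)) (t : ℝ) :
    ‖n t‖ ≤ ∫ s in Set.Iic t, H s := by
  have hH0 : ∀ s, 0 ≤ H s := fun s => (norm_nonneg _).trans (hle s)
  -- Duhamel's formula on [s, t], where the propagator has norm at most 1 because Re c ≤ 0;
  -- afterwards s → -∞ removes the first term.
  have key : ∀ s ≤ t, ‖n t‖ ≤ ‖n s‖ + ∫ r in Set.Iic t, H r := by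
    intro s hs
    have hd : ∀ r : ℝ, HasDerivAt (fun r : ℝ => exp (c * (t - r)) * n r)
        (exp (c * (t - r)) * h r) r := by
      intro r
      have h1 : HasDerivAt (fun r : ℝ => c * ((t : ℂ) - (r : ℂ))) (c * (0 - 1)) r :=
        ((hasDerivAt_const r (t : ℂ)).sub (hasDerivAt_id r).ofReal_comp).const_mul c
      refine (h1.cexp.mul (hn r)).congr_deriv ?_
      ring
    have hcont : Continuous fun r : ℝ => exp (c * ((t : ℂ) - r)) * h r := by fun_prop
    have h2 := intervalIntegral.integral_eq_sub_of_hasDerivAt (a := s) (b := t)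
      (fun r _ => hd r) (hcont.intervalIntegrable s t)
    have h3 : n t = exp (c * (t - s)) * n s + ∫ r in s..t, exp (c * (t - r)) * h r := by
      rw [h2]; simp
    have he : ∀ r ≤ t, ‖exp (c * ((t : ℂ) - r))‖ ≤ 1 := by
      intro r hr
      rw [Complex.norm_exp, Real.exp_le_one_iff]
      have : (c * ((t : ℂ) - r)).re = c.re * (t - r) := by simp
      rw [this]
      exact mul_nonpos_of_nonpos_of_nonneg hc (by linarith)
    have h4 : ‖∫ r in s..t, exp (c * (t - r)) * h r‖ ≤ ∫ r in s..t, H r := by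
      refine intervalIntegral.norm_integral_le_of_norm_le hs (Eventually.of_forall fun r hr => ?_)
        hH.intervalIntegrable
      rw [norm_mul]
      exact (mul_le_of_le_one_left (norm_nonneg _) (he r hr.2)).trans (hle r)
    have h5 : ∫ r in s..t, H r ≤ ∫ r in Set.Iic t, H r := by
      rw [intervalIntegral.integral_of_le hs]
      exact setIntegral_mono_set hH.integrableOn (Eventually.of_forall hH0)
        (LE.le.eventuallyLE fun r hr => hr.2)
    calc ‖n t‖ ≤ ‖exp (c * (t - s)) * n s‖ + ‖∫ r in s..t, exp (c * (t - r)) * h r‖ := by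
          conv_lhs => rw [h3]
          exact norm_add_le _ _
      _ ≤ ‖n s‖ + ∫ r in Set.Iic t, H r := by
          rw [norm_mul]
          exact add_le_add (mul_le_of_le_one_left (norm_nonneg _) (he s hs)) (h4.trans h5)
  have hl' : Tendsto (fun s => ‖n s‖ + ∫ r in Set.Iic t, H r) atBot
      (𝓝 (0 + ∫ r in Set.Iic t, H r)) := by
    simpa using (hl.norm).add_const (∫ r in Set.Iic t, H r)
  rw [zero_add] at hl'
  exact ge_of_tendsto hl' ((eventually_le_atBot t).mono key)

namespace IsNormalizedPhi

variable {q : ℝ → ℂ} {z w : ℂ} {x y x' y' : ℝ → ℂ}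

theorem continuous_fst (h : IsNormalizedPhi q z x y) : Continuous x :=
  continuous_iff_continuousAt.2 fun t => (h.deriv_fst t).continuousAt

theorem continuous_snd (h : IsNormalizedPhi q z x y) : Continuous y :=
  continuous_iff_continuousAt.2 fun t => (h.deriv_snd t).continuousAt

theorem norm_fst_sub_one_le (hq : Continuous q) (hi : Integrable q)
    (h : IsNormalizedPhi q z x y) {ε : ℝ} (hy : ∀ t, ‖y t‖ ≤ ε) (t : ℝ) :
    ‖x t - 1‖ ≤ ∫ s in Set.Iic t, ε * ‖q s‖ := by
  have hc := h.continuous_snd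
  refine norm_le_integral_of_hasDerivAt (n := fun t => x t - 1) (c := 0) le_rfl
    (fun t => ((h.deriv_fst t).sub_const 1).congr_deriv (by rw [zero_mul, zero_add])) (by fun_prop)
    (hi.norm.const_mul ε) (fun t => ?_) (by simpa using h.lim_fst.sub_const 1) t
  rw [norm_mul, mul_comm]
  exact mul_le_mul_of_nonneg_right (hy t) (norm_nonneg _)

theorem norm_snd_le_integral (hq : Continuous q) (hi : Integrable q)
    (h : IsNormalizedPhi q z x y) (hz : 0 ≤ z.im) (t : ℝ) :
    ‖y t‖ ≤ ∫ s in Set.Iic t, ‖q s‖ := by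
  have hc := h.continuous_fst
  refine norm_le_integral_of_hasDerivAt (n := y) (h := fun t => -(conj (q t) * x t))
    (c := 2 * I * z) (by simpa using hz)
    (fun t => (h.deriv_snd t).congr_deriv (by ring))
    (by have := Complex.continuous_conj.comp hq; exact (this.mul hc).neg)
    hi.norm (fun t => ?_) h.lim_snd t
  rw [norm_neg, norm_mul, RCLike.norm_conj]
  exact mul_le_of_le_one_right (norm_nonneg _) (h.norm_fst_le hz t)

/-- Up to time s both solutions are close to their limit (1, 0) by the Volterra estimate. After s
the energy of the difference grows at rate at most 8‖z - w‖, since |y| ≤ 1 and the difference of the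
second components is at most 2. Unlike the slope estimate this needs no positive lower bound on the
imaginary parts and reaches the real line. -/
theorem difference_le (hq : Continuous q) (hi : Integrable q)
    (h : IsNormalizedPhi q z x y) (h' : IsNormalizedPhi q w x' y') (hz : 0 ≤ z.im)
    (hw : 0 ≤ w.im) {s t : ℝ} (hst : s ≤ t) :
    ‖x t - x' t‖ ^ 2 + ‖y t - y' t‖ ^ 2 ≤
      8 * (∫ r in Set.Iic s, ‖q r‖) ^ 2 + 8 * ‖z - w‖ * (t - s) := by
  set Q := ∫ r in Set.Iic s, ‖q r‖
  have hF : ∀ r, HasDerivAt (fun r => ‖x r - x' r‖ ^ 2 + ‖y r - y' r‖ ^ 2 - 8 * ‖z - w‖ * r)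
      (-4 * w.im * ‖y r - y' r‖ ^ 2 + 2 * (2 * I * (z - w) * y r * conj (y r - y' r)).re
        - 8 * ‖z - w‖ * 1) r := fun r =>
    (h.difference_deriv h' r).sub ((hasDerivAt_id r).const_mul _)
  have hF' : ∀ r, -4 * w.im * ‖y r - y' r‖ ^ 2
      + 2 * (2 * I * (z - w) * y r * conj (y r - y' r)).re - 8 * ‖z - w‖ * 1 ≤ 0 := by
    intro r
    have h1 : (2 * I * (z - w) * y r * conj (y r - y' r)).re ≤ 4 * ‖z - w‖ := by
      refine (Complex.re_le_norm _).trans ?_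
      simp only [norm_mul, RCLike.norm_conj, Complex.norm_ofNat, Complex.norm_I, mul_one]
      have h2 : ‖y r - y' r‖ ≤ 2 := by
        have := norm_sub_le (y r) (y' r)
        linarith [h.norm_snd_le hz r, h'.norm_snd_le hw r]
      calc 2 * ‖z - w‖ * ‖y r‖ * ‖y r - y' r‖ ≤ 2 * ‖z - w‖ * 1 * 2 := by
            gcongr
            exact h.norm_snd_le hz r
        _ = _ := by ring
    have h3 : 0 ≤ w.im * ‖y r - y' r‖ ^ 2 := by positivity
    linarith
  have ha := antitone_of_hasDerivAt_nonpos hF hF' hst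
  have hx : ‖x s - x' s‖ ≤ 2 * Q := by
    have h1 := h.norm_fst_sub_one_le hq hi (h.norm_snd_le hz) s
    have h2 := h'.norm_fst_sub_one_le hq hi (h'.norm_snd_le hw) s
    simp only [one_mul] at h1 h2
    have := norm_sub_le (x s - 1) (x' s - 1)
    rw [sub_sub_sub_cancel_right] at this
    linarith
  have hy : ‖y s - y' s‖ ≤ 2 * Q := by
    have h1 := h.norm_snd_le_integral hq hi hz s
    have h2 := h'.norm_snd_le_integral hq hi hw s
    have := norm_sub_le (y s) (y' s)
    linarith
  have hx2 := pow_le_pow_left₀ (norm_nonneg _) hx 2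
  have hy2 := pow_le_pow_left₀ (norm_nonneg _) hy 2
  simp only at ha
  nlinarith

/-- The divided differences of the normalized Jost solutions in the spectral parameter are
Lipschitz. -/
theorem norm_slope_sub_le {η : ℝ} (hη : 0 < η) {z' : ℂ} {x₀ y₀ : ℝ → ℂ}
    (h : IsNormalizedPhi q z x y) (h' : IsNormalizedPhi q z' x' y')
    (h₀ : IsNormalizedPhi q w x₀ y₀) (hz : η ≤ z.im) (hz' : η ≤ z'.im) (hw : η ≤ w.im)
    (hzw : z ≠ w) (hzw' : z' ≠ w) (t : ℝ) :
    ‖(x t - x₀ t) / (z - w) - (x' t - x₀ t) / (z' - w)‖ ^ 2 +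
      ‖(y t - y₀ t) / (z - w) - (y' t - y₀ t) / (z' - w)‖ ^ 2 ≤
      1 / (4 * η ^ 4) * ‖z - z'‖ ^ 2 := by
  have hd := sub_ne_zero.2 hzw
  have hd' := sub_ne_zero.2 hzw'
  have e1 := fun t => hasDerivAt_energy (q := q) (w := w)
    (x := fun t => (x t - x₀ t) / (z - w) - (x' t - x₀ t) / (z' - w))
    (y := fun t => (y t - y₀ t) / (z - w) - (y' t - y₀ t) / (z' - w))
    (f := fun t => 2 * I * (y t - y' t)) (t := t)
    (((((h.deriv_fst t).sub (h₀.deriv_fst t)).div_const (z - w)).sub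
      (((h'.deriv_fst t).sub (h₀.deriv_fst t)).div_const (z' - w))).congr_deriv (by ring))
    (((((h.deriv_snd t).sub (h₀.deriv_snd t)).div_const (z - w)).sub
      (((h'.deriv_snd t).sub (h₀.deriv_snd t)).div_const (z' - w))).congr_deriv
        (by field_simp; ring))
  have e2 := fun t => h.difference_deriv h' t
  have e3 := fun t => h.energy_deriv t
  -- A Lyapunov functional. The difference of the slopes is driven by y - y', which the dissipation
  -- of the difference energy absorbs; that energy is in turn driven by y, absorbed by the
  -- dissipation of the energy itself. The weights make the three contributions cancel exactly, and
  -- only the last term has a nonzero limit at -∞.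
  have hD := fun t => ((e1 t).add ((e2 t).const_mul (1 / (2 * η ^ 2)))).add
    ((e3 t).const_mul (1 / (4 * η ^ 4) * ‖z - z'‖ ^ 2))
  have hL := ((((h.lim_fst.sub h₀.lim_fst).div_const (z - w)).sub
      ((h'.lim_fst.sub h₀.lim_fst).div_const (z' - w))).norm.pow 2).add
      ((((h.lim_snd.sub h₀.lim_snd).div_const (z - w)).sub
      ((h'.lim_snd.sub h₀.lim_snd).div_const (z' - w))).norm.pow 2)
  have hL2 := (hL.add ((h.difference_lim h').const_mul (1 / (2 * η ^ 2)))).add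
    (h.energy_lim.const_mul (1 / (4 * η ^ 4) * ‖z - z'‖ ^ 2))
  have := le_of_hasDerivAt_nonpos hD (fun t => ?_) hL2 t
  · simp only [Pi.add_apply, sub_self, zero_div, norm_zero] at this
    have p1 : 0 ≤ 1 / (2 * η ^ 2) * (‖x t - x' t‖ ^ 2 + ‖y t - y' t‖ ^ 2) := by positivity
    have p2 : 0 ≤ 1 / (4 * η ^ 4) * ‖z - z'‖ ^ 2 * (‖x t‖ ^ 2 + ‖y t‖ ^ 2) := by positivity
    linarith
  · set e := (y t - y₀ t) / (z - w) - (y' t - y₀ t) / (z' - w)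
    set d := y t - y' t
    have b1 : (2 * I * d * conj e).re ≤ 2 * (‖d‖ * ‖e‖) := by
      refine (Complex.re_le_norm _).trans (le_of_eq ?_)
      simp only [norm_mul, RCLike.norm_conj, Complex.norm_ofNat, Complex.norm_I, mul_one]
      ring
    have b2 : (2 * I * (z - z') * y t * conj d).re ≤ 2 * (‖z - z'‖ * ‖y t‖ * ‖d‖) := by
      refine (Complex.re_le_norm _).trans (le_of_eq ?_)
      simp only [norm_mul, RCLike.norm_conj, Complex.norm_ofNat, Complex.norm_I, mul_one]
      ring
    have c1 : η * ‖e‖ ^ 2 ≤ w.im * ‖e‖ ^ 2 := by gcongr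
    have c2 : η * ‖d‖ ^ 2 ≤ z'.im * ‖d‖ ^ 2 := by gcongr
    have c3 : η * ‖y t‖ ^ 2 ≤ z.im * ‖y t‖ ^ 2 := by gcongr
    have f1 : -4 * w.im * ‖e‖ ^ 2 + 2 * (2 * I * d * conj e).re ≤ 1 / η * ‖d‖ ^ 2 := by
      have : 4 * (‖d‖ * ‖e‖) ≤ 1 / η * ‖d‖ ^ 2 + 4 * (η * ‖e‖ ^ 2) := by
        have h := sq_nonneg (‖d‖ - 2 * η * ‖e‖)
        have : 1 / η * ‖d‖ ^ 2 + 4 * (η * ‖e‖ ^ 2) - 4 * (‖d‖ * ‖e‖)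
          = 1 / η * (‖d‖ - 2 * η * ‖e‖) ^ 2 := by field_simp; ring
        have : 0 ≤ 1 / η * (‖d‖ - 2 * η * ‖e‖) ^ 2 := by positivity
        linarith
      linarith
    have f2 : -4 * z'.im * ‖d‖ ^ 2 + 2 * (2 * I * (z - z') * y t * conj d).re ≤
        -2 * η * ‖d‖ ^ 2 + 2 / η * (‖z - z'‖ ^ 2 * ‖y t‖ ^ 2) := by
      have : 4 * (‖z - z'‖ * ‖y t‖ * ‖d‖) ≤
          2 * η * ‖d‖ ^ 2 + 2 / η * (‖z - z'‖ ^ 2 * ‖y t‖ ^ 2) := by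
        have : 2 * η * ‖d‖ ^ 2 + 2 / η * (‖z - z'‖ ^ 2 * ‖y t‖ ^ 2)
          - 4 * (‖z - z'‖ * ‖y t‖ * ‖d‖) = 2 / η * (‖z - z'‖ * ‖y t‖ - η * ‖d‖) ^ 2 := by
          field_simp; ring
        have : 0 ≤ 2 / η * (‖z - z'‖ * ‖y t‖ - η * ‖d‖) ^ 2 := by positivity
        linarith
      linarith
    have f3 : -4 * z.im * ‖y t‖ ^ 2 ≤ -4 * (η * ‖y t‖ ^ 2) := by linarith
    calc _ ≤ 1 / η * ‖d‖ ^ 2 + 1 / (2 * η ^ 2) *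
          (-2 * η * ‖d‖ ^ 2 + 2 / η * (‖z - z'‖ ^ 2 * ‖y t‖ ^ 2)) +
          1 / (4 * η ^ 4) * ‖z - z'‖ ^ 2 * (-4 * (η * ‖y t‖ ^ 2)) := by gcongr
      _ = 0 := by field_simp; ring
end IsNormalizedPhi
end

/-! ### Holomorphy in the upper half-plane and the limit at infinity -/

section

theorem differentiableAt_of_exists_slope {f : ℂ → ℂ} {w : ℂ}
    (h : ∃ L, Tendsto (fun z => (f z - f w) / (z - w)) (𝓝[≠] w) (𝓝 L)) :
    DifferentiableAt ℂ f w := by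
  obtain ⟨L, hL⟩ := h
  refine HasDerivAt.differentiableAt (f' := L) ?_
  rw [hasDerivAt_iff_tendsto_slope]
  refine hL.congr fun z => ?_
  rw [slope_def_field]

theorem norm_le_of_sq_add_sq_le {a b : ℂ} {c : ℝ} (hc : 0 ≤ c) (h : ‖a‖ ^ 2 + ‖b‖ ^ 2 ≤ c ^ 2) :
    ‖a‖ ≤ c ∧ ‖b‖ ≤ c :=
  ⟨abs_le_of_sq_le_sq' (by nlinarith [sq_nonneg ‖b‖]) hc |>.2,
    abs_le_of_sq_le_sq' (by nlinarith [sq_nonneg ‖a‖]) hc |>.2⟩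

/-- A family of normalized Jost solutions over the closed upper half-plane. -/
def IsPhiFamily (q : ℝ → ℂ) (X Y : ℂ → ℝ → ℂ) : Prop :=
  ∀ z : ℂ, 0 ≤ z.im → IsNormalizedPhi q z (X z) (Y z)

namespace IsPhiFamily

variable {q : ℝ → ℂ} {X Y : ℂ → ℝ → ℂ}

/-- On the ball of radius Im w / 2 all imaginary parts are at least η = Im w / 2, so the slopes at w
are Lipschitz with constant 1 / (2η²) and converge. -/
theorem differentiableAt (h : IsPhiFamily q X Y) {w : ℂ} (hw : 0 < w.im) (t : ℝ) :
    DifferentiableAt ℂ (fun z => X z t) w ∧ DifferentiableAt ℂ (fun z => Y z t) w := by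
  set η := w.im / 2 with hη
  have hη0 : 0 < η := by positivity
  have him : ∀ z ∈ Metric.ball w η, η ≤ z.im := by
    intro z hz
    rw [Metric.mem_ball, dist_eq_norm] at hz
    have h1 := (Complex.abs_im_le_norm (z - w)).trans hz.le
    rw [Complex.sub_im] at h1
    have := (abs_le.1 h1).1
    linarith
  have key : ∀ z z', z ∈ Metric.ball w η → z' ∈ Metric.ball w η → z ≠ w → z' ≠ w →
      ‖(X z t - X w t) / (z - w) - (X z' t - X w t) / (z' - w)‖ ≤ 1 / (2 * η ^ 2) * ‖z - z'‖ ∧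
      ‖(Y z t - Y w t) / (z - w) - (Y z' t - Y w t) / (z' - w)‖ ≤ 1 / (2 * η ^ 2) * ‖z - z'‖ := by
    intro z z' hz hz' hzw hzw'
    refine norm_le_of_sq_add_sq_le (by positivity)
      ((IsNormalizedPhi.norm_slope_sub_le hη0 (h z (hη0.le.trans (him z hz)))
        (h z' (hη0.le.trans (him z' hz'))) (h w hw.le) (him z hz) (him z' hz')
        (by linarith) hzw hzw' t).trans (le_of_eq ?_))
    field_simp
    ring
  exact ⟨differentiableAt_of_exists_slope (exists_tendsto_of_norm_sub_le hη0
      fun z z' hz hz' a b => (key z z' hz hz' a b).1),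
    differentiableAt_of_exists_slope (exists_tendsto_of_norm_sub_le hη0
      fun z z' hz hz' a b => (key z z' hz hz' a b).2)⟩

theorem continuousOn (hq : Continuous q) (hi : Integrable q) (h : IsPhiFamily q X Y) (t : ℝ) :
    ContinuousOn (fun z => X z t) {z | 0 ≤ z.im} ∧
      ContinuousOn (fun z => Y z t) {z | 0 ≤ z.im} := by
  have key : ∀ w : ℂ, 0 ≤ w.im → ∀ ε > 0, ∃ δ > 0, ∀ z : ℂ, 0 ≤ z.im → dist z w < δ →
      dist (X z t) (X w t) < ε ∧ dist (Y z t) (Y w t) < ε := by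
    intro w hw ε hε
    -- First s is taken so far left that the tail of q contributes less than half of (ε/2)²; then δ
    -- makes 8‖z - w‖(t - s) at most the other half.
    have hlim : Tendsto (fun s => 8 * (∫ r in Set.Iic s, ‖q r‖) ^ 2) atBot (𝓝 (8 * 0 ^ 2)) :=
      ((tendsto_integral_Iic_zero tendsto_id).pow 2).const_mul 8
    have hev := hlim.eventually_lt_const (u := (ε / 2) ^ 2 / 2)
      (by simp only [ne_eq, OfNat.ofNat_ne_zero, not_false_eq_true, zero_pow, mul_zero]; positivity)
    obtain ⟨s, hs1, hs2⟩ := (hev.and (eventually_le_atBot t)).exists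
    have hts : 0 ≤ t - s := by linarith
    refine ⟨(ε / 2) ^ 2 / 2 / (8 * (t - s + 1)), by positivity, fun z hz hd => ?_⟩
    have h1 := (h z hz).difference_le hq hi (h w hw) hz hw hs2
    have h2 : 8 * ‖z - w‖ * (t - s) ≤ (ε / 2) ^ 2 / 2 := by
      rw [dist_eq_norm, lt_div_iff₀ (by positivity)] at hd
      nlinarith [norm_nonneg (z - w)]
    have h3 := norm_le_of_sq_add_sq_le (c := ε / 2) (by positivity)
      (h1.trans (by linarith))
    rw [dist_eq_norm, dist_eq_norm]
    constructor <;> linarith [h3.1, h3.2]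
  constructor
  · refine Metric.continuousOn_iff.2 fun w hw ε hε => ?_
    obtain ⟨δ, hδ, hh⟩ := key w hw ε hε
    exact ⟨δ, hδ, fun z hz hd => (hh z hz hd).1⟩
  · refine Metric.continuousOn_iff.2 fun w hw ε hε => ?_
    obtain ⟨δ, hδ, hh⟩ := key w hw ε hε
    exact ⟨δ, hδ, fun z hz hd => (hh z hz hd).2⟩

/-- A quantitative Riemann-Lebesgue lemma for normalized Jost solutions. -/
theorem norm_snd_le_of_approx (hq : Continuous q) (hi : Integrable q) (h : IsPhiFamily q X Y)
    {g : ℝ → ℂ} (hg : ContDiff ℝ 1 g) (hgc : HasCompactSupport g) {z : ℂ} (hz : 0 ≤ z.im)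
    (hz0 : z ≠ 0) {G : ℝ} (hG : ∀ t, ‖g t‖ ≤ G) (t : ℝ) :
    ‖Y z t‖ ≤ (∫ s, ‖conj (q s) - g s‖) +
      ((∫ s, (‖deriv g s‖ + G * ‖q s‖)) + G) / (2 * ‖z‖) := by
  have hh := h z hz
  have hX := hh.continuous_fst
  have hY := hh.continuous_snd
  have hcq : Continuous fun s => conj (q s) := Complex.continuous_conj.comp hq
  have hgcont := hg.continuous
  have hg' : Continuous (deriv g) := hg.continuous_deriv le_rfl
  have hcqi : Integrable fun s => conj (q s) := by
    refine (integrable_norm_iff hcq.aestronglyMeasurable).1 ?_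
    simpa using hi.norm
  have hgi : Integrable g := hgcont.integrable_of_hasCompactSupport hgc
  have hg'i : Integrable (deriv g) := hg'.integrable_of_hasCompactSupport hgc.deriv
  have hzn : 0 < ‖z‖ := norm_pos_iff.2 hz0
  have hG0 : 0 ≤ G := (norm_nonneg _).trans (hG 0)
  set c : ℂ := 2 * I * z
  have hc0 : c ≠ 0 := by simp [c, hz0]
  have hcn : ‖c‖ = 2 * ‖z‖ := by simp [c]
  -- Integration by parts in differential form: the correction g X / c replaces the source conj q ·
  -- X by (conj q - g) X, up to terms carrying the factor 1 / c.
  have hd : ∀ s, HasDerivAt (fun s => Y z s - g s * X z s / c)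
      (c * (Y z s - g s * X z s / c) + ((g s - conj (q s)) * X z s
        - (deriv g s * X z s + g s * (q s * Y z s)) / c)) s := by
    intro s
    refine ((hh.deriv_snd s).sub ((((hg.differentiable one_ne_zero s).hasDerivAt).mul
      (hh.deriv_fst s)).div_const c)).congr_deriv ?_
    field_simp
    ring
  have hlim : Tendsto (fun s => Y z s - g s * X z s / c) atBot (𝓝 0) := by
    have h1 : Tendsto g atBot (𝓝 0) :=
      hgc.is_zero_at_infty.mono_left (by rw [cocompact_eq_atBot_atTop]; exact le_sup_left)
    simpa using hh.lim_snd.sub ((h1.mul hh.lim_fst).div_const c)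
  have hH : Integrable fun s => ‖conj (q s) - g s‖ + (‖deriv g s‖ + G * ‖q s‖) / (2 * ‖z‖) :=
    (hcqi.sub hgi).norm.add ((hg'i.norm.add (hi.norm.const_mul G)).div_const _)
  have hle : ∀ s, ‖(g s - conj (q s)) * X z s
        - (deriv g s * X z s + g s * (q s * Y z s)) / c‖ ≤
      ‖conj (q s) - g s‖ + (‖deriv g s‖ + G * ‖q s‖) / (2 * ‖z‖) := by
    intro s
    refine (norm_sub_le _ _).trans (add_le_add ?_ ?_)
    · rw [norm_mul, norm_sub_rev]
      exact mul_le_of_le_one_right (norm_nonneg _) (hh.norm_fst_le hz s)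
    · rw [norm_div, hcn]
      gcongr
      refine (norm_add_le _ _).trans (add_le_add ?_ ?_)
      · rw [norm_mul]
        exact mul_le_of_le_one_right (norm_nonneg _) (hh.norm_fst_le hz s)
      · rw [norm_mul, norm_mul]
        gcongr
        · exact hG s
        · exact mul_le_of_le_one_right (norm_nonneg _) (hh.norm_snd_le hz s)
  have hn := norm_le_integral_of_hasDerivAt (by simpa [c] using hz) hd
    (by fun_prop (disch := assumption)) hH hle hlim t
  have hn2 : ‖Y z t - g t * X z t / c‖ ≤
      (∫ s, ‖conj (q s) - g s‖) + (∫ s, (‖deriv g s‖ + G * ‖q s‖)) / (2 * ‖z‖) := by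
    refine hn.trans ((setIntegral_le_integral hH (Eventually.of_forall fun s => ?_)).trans
      (le_of_eq ?_))
    · exact (norm_nonneg _).trans (hle s)
    · exact (integral_add (hcqi.sub hgi).norm
        ((hg'i.norm.add (hi.norm.const_mul G)).div_const _)).trans
        (congrArg _ (integral_div _ _))
  have hn3 : ‖g t * X z t / c‖ ≤ G / (2 * ‖z‖) := by
    rw [norm_div, hcn, norm_mul]
    gcongr
    exact (mul_le_of_le_one_right (norm_nonneg _) (hh.norm_fst_le hz t)).trans (hG t)
  have := norm_add_le (Y z t - g t * X z t / c) (g t * X z t / c)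
  rw [sub_add_cancel] at this
  rw [add_div]
  linarith

/-- Smooth compactly supported g are dense in L¹; with g fixed, the remaining term of the
quantitative estimate is O(1/‖z‖). The bound is uniform in t, so integrating q Y then controls X -
1. -/
theorem exists_norm_snd_le (hq : Continuous q) (hi : Integrable q) (h : IsPhiFamily q X Y)
    {ε : ℝ} (hε : 0 < ε) : ∃ R : ℝ, ∀ z : ℂ, 0 ≤ z.im → R ≤ ‖z‖ → ∀ t, ‖Y z t‖ ≤ ε := by
  have hcqi : Integrable fun s => conj (q s) := by
    refine (integrable_norm_iff (Complex.continuous_conj.comp hq).aestronglyMeasurable).1 ?_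
    simpa using hi.norm
  obtain ⟨g, hgc, hg, hge⟩ := (memLp_one_iff_integrable.2 hcqi).exist_eLpNorm_sub_le
    ENNReal.one_ne_top le_rfl (half_pos hε)
  have hgi : Integrable g := hg.continuous.integrable_of_hasCompactSupport hgc
  have hge' : ∫ s, ‖conj (q s) - g s‖ ≤ ε / 2 := by
    have h1 := integral_norm_eq_lintegral_enorm (hcqi.sub hgi).aestronglyMeasurable
    rw [eLpNorm_one_eq_lintegral_enorm] at hge
    exact h1.trans_le (ENNReal.toReal_le_of_le_ofReal (half_pos hε).le hge)
  obtain ⟨G, hG⟩ := hgc.exists_bound_of_continuous hg.continuous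
  set A := (∫ s, (‖deriv g s‖ + G * ‖q s‖)) + G
  refine ⟨(|A| + 1) / ε, fun z hz hR t => ?_⟩
  have hR0 : 0 < ‖z‖ := lt_of_lt_of_le (by positivity) hR
  have h1 := h.norm_snd_le_of_approx hq hi (hg.of_le (by exact_mod_cast le_top)) hgc hz
    (norm_pos_iff.1 hR0) hG t
  have h2 : A / (2 * ‖z‖) ≤ ε / 2 := by
    rw [div_le_iff₀ (by positivity)]
    rw [div_le_iff₀ hε] at hR
    linarith [le_abs_self A]
  linarith

theorem exists_norm_fst_sub_one_le (hq : Continuous q) (hi : Integrable q)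
    (h : IsPhiFamily q X Y) {ε : ℝ} (hε : 0 < ε) :
    ∃ R : ℝ, ∀ z : ℂ, 0 ≤ z.im → R ≤ ‖z‖ → ∀ t, ‖X z t - 1‖ ≤ ε := by
  set Q := ∫ s, ‖q s‖
  have hQ : 0 ≤ Q := by positivity
  obtain ⟨R, hR⟩ := h.exists_norm_snd_le hq hi (ε := ε / (Q + 1)) (by positivity)
  refine ⟨R, fun z hz hzR t => ?_⟩
  refine ((h z hz).norm_fst_sub_one_le hq hi (hR z hz hzR) t).trans ?_
  refine (setIntegral_le_integral (hi.norm.const_mul _)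
    (Eventually.of_forall fun s => by positivity)).trans ?_
  rw [integral_const_mul, div_mul_eq_mul_div, div_le_iff₀ (by positivity)]
  nlinarith

theorem tendsto_cobounded (hq : Continuous q) (hi : Integrable q) (h : IsPhiFamily q X Y) (t : ℝ) :
    Tendsto (fun z => X z t) (Bornology.cobounded ℂ ⊓ 𝓟 {z | 0 ≤ z.im}) (𝓝 1) ∧
      Tendsto (fun z => Y z t) (Bornology.cobounded ℂ ⊓ 𝓟 {z | 0 ≤ z.im}) (𝓝 0) := by
  have hR : ∀ R : ℝ, ∀ᶠ z in Bornology.cobounded ℂ ⊓ 𝓟 {z : ℂ | 0 ≤ z.im}, 0 ≤ z.im ∧ R ≤ ‖z‖ :=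
    fun R => ((eventually_principal.2 fun z hz => hz).filter_mono inf_le_right).and
      ((tendsto_norm_cobounded_atTop.eventually_ge_atTop R).filter_mono inf_le_left)
  constructor
  · refine Metric.tendsto_nhds.2 fun ε hε => ?_
    obtain ⟨R, hh⟩ := h.exists_norm_fst_sub_one_le hq hi (half_pos hε)
    filter_upwards [hR R] with z hz
    rw [dist_eq_norm]
    linarith [hh z hz.1 hz.2 t]
  · refine Metric.tendsto_nhds.2 fun ε hε => ?_
    obtain ⟨R, hh⟩ := h.exists_norm_snd_le hq hi (half_pos hε)
    filter_upwards [hR R] with z hz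
    rw [dist_eq_norm, sub_zero]
    linarith [hh z hz.1 hz.2 t]

end IsPhiFamily
end

section

/-! ### Bounded holomorphic functions on the upper half-plane -/

/-- Bounded continuous functions on the closed upper half-plane, holomorphic in its interior. -/
structure IsBoundedHolo (f : ℂ → ℂ) : Prop where
  diff : DifferentiableOn ℂ f {z | 0 < z.im}
  cont : ContinuousOn f {z | 0 ≤ z.im}
  bdd : ∃ C, ∀ z : ℂ, 0 ≤ z.im → ‖f z‖ ≤ C

theorem isOpen_upper : IsOpen {z : ℂ | 0 < z.im} := isOpen_lt continuous_const Complex.continuous_im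

namespace IsBoundedHolo

variable {f g : ℂ → ℂ}

theorem const (c : ℂ) : IsBoundedHolo fun _ => c :=
  ⟨differentiableOn_const c, continuousOn_const, ‖c‖, fun _ _ => le_rfl⟩

theorem add (hf : IsBoundedHolo f) (hg : IsBoundedHolo g) : IsBoundedHolo fun z => f z + g z := by
  obtain ⟨C, hC⟩ := hf.bdd
  obtain ⟨D, hD⟩ := hg.bdd
  exact ⟨hf.diff.add hg.diff, hf.cont.add hg.cont, C + D, fun z hz =>
    (norm_add_le _ _).trans (add_le_add (hC z hz) (hD z hz))⟩

theorem mul (hf : IsBoundedHolo f) (hg : IsBoundedHolo g) : IsBoundedHolo fun z => f z * g z := by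
  obtain ⟨C, hC⟩ := hf.bdd
  obtain ⟨D, hD⟩ := hg.bdd
  exact ⟨hf.diff.mul hg.diff, hf.cont.mul hg.cont, C * D, fun z hz => by
    rw [norm_mul]
    exact mul_le_mul (hC z hz) (hD z hz) (norm_nonneg _) ((norm_nonneg _).trans (hC z hz))⟩

theorem sub (hf : IsBoundedHolo f) (hg : IsBoundedHolo g) : IsBoundedHolo fun z => f z - g z := by
  simpa [sub_eq_add_neg] using hf.add ((const (-1)).mul hg)

/-- The maximum principle in the upper half-plane. -/
theorem norm_le (hf : IsBoundedHolo f) {C : ℝ} (hC : ∀ x : ℝ, ‖f x‖ ≤ C) {z : ℂ}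
    (hz : 0 ≤ z.im) : ‖f z‖ ≤ C := by
  obtain ⟨D, hD⟩ := hf.bdd
  have hcl : closure {z : ℂ | 0 < z.re} = {z | 0 ≤ z.re} := Complex.closure_setOfPred_lt_re 0
  -- Multiplication by i maps the right half-plane to the upper one and the imaginary axis to the
  -- real line.
  have h := PhragmenLindelof.right_half_plane_of_bounded_on_real (f := fun w => f (I * w)) (C := C)
    (z := -I * z) ⟨?_, ?_⟩ ⟨1, by norm_num, 0, ?_⟩ ?_ ?_ (by simpa using hz)
  · have e : I * (-I * z) = z := by rw [← mul_assoc, mul_neg, I_mul_I, neg_neg, one_mul]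
    simpa only [e] using h
  · exact hf.diff.comp (by fun_prop) fun w hw => by simpa using hw
  · rw [hcl]
    exact hf.cont.comp (by fun_prop) fun w hw => by simpa using hw
  · refine Asymptotics.IsBigO.of_bound D ?_
    filter_upwards [mem_inf_of_right (mem_principal_self _)] with w hw
    have := hD (I * w) (by simpa using le_of_lt hw)
    simpa using this
  · refine isBoundedUnder_of_eventually_le (a := D) ?_
    filter_upwards [eventually_ge_atTop 0] with x hx
    exact hD _ (by simpa using hx)
  · intro x
    have e : I * ((x : ℂ) * I) = ((-x : ℝ) : ℂ) := by
      rw [mul_left_comm, I_mul_I]; simp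
    simpa only [e] using hC (-x)

/-- A zero in the upper half-plane can be divided out by a Blaschke factor. -/
theorem exists_div (hf : IsBoundedHolo f) {w : ℂ} (hw : 0 < w.im) (h0 : f w = 0) :
    ∃ g, IsBoundedHolo g ∧ ∀ z, (z - w) * g z = (z - conj w) * f z := by
  have hn : {z : ℂ | 0 < z.im} ∈ 𝓝 w := isOpen_upper.mem_nhds hw
  have hn' : {z : ℂ | 0 ≤ z.im} ∈ 𝓝 w := mem_of_superset hn fun z (hz : 0 < z.im) => hz.le
  have hd : DifferentiableOn ℂ (dslope f w) {z | 0 < z.im} :=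
    (Complex.differentiableOn_dslope hn).2 hf.diff
  have hc : ContinuousOn (dslope f w) {z | 0 ≤ z.im} :=
    (continuousOn_dslope hn').2 ⟨hf.cont, hf.diff.differentiableAt hn⟩
  have hs : ∀ z, (z - w) * dslope f w z = f z := fun z => by
    simpa [h0] using sub_smul_dslope f w z
  have hcg : ContinuousOn (fun z => (z - conj w) * dslope f w z) {z | 0 ≤ z.im} :=
    ContinuousOn.mul (by fun_prop) hc
  refine ⟨fun z => (z - conj w) * dslope f w z,
    ⟨DifferentiableOn.mul (by fun_prop) hd, hcg, ?_⟩, fun z => ?_⟩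
  · obtain ⟨C, hC⟩ := hf.bdd
    have hball : Metric.closedBall w w.im ⊆ {z : ℂ | 0 ≤ z.im} := by
      intro z hz
      rw [Metric.mem_closedBall, dist_eq_norm] at hz
      have h1 := (Complex.abs_im_le_norm (z - w)).trans hz
      rw [Complex.sub_im] at h1
      have := (abs_le.1 h1).1
      simp only [Set.mem_ofPred_eq]
      linarith
    obtain ⟨D, hD⟩ := (isCompact_closedBall w w.im).exists_bound_of_continuousOn (hcg.mono hball)
    -- Compactness bounds the quotient on the disc of radius Im w about w. Off the disc, ‖w - conj
    -- w‖ = 2 Im w ≤ 2‖z - w‖, so the Blaschke factor inverts at the cost of a factor 3.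
    refine ⟨max D (3 * C), fun z hz => ?_⟩
    by_cases hzw : z ∈ Metric.closedBall w w.im
    · exact (hD z hzw).trans (le_max_left _ _)
    · refine le_trans ?_ (le_max_right _ _)
      rw [Metric.mem_closedBall, dist_eq_norm, not_le] at hzw
      have h2 : ‖z - conj w‖ ≤ 3 * ‖z - w‖ := by
        have e : z - conj w = (z - w) + (w - conj w) := by ring
        have h3 : ‖w - conj w‖ = 2 * w.im := by
          rw [Complex.sub_conj, norm_mul, Complex.norm_I, mul_one, Complex.norm_real,
            Real.norm_of_nonneg (by positivity)]
        have := norm_add_le (z - w) (w - conj w)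
        rw [e]; linarith
      have h4 := hC z hz
      rw [← hs z, norm_mul] at h4
      rw [norm_mul]
      calc _ ≤ 3 * ‖z - w‖ * ‖dslope f w z‖ := by gcongr
        _ ≤ 3 * C := by linarith
  · rw [mul_left_comm, hs]

theorem exists_div_prod (hf : IsBoundedHolo f) (s : Finset ℂ) (hs : ∀ w ∈ s, 0 < w.im)
    (h0 : ∀ w ∈ s, f w = 0) : ∃ g, IsBoundedHolo g ∧
      ∀ z, (∏ w ∈ s, (z - w)) * g z = (∏ w ∈ s, (z - conj w)) * f z := by
  classical
  induction s using Finset.induction_on with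
  | empty => exact ⟨f, hf, fun z => by simp⟩
  | insert w s hws ih =>
    obtain ⟨g, hg, hgf⟩ := ih (fun v hv => hs v (Finset.mem_insert_of_mem hv))
      (fun v hv => h0 v (Finset.mem_insert_of_mem hv))
    -- Dividing out the other zeros does not affect the zero at w, since w is none of them.
    have hgw : g w = 0 := by
      have := hgf w
      rw [h0 w (Finset.mem_insert_self w s), mul_zero, mul_eq_zero, Finset.prod_eq_zero_iff] at this
      rcases this with ⟨v, hv, hv0⟩ | h
      · rw [sub_eq_zero] at hv0
        exact absurd (hv0 ▸ hv) hws
      · exact h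
    obtain ⟨k, hk, hkg⟩ := hg.exists_div (hs w (Finset.mem_insert_self w s)) hgw
    refine ⟨k, hk, fun z => ?_⟩
    rw [Finset.prod_insert hws, Finset.prod_insert hws]
    linear_combination (∏ v ∈ s, (z - v)) * hkg z + (z - conj w) * hgf z

end IsBoundedHolo

/-- Conjugation at a real point swaps the two products. Hence dividing out Blaschke factors leaves
the modulus on the real line unchanged. -/
theorem norm_prod_sub_conj (s : Finset ℂ) (x : ℝ) :
    ‖∏ w ∈ s, ((x : ℂ) - conj w)‖ = ‖∏ w ∈ s, ((x : ℂ) - w)‖ := by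
  rw [← RCLike.norm_conj, map_prod]
  simp

theorem sub_conj_ne_zero {z w : ℂ} (hz : 0 ≤ z.im) (hw : 0 < w.im) : z - conj w ≠ 0 := by
  intro h
  have := congrArg Complex.im h
  simp at this
  linarith

theorem prod_sub_conj_ne_zero {s : Finset ℂ} (hs : ∀ w ∈ s, 0 < w.im) {z : ℂ} (hz : 0 ≤ z.im) :
    ∏ w ∈ s, (z - conj w) ≠ 0 :=
  Finset.prod_ne_zero_iff.2 fun w hw => sub_conj_ne_zero hz (hs w hw)

theorem prod_sub_ne_zero {s : Finset ℂ} {z : ℂ} (hz : z ∉ s) : ∏ w ∈ s, (z - w) ≠ 0 :=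
  Finset.prod_ne_zero_iff.2 fun _ hw => sub_ne_zero.2 fun h => hz (h ▸ hw)

/-- Each factor is 1 + (conj w - w) / (z - conj w). -/
theorem tendsto_blaschke (s : Finset ℂ) :
    Tendsto (fun z : ℂ => (∏ w ∈ s, (z - w)) / ∏ w ∈ s, (z - conj w)) (Bornology.cobounded ℂ)
      (𝓝 1) := by
  have h1 : ∀ w : ℂ, Tendsto (fun z : ℂ => (z - w) / (z - conj w)) (Bornology.cobounded ℂ)
      (𝓝 1) := by
    intro w
    have h2 : Tendsto (fun z : ℂ => z - conj w) (Bornology.cobounded ℂ) (Bornology.cobounded ℂ) := by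
      rw [← tendsto_norm_atTop_iff_cobounded]
      refine tendsto_atTop_mono (fun z => ?_)
        (tendsto_atTop_add_const_right _ (-‖conj w‖) tendsto_norm_cobounded_atTop)
      rw [← sub_eq_add_neg]
      exact norm_sub_norm_le _ _
    have h3 : Tendsto (fun z : ℂ => 1 + (conj w - w) * (z - conj w)⁻¹) (Bornology.cobounded ℂ)
        (𝓝 (1 + (conj w - w) * 0)) :=
      ((tendsto_inv₀_cobounded.comp h2).const_mul _).const_add 1
    rw [mul_zero, add_zero] at h3
    refine h3.congr' ?_
    filter_upwards [tendsto_norm_cobounded_atTop.eventually_gt_atTop ‖conj w‖] with z hz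
    have : z - conj w ≠ 0 := sub_ne_zero.2 fun h => hz.ne' (congrArg norm h)
    field_simp
    ring
  simp_rw [← Finset.prod_div_distrib]
  simpa using tendsto_finsetProd s fun w _ => h1 w

end

/-! ### Scattering coefficients as Blaschke products -/

section

/-- The filter of neighbourhoods of infinity in the closed upper half-plane. -/
noncomputable def upperInfinity : Filter ℂ := Bornology.cobounded ℂ ⊓ 𝓟 {z | 0 ≤ z.im}

theorem exists_of_eventually_upperInfinity {p : ℂ → Prop} (h : ∀ᶠ z in upperInfinity, p z) :
    ∃ R : ℝ, ∀ z : ℂ, 0 ≤ z.im → R < ‖z‖ → p z := by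
  rw [upperInfinity, eventually_inf_principal,
    (Metric.hasBasis_cobounded_compl_closedBall (0 : ℂ)).eventually_iff] at h
  obtain ⟨R, -, hR⟩ := h
  exact ⟨R, fun z hz hzR => hR (by simpa using hzR) hz⟩

/-- A scattering coefficient of modulus one on the real line is a Blaschke product up to a
unimodular factor. -/
theorem norm_eq_blaschke {a : ℂ → ℂ} (ha : IsBoundedHolo a) (hreal : ∀ x : ℝ, ‖a x‖ = 1)
    (hlim : Tendsto a upperInfinity (𝓝 1)) {s : Finset ℂ} (hs : ∀ w ∈ s, 0 < w.im)
    (hzero : ∀ z : ℂ, 0 < z.im → (a z = 0 ↔ z ∈ s)) (hsimple : ∀ w ∈ s, deriv a w ≠ 0)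
    {z : ℂ} (hz : 0 ≤ z.im) :
    ‖∏ w ∈ s, (z - w)‖ = ‖∏ w ∈ s, (z - conj w)‖ * ‖a z‖ := by
  obtain ⟨h, hh, hha⟩ := ha.exists_div_prod s hs fun w hw => (hzero w (hs w hw)).2 hw
  have hsx : ∀ x : ℝ, (x : ℂ) ∉ s := fun x hx => by simpa using hs x hx
  have hhx : ∀ x : ℝ, ‖h x‖ = 1 := by
    intro x
    have h1 := congrArg norm (hha x)
    rw [norm_mul, norm_mul, hreal, norm_prod_sub_conj] at h1
    exact mul_left_cancel₀ (norm_ne_zero_iff.2 (prod_sub_ne_zero (hsx x))) h1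
  -- In the interior a zero of the quotient h would be one of the eigenvalues. Differentiating ∏(z -
  -- w) · h = ∏(z - conj w) · a there, every term vanishes except the one with a', which contradicts
  -- simplicity.
  have hne : ∀ z : ℂ, 0 ≤ z.im → h z ≠ 0 := by
    intro z hz h0
    rcases hz.eq_or_lt with hz0 | hz0
    · have e : z = (z.re : ℂ) := Complex.ext rfl (by simp [← hz0])
      have := hhx z.re
      rw [← e, h0, norm_zero] at this
      exact zero_ne_one this
    · have h1 := hha z
      rw [h0, mul_zero, eq_comm, mul_eq_zero, or_iff_right (prod_sub_conj_ne_zero hs hz)] at h1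
      have hzs := (hzero z hz0).1 h1
      have hn : {z : ℂ | 0 < z.im} ∈ 𝓝 z := isOpen_upper.mem_nhds hz0
      have hP : DifferentiableAt ℂ (fun v => ∏ w ∈ s, (v - w)) z := by fun_prop
      have hP' : DifferentiableAt ℂ (fun v => ∏ w ∈ s, (v - conj w)) z := by fun_prop
      have d1 := hP.hasDerivAt.mul (hh.diff.differentiableAt hn).hasDerivAt
      have d2 := hP'.hasDerivAt.mul (ha.diff.differentiableAt hn).hasDerivAt
      have e : (fun v => ∏ w ∈ s, (v - w)) * h = (fun v => ∏ w ∈ s, (v - conj w)) * a :=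
        funext hha
      rw [e] at d1
      have h2 := d1.unique d2
      rw [h0, h1, Finset.prod_eq_zero hzs (sub_self z)] at h2
      simp only [mul_zero, zero_mul, zero_add] at h2
      exact mul_ne_zero (prod_sub_conj_ne_zero hs hz) (hsimple z hzs) h2.symm
  have hinv : IsBoundedHolo fun z => (h z)⁻¹ := by
    refine ⟨hh.diff.inv fun z hz => hne z (le_of_lt hz), hh.cont.inv₀ fun z hz => hne z hz, ?_⟩
    -- Boundedness of 1/h: near infinity h is close to 1, and on the rest of the closed half-plane,
    -- which is compact, 1/h is continuous.
    have hlim2 : Tendsto h upperInfinity (𝓝 1) := by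
      have h1 : Tendsto (fun z : ℂ => (∏ w ∈ s, (z - w)) / ∏ w ∈ s, (z - conj w)) upperInfinity
          (𝓝 1) := (tendsto_blaschke s).mono_left inf_le_left
      have h2 := hlim.div h1 one_ne_zero
      rw [div_one] at h2
      refine h2.congr' ?_
      filter_upwards [h1.eventually_ne one_ne_zero, mem_inf_of_right (mem_principal_self _)]
        with z hz hz'
      have hc := prod_sub_conj_ne_zero hs hz'
      have hc' : ∏ w ∈ s, (z - w) ≠ 0 := fun h => hz (by simp [h])
      have := hha z
      simp only [Pi.div_apply]
      field_simp
      linear_combination -this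
    obtain ⟨R, hR⟩ := exists_of_eventually_upperInfinity
      ((hlim2.norm.eventually_const_lt (u := (1 / 2 : ℝ)) (by norm_num)))
    have hK : IsCompact (Metric.closedBall (0 : ℂ) R ∩ {z | 0 ≤ z.im}) :=
      (isCompact_closedBall 0 R).inter_right
        (isClosed_le continuous_const Complex.continuous_im)
    obtain ⟨D, hD⟩ := hK.exists_bound_of_continuousOn
      ((hh.cont.inv₀ fun z hz => hne z hz).mono Set.inter_subset_right)
    refine ⟨max D 2, fun z hz => ?_⟩
    by_cases hzR : ‖z‖ ≤ R
    · exact (hD z ⟨by simpa using hzR, hz⟩).trans (le_max_left _ _)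
    · have h1 := hR z hz (not_le.1 hzR)
      refine le_trans ?_ (le_max_right _ _)
      rw [norm_inv]
      exact inv_le_of_inv_le₀ (by norm_num) (by linarith)
  -- The maximum principle for h and for 1/h together gives ‖h‖ = 1.
  have hle := hh.norm_le (fun x => (hhx x).le) hz
  have hge := hinv.norm_le (C := 1) (fun x => by rw [norm_inv, hhx, inv_one]) hz
  rw [norm_inv] at hge
  have hpos : 0 < ‖h z‖ := norm_pos_iff.2 (hne z hz)
  have hge' : 1 ≤ ‖h z‖ := by
    rwa [inv_le_one₀ hpos] at hge
  rw [← norm_mul, ← hha z, norm_mul, le_antisymm hle hge', mul_one]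

/-! ### Hermitian geometry of `ℂ²` -/

/-- The square of the Euclidean norm. -/
noncomputable def sqNorm (v : Fin 2 → ℂ) : ℝ := ‖v 0‖ ^ 2 + ‖v 1‖ ^ 2

/-- The Hermitian inner product, conjugate linear in the first argument. -/
noncomputable def herm (u v : Fin 2 → ℂ) : ℂ := conj (u 0) * v 0 + conj (u 1) * v 1

theorem sqNorm_nonneg (v : Fin 2 → ℂ) : 0 ≤ sqNorm v := by unfold sqNorm; positivity

theorem ofReal_sqNorm (v : Fin 2 → ℂ) : (sqNorm v : ℂ) = herm v v := by
  simp [sqNorm, herm, Complex.conj_mul']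

theorem ofReal_norm_sq (a : ℂ) : ((‖a‖ ^ 2 : ℝ) : ℂ) = conj a * a := by
  rw [Complex.conj_mul']; simp

/-- Lagrange's identity. -/
theorem norm_wronskian_sq_add (u v : Fin 2 → ℂ) :
    ‖wronskian u v‖ ^ 2 + ‖herm u v‖ ^ 2 = sqNorm u * sqNorm v := by
  have : ((‖wronskian u v‖ ^ 2 + ‖herm u v‖ ^ 2 : ℝ) : ℂ) = ((sqNorm u * sqNorm v : ℝ) : ℂ) := by
    rw [ofReal_add, ofReal_norm_sq, ofReal_norm_sq, ofReal_mul, ofReal_sqNorm, ofReal_sqNorm]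
    simp only [wronskian, herm, map_add, map_sub, map_mul, conj_conj]
    ring
  exact_mod_cast this

theorem norm_herm_sq_le (u v : Fin 2 → ℂ) : ‖herm u v‖ ^ 2 ≤ sqNorm u * sqNorm v := by
  rw [← norm_wronskian_sq_add]; nlinarith [sq_nonneg ‖wronskian u v‖]

theorem norm_wronskian_sq_le (u v : Fin 2 → ℂ) : ‖wronskian u v‖ ^ 2 ≤ sqNorm u * sqNorm v := by
  rw [← norm_wronskian_sq_add]; nlinarith [sq_nonneg ‖herm u v‖]

/-- The equality case of the Cauchy-Schwarz inequality: expanding ‖u - v‖² gives zero. -/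
theorem eq_of_sqNorm_sub {u v : Fin 2 → ℂ} (h : herm u v = sqNorm v) (h' : sqNorm u = sqNorm v) :
    u = v := by
  have e : ((sqNorm (u - v) : ℝ) : ℂ) = 0 := by
    have hc : herm v u = sqNorm v := by
      have := congrArg conj h
      rw [conj_ofReal] at this
      rw [← this]
      simp only [herm, map_add, map_mul, conj_conj]
      ring
    have hu := ofReal_sqNorm u
    have hv := ofReal_sqNorm v
    rw [h'] at hu
    rw [ofReal_sqNorm]
    simp only [herm, Pi.sub_apply, map_sub] at *
    linear_combination -hu - hv - h - hc
  have e' : sqNorm (u - v) = 0 := by exact_mod_cast e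
  unfold sqNorm at e'
  have h0 : ‖(u - v) 0‖ ^ 2 = 0 := by nlinarith [sq_nonneg ‖(u - v) 0‖, sq_nonneg ‖(u - v) 1‖]
  have h1 : ‖(u - v) 1‖ ^ 2 = 0 := by nlinarith [sq_nonneg ‖(u - v) 0‖, sq_nonneg ‖(u - v) 1‖]
  rw [sq_eq_zero_iff, norm_eq_zero, Pi.sub_apply, sub_eq_zero] at h0 h1
  funext i
  fin_cases i
  · exact h0
  · exact h1

/-- An orthonormal basis of `ℂ²`. -/
structure IsOrthonormalPair (u v : Fin 2 → ℂ) : Prop where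
  fst : sqNorm u = 1
  snd : sqNorm v = 1
  orth : herm u v = 0

namespace IsOrthonormalPair

variable {u v u' v' : Fin 2 → ℂ}

theorem norm_wronskian (h : IsOrthonormalPair u v) : ‖wronskian u v‖ = 1 := by
  have := norm_wronskian_sq_add u v
  rw [h.fst, h.snd, h.orth, norm_zero] at this
  have h1 : ‖wronskian u v‖ ^ 2 = 1 := by linarith
  nlinarith [norm_nonneg (wronskian u v)]

theorem sqNorm_combination (h : IsOrthonormalPair u v) (α β : ℂ) :
    sqNorm (α • u + β • v) = ‖α‖ ^ 2 + ‖β‖ ^ 2 := by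
  have h1 := ofReal_sqNorm u
  have h2 := ofReal_sqNorm v
  have h3 := h.orth
  have h4 := congrArg conj h.orth
  rw [h.fst] at h1
  rw [h.snd] at h2
  have : ((sqNorm (α • u + β • v) : ℝ) : ℂ) = ((‖α‖ ^ 2 + ‖β‖ ^ 2 : ℝ) : ℂ) := by
    rw [ofReal_sqNorm, ofReal_add, ofReal_norm_sq, ofReal_norm_sq]
    simp only [herm, Pi.add_apply, Pi.smul_apply, smul_eq_mul, map_add, map_mul, conj_conj,
      map_zero, ofReal_one] at *
    linear_combination -(conj α * α) * h1 - (conj β * β) * h2 + conj α * β * h3 + conj β * α * h4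
  exact_mod_cast this

/-- By Cramer's rule the two Wronskians are the coordinates of x in the basis (u, v) times W(u, v),
which is unimodular. -/
theorem sqNorm_coordinates (h : IsOrthonormalPair u v) (x : Fin 2 → ℂ) :
    ‖wronskian x v‖ ^ 2 + ‖wronskian u x‖ ^ 2 = sqNorm x := by
  have h1 := norm_wronskian_sq_add x v
  rw [h.snd, mul_one] at h1
  have h2 : ‖wronskian u x‖ ^ 2 = ‖herm x v‖ ^ 2 := by
    have e : wronskian u x = wronskian u v * herm v x := by
      have h3 := ofReal_sqNorm v
      have h4 := h.orth
      have h5 := congrArg conj h.orth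
      rw [h.snd] at h3
      simp only [herm, wronskian, map_add, map_mul, conj_conj, map_zero, ofReal_one] at *
      linear_combination (u 0 * x 1 - u 1 * x 0) * h3 + (x 1 * v 0 - x 0 * v 1) * h5
    have e2 : herm v x = conj (herm x v) := by
      simp only [herm, map_add, map_mul, conj_conj]; ring
    rw [e, norm_mul, h.norm_wronskian, one_mul, e2, RCLike.norm_conj]
  linarith

end IsOrthonormalPair
end

/-! ### Uniqueness of reflectionless Jost solutions -/

section

/-- Normalized reflectionless Jost solutions at a fixed time, as functions of the spectral
parameter in the closed upper half-plane, with eigenvalues `s` and norming constants `c`. -/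
structure IsReflectionlessPair (s : Finset ℂ) (c : ℂ → ℂ) (m n : ℂ → Fin 2 → ℂ) : Prop where
  holo_fst : ∀ i, IsBoundedHolo fun z => m z i
  holo_snd : ∀ i, IsBoundedHolo fun z => n z i
  real : ∀ x : ℝ, IsOrthonormalPair (m x) (n x)
  lim_fst : Tendsto m upperInfinity (𝓝 ![1, 0])
  lim_snd : Tendsto n upperInfinity (𝓝 ![0, 1])
  zero : ∀ w ∈ s, m w = c w • n w

instance upperInfinity_upper_neBot : (upperInfinity ⊓ 𝓟 {z : ℂ | 0 < z.im}).NeBot := by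
  have h : Tendsto (fun y : ℝ => (y : ℂ) * I) atTop (upperInfinity ⊓ 𝓟 {z : ℂ | 0 < z.im}) := by
    refine tendsto_inf.2 ⟨tendsto_inf.2 ⟨?_, ?_⟩, ?_⟩
    · rw [← tendsto_norm_atTop_iff_cobounded]
      simpa using tendsto_abs_atTop_atTop
    · refine tendsto_principal.2 ?_
      filter_upwards [eventually_ge_atTop 0] with y hy
      simpa using hy
    · refine tendsto_principal.2 ?_
      filter_upwards [eventually_gt_atTop 0] with y hy
      simpa using hy
  exact h.neBot

namespace IsReflectionlessPair

variable {s : Finset ℂ} {c : ℂ → ℂ} {m n m' n' : ℂ → Fin 2 → ℂ}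

theorem holo_wronskian (h : IsReflectionlessPair s c m n) :
    IsBoundedHolo fun z => wronskian (m z) (n z) :=
  ((h.holo_fst 0).mul (h.holo_snd 1)).sub ((h.holo_fst 1).mul (h.holo_snd 0))

theorem lim_wronskian (h : IsReflectionlessPair s c m n) :
    Tendsto (fun z => wronskian (m z) (n z)) upperInfinity (𝓝 1) := by
  have h1 := tendsto_pi_nhds.1 h.lim_fst
  have h2 := tendsto_pi_nhds.1 h.lim_snd
  simpa [wronskian] using ((h1 0).mul (h2 1)).sub ((h1 1).mul (h2 0))

/-- The vector with coordinates `W(x, n')`, `W(m', x)` in the basis `(m, n)`. -/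
def transfer (m n m' n' : ℂ → Fin 2 → ℂ) (x : Fin 2 → ℂ) (z : ℂ) : Fin 2 → ℂ :=
  wronskian x (n' z) • m z + wronskian (m' z) x • n z

theorem holo_transfer (h : IsReflectionlessPair s c m n) (h' : IsReflectionlessPair s c m' n')
    (x y : Fin 2 → ℂ) : IsBoundedHolo fun z => herm y (transfer m n m' n' x z) := by
  have e1 := ((IsBoundedHolo.const (x 0)).mul (h'.holo_snd 1)).sub
    ((IsBoundedHolo.const (x 1)).mul (h'.holo_snd 0))
  have e2 := ((h'.holo_fst 0).mul (IsBoundedHolo.const (x 1))).sub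
    ((h'.holo_fst 1).mul (IsBoundedHolo.const (x 0)))
  exact ((IsBoundedHolo.const (conj (y 0))).mul
      ((e1.mul (h.holo_fst 0)).add (e2.mul (h.holo_snd 0)))).add
    ((IsBoundedHolo.const (conj (y 1))).mul
      ((e1.mul (h.holo_fst 1)).add (e2.mul (h.holo_snd 1))))

theorem lim_transfer (h : IsReflectionlessPair s c m n) (h' : IsReflectionlessPair s c m' n')
    (x y : Fin 2 → ℂ) :
    Tendsto (fun z => herm y (transfer m n m' n' x z)) upperInfinity (𝓝 (herm y x)) := by
  have h1 := tendsto_pi_nhds.1 h.lim_fst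
  have h2 := tendsto_pi_nhds.1 h.lim_snd
  have h1' := tendsto_pi_nhds.1 h'.lim_fst
  have h2' := tendsto_pi_nhds.1 h'.lim_snd
  have e1 := ((h2' 1).const_mul (x 0)).sub ((h2' 0).const_mul (x 1))
  have e2 := ((h1' 0).mul_const (x 1)).sub ((h1' 1).mul_const (x 0))
  simpa [herm, transfer, wronskian] using
    (((e1.mul (h1 0)).add (e2.mul (h2 0))).const_mul (conj (y 0))).add
      (((e1.mul (h1 1)).add (e2.mul (h2 1))).const_mul (conj (y 1)))

/-- Here it matters that both pairs have the same norming constants: with m = c n and m' = c n' the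
two summands are c W(x, n') n and c W(n', x) n, which cancel. These zeros compensate those of W(m',
n') in the quotient. -/
theorem transfer_zero (h : IsReflectionlessPair s c m n) (h' : IsReflectionlessPair s c m' n')
    (x : Fin 2 → ℂ) {w : ℂ} (hw : w ∈ s) : transfer m n m' n' x w = 0 := by
  funext i
  simp only [transfer, wronskian, h.zero w hw, h'.zero w hw, Pi.add_apply, Pi.smul_apply,
    smul_eq_mul, Pi.zero_apply]
  ring

/-- Reflectionless Jost solutions are determined by eigenvalues and norming constants. -/
theorem unique (h : IsReflectionlessPair s c m n) (h' : IsReflectionlessPair s c m' n')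
    (hs : ∀ w ∈ s, 0 < w.im)
    (ha' : ∀ z : ℂ, 0 ≤ z.im →
      wronskian (m' z) (n' z) * ∏ w ∈ s, (z - conj w) = ∏ w ∈ s, (z - w))
    (ha : ∀ z : ℂ, 0 ≤ z.im →
      ‖∏ w ∈ s, (z - w)‖ = ‖∏ w ∈ s, (z - conj w)‖ * ‖wronskian (m z) (n z)‖)
    {z₀ : ℂ} (hz₀ : 0 < z₀.im) (hz₀s : z₀ ∉ s) : m z₀ = m' z₀ ∧ n z₀ = n' z₀ := by
  set B := wronskian (m' z₀) (n' z₀) with hB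
  have hBP := ha' z₀ hz₀.le
  rw [← hB] at hBP
  have hP := prod_sub_conj_ne_zero hs hz₀.le
  have hP' := prod_sub_ne_zero hz₀s
  have hB0 : B ≠ 0 := fun h0 => hP' (by rw [← hBP, h0, zero_mul])
  have hdet : ‖wronskian (m z₀) (n z₀)‖ = ‖B‖ := by
    have h1 := congrArg norm hBP
    rw [norm_mul, ha z₀ hz₀.le, mul_comm] at h1
    exact (mul_left_cancel₀ (norm_ne_zero_iff.2 hP) h1).symm
  -- `transfer` is W(m', n') times the quotient (m n)(m' n')⁻¹ applied to x. Away from the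
  -- eigenvalues g is therefore the matrix element of the quotient between y and x; on the real line
  -- the quotient is unitary, which bounds g by Cauchy-Schwarz.
  have hdiv : ∀ x y : Fin 2 → ℂ, ∃ g, IsBoundedHolo g ∧
      (∀ z, (∏ w ∈ s, (z - w)) * g z
        = (∏ w ∈ s, (z - conj w)) * herm y (transfer m n m' n' x z)) ∧
      ∀ z : ℂ, 0 ≤ z.im → ‖g z‖ ≤ √(sqNorm y * sqNorm x) := by
    intro x y
    obtain ⟨g, hg, hge⟩ := (h.holo_transfer h' x y).exists_div_prod s hs fun w hw => by
      simp [h.transfer_zero h' x hw, herm]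
    refine ⟨g, hg, hge, fun z hz => hg.norm_le (fun r => ?_) hz⟩
    have h1 := congrArg norm (hge r)
    rw [norm_mul, norm_mul, norm_prod_sub_conj] at h1
    have hr : (r : ℂ) ∉ s := fun hr => by simpa using hs r hr
    rw [mul_left_cancel₀ (norm_ne_zero_iff.2 (prod_sub_ne_zero hr)) h1]
    refine Real.le_sqrt_of_sq_le ((norm_herm_sq_le _ _).trans (le_of_eq ?_))
    rw [transfer, (h.real r).sqNorm_combination, (h'.real r).sqNorm_coordinates]
  have hgz : ∀ (x y : Fin 2 → ℂ) (g : ℂ → ℂ), ((∏ w ∈ s, (z₀ - w)) * g z₀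
        = (∏ w ∈ s, (z₀ - conj w)) * herm y (transfer m n m' n' x z₀)) →
      g z₀ = herm y (B⁻¹ • transfer m n m' n' x z₀) := by
    intro x y g hg
    rw [← hBP] at hg
    have e : B * g z₀ = herm y (transfer m n m' n' x z₀) :=
      mul_left_cancel₀ hP (by linear_combination hg)
    have e2 : herm y (B⁻¹ • transfer m n m' n' x z₀) = B⁻¹ * herm y (transfer m n m' n' x z₀) := by
      simp only [herm, Pi.smul_apply, smul_eq_mul]; ring
    rw [e2, ← e, inv_mul_cancel_left₀ hB0]
  -- Testing against the image T of x itself gives ‖T‖² ≤ ‖T‖ ‖x‖.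
  have hle : ∀ x, sqNorm (B⁻¹ • transfer m n m' n' x z₀) ≤ sqNorm x := by
    intro x
    set T := B⁻¹ • transfer m n m' n' x z₀ with hT
    obtain ⟨g, -, hge, hgle⟩ := hdiv x T
    have h1 := hgle z₀ hz₀.le
    rw [hgz x T g (hge z₀), ← ofReal_sqNorm, Complex.norm_real,
      Real.norm_of_nonneg (sqNorm_nonneg _)] at h1
    have h2 := (Real.le_sqrt (sqNorm_nonneg _) (mul_nonneg (sqNorm_nonneg _) (sqNorm_nonneg _))).1 h1
    rcases (sqNorm_nonneg T).eq_or_lt with h0 | h0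
    · rw [← h0]; exact sqNorm_nonneg x
    · exact le_of_mul_le_mul_left (by linarith [sq (sqNorm T)]) h0
  have heq : ∀ x, sqNorm (B⁻¹ • transfer m n m' n' x z₀) = sqNorm x := by
    intro x
    refine le_antisymm (hle x) ?_
    -- The orthogonal companion of x, with W(x, x') = ‖x‖². The determinant of the quotient at `z₀`
    -- is unimodular, so a contraction that shortened x would have to lengthen x'.
    set x' : Fin 2 → ℂ := ![-conj (x 1), conj (x 0)] with hx'
    have hx'n : sqNorm x' = sqNorm x := by simp [sqNorm, hx', add_comm]
    have hw : wronskian x x' = (sqNorm x : ℂ) := by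
      rw [ofReal_sqNorm]; simp [wronskian, herm, hx']; ring
    have hwT : wronskian (B⁻¹ • transfer m n m' n' x z₀) (B⁻¹ • transfer m n m' n' x' z₀)
        = B⁻¹ * wronskian (m z₀) (n z₀) * wronskian x x' := by
      rw [show B⁻¹ * wronskian (m z₀) (n z₀) * wronskian x x'
        = B⁻¹ * B⁻¹ * (B * wronskian (m z₀) (n z₀) * wronskian x x') by field_simp, hB]
      simp only [wronskian, transfer, Pi.smul_apply, Pi.add_apply, smul_eq_mul]
      ring
    have h1 := norm_wronskian_sq_le (B⁻¹ • transfer m n m' n' x z₀)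
      (B⁻¹ • transfer m n m' n' x' z₀)
    rw [hwT, norm_mul, norm_mul, norm_inv, hdet, inv_mul_cancel₀ (norm_ne_zero_iff.2 hB0), one_mul,
      hw, Complex.norm_real, Real.norm_of_nonneg (sqNorm_nonneg _)] at h1
    have h2 := hle x'
    rw [hx'n] at h2
    have h3 : sqNorm x ^ 2 ≤ sqNorm (B⁻¹ • transfer m n m' n' x z₀) * sqNorm x :=
      h1.trans (mul_le_mul_of_nonneg_left h2 (sqNorm_nonneg _))
    rcases (sqNorm_nonneg x).eq_or_lt with h0 | h0
    · rw [← h0]; exact sqNorm_nonneg _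
    · exact le_of_mul_le_mul_right (by linarith [sq (sqNorm x)]) h0
  have hid : ∀ x, B⁻¹ • transfer m n m' n' x z₀ = x := by
    intro x
    set T := B⁻¹ • transfer m n m' n' x z₀ with hT
    obtain ⟨g, hg, hge, hgle⟩ := hdiv x T
    have hg0 : g z₀ = sqNorm x := by
      rw [hgz x T g (hge z₀), ← ofReal_sqNorm, heq]
    -- The matrix element between T and x is bounded by ‖x‖² and attains this value at the interior
    -- point `z₀`, so it is constant; comparison with its limit ⟨T, x⟩ at infinity gives T = x.
    have hmax : IsMaxOn (norm ∘ g) {z | 0 < z.im} z₀ := by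
      intro z hz
      have h1 := hgle z (le_of_lt hz)
      rw [heq, Real.sqrt_mul_self (sqNorm_nonneg _)] at h1
      simpa [hg0, abs_of_nonneg (sqNorm_nonneg x)] using h1
    have hconst := Complex.eqOn_of_isPreconnected_of_isMaxOn_norm
      (convex_halfSpace_im_gt 0).isPreconnected isOpen_upper hg.diff hz₀ hmax
    have hlim : Tendsto g (upperInfinity ⊓ 𝓟 {z : ℂ | 0 < z.im}) (𝓝 (herm T x)) := by
      have h1 : Tendsto (fun z : ℂ => (∏ w ∈ s, (z - w)) / ∏ w ∈ s, (z - conj w)) upperInfinity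
          (𝓝 1) := (tendsto_blaschke s).mono_left inf_le_left
      have h2 := (h.lim_transfer h' x T).div h1 one_ne_zero
      rw [div_one] at h2
      refine (h2.congr' ?_).mono_left inf_le_left
      filter_upwards [h1.eventually_ne one_ne_zero, mem_inf_of_right (mem_principal_self _)]
        with z hz hz'
      have hc := prod_sub_conj_ne_zero hs hz'
      have hc' : ∏ w ∈ s, (z - w) ≠ 0 := fun h => hz (by simp [h])
      have := hge z
      simp only [Pi.div_apply]
      field_simp
      linear_combination -this
    have hlim2 : Tendsto g (upperInfinity ⊓ 𝓟 {z : ℂ | 0 < z.im}) (𝓝 (sqNorm x : ℂ)) := by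
      refine tendsto_const_nhds.congr' ?_
      filter_upwards [mem_inf_of_right (mem_principal_self _)] with z hz
      rw [hconst hz, Function.const_apply, hg0]
    exact eq_of_sqNorm_sub (tendsto_nhds_unique hlim hlim2) (heq x)
  have hfst := hid (m' z₀)
  have hsnd := hid (n' z₀)
  have e1 : transfer m n m' n' (m' z₀) z₀ = B • m z₀ := by
    funext i
    simp only [transfer, hB, wronskian, Pi.add_apply, Pi.smul_apply, smul_eq_mul]
    ring
  have e2 : transfer m n m' n' (n' z₀) z₀ = B • n z₀ := by
    funext i
    simp only [transfer, hB, wronskian, Pi.add_apply, Pi.smul_apply, smul_eq_mul]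
    ring
  rw [e1, inv_smul_smul₀ hB0] at hfst
  rw [e2, inv_smul_smul₀ hB0] at hsnd
  exact ⟨hfst, hsnd⟩

end IsReflectionlessPair
end

/-! ### Uniqueness of soliton potentials -/

section

theorem IsJostPhi.unique {q : ℝ → ℂ} {z : ℂ} {φ φ' : ℝ → Fin 2 → ℂ} (h : IsJostPhi q z φ)
    (h' : IsJostPhi q z φ') (hz : 0 ≤ z.im) : φ = φ' := by
  funext t i
  have hu := h.normalized.unique h'.normalized hz t
  have he := Complex.exp_ne_zero (I * z * t)
  fin_cases i
  · exact mul_left_cancel₀ he hu.1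
  · exact mul_left_cancel₀ he hu.2

theorem IsJostPsi.unique {q : ℝ → ℂ} {z : ℂ} {ψ ψ' : ℝ → Fin 2 → ℂ} (h : IsJostPsi q z ψ)
    (h' : IsJostPsi q z ψ') (hz : 0 ≤ z.im) : ψ = ψ' := by
  funext t i
  have hu := h.normalized.unique h'.normalized hz (-t)
  have he := Complex.exp_ne_zero (I * z * (-t : ℝ))
  simp only [neg_neg] at hu
  fin_cases i
  · exact mul_left_cancel₀ he hu.2
  · exact mul_left_cancel₀ he hu.1

/-- On the real line the flow of the scattering problem is unitary. -/
theorem IsZSSolution.herm_eq {q : ℝ → ℂ} {ξ : ℝ} {u v : ℝ → Fin 2 → ℂ}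
    (hu : IsZSSolution q ξ u) (hv : IsZSSolution q ξ v) (s t : ℝ) :
    herm (u s) (v s) = herm (u t) (v t) := by
  have hd : ∀ r, HasDerivAt (fun r => herm (u r) (v r)) 0 r := by
    intro r
    have u0 := hasDerivAt_pi.1 (hu r) 0
    have u1 := hasDerivAt_pi.1 (hu r) 1
    have v0 := hasDerivAt_pi.1 (hv r) 0
    have v1 := hasDerivAt_pi.1 (hv r) 1
    have c0 : HasDerivAt (fun r => conj (u r 0)) _ r := u0.star
    have c1 : HasDerivAt (fun r => conj (u r 1)) _ r := u1.star
    refine ((c0.mul v0).add (c1.mul v1)).congr_deriv ?_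
    simp only [zsMatrix, Matrix.mulVec, dotProduct, Fin.sum_univ_two, Matrix.of_apply,
      Matrix.cons_val', Matrix.cons_val_zero, Matrix.cons_val_one, Matrix.cons_val_fin_one,
      ← starRingEnd_apply, map_add, map_mul, map_neg, conj_conj, conj_I, conj_ofReal]
    ring
  exact is_const_of_deriv_eq_zero (fun r => (hd r).differentiableAt) (fun r => (hd r).deriv) s t

/-- If `b` vanishes, the Jost solutions are orthogonal on the real line. -/
theorem herm_eq_zero_of_isScatteringB {q : ℝ → ℂ} (hb : IsScatteringB q fun _ => 0) {ξ : ℝ}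
    {φ ψ : ℝ → Fin 2 → ℂ} (hφ : IsJostPhi q ξ φ) (hψ : IsJostPsi q ξ ψ) (t : ℝ) :
    herm (φ t) (ψ t) = 0 := by
  obtain ⟨φ', χ, hφ', hχ, hW⟩ := hb ξ
  obtain rfl := hφ.unique hφ' (by simp)
  have hconst := hψ.1.herm_eq hχ.1
  have hχl := tendsto_pi_nhds.1 hχ.2
  have hψl := tendsto_pi_nhds.1 hψ.2
  -- The inner product of ψ and ψ̄ is constant in time, and its modulus tends to zero at +∞, where
  -- the two solutions approach orthogonal unit vectors up to unimodular phases.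
  have horth : ∀ r, herm (ψ r) (χ r) = 0 := by
    intro r
    have h0 := (((Complex.continuous_conj.tendsto _).comp (hψl 0)).mul (hχl 0)).add
      (((Complex.continuous_conj.tendsto _).comp (hψl 1)).mul (hχl 1))
    have h1 := h0.norm
    have e : ∀ x : ℝ, ‖conj (exp (-(I * ξ * x)) * ψ x 0) * (exp (I * ξ * x) * χ x 0) +
        conj (exp (-(I * ξ * x)) * ψ x 1) * (exp (I * ξ * x) * χ x 1)‖ = ‖herm (ψ r) (χ r)‖ := by
      intro x
      have hc : conj (exp (-(I * ξ * x))) = exp (I * ξ * x) := by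
        rw [← Complex.exp_conj]; simp
      have hn : ‖exp (I * ξ * x)‖ = 1 := by
        rw [Complex.norm_exp]; simp
      rw [← hconst x r]
      have : conj (exp (-(I * ξ * x)) * ψ x 0) * (exp (I * ξ * x) * χ x 0) +
          conj (exp (-(I * ξ * x)) * ψ x 1) * (exp (I * ξ * x) * χ x 1)
          = exp (I * ξ * x) * exp (I * ξ * x) * herm (ψ x) (χ x) := by
        rw [map_mul, map_mul, hc, herm]; ring
      rw [this, norm_mul, norm_mul, hn, one_mul, one_mul]
    have h2 : Tendsto (fun _ : ℝ => ‖herm (ψ r) (χ r)‖) atTop (𝓝 0) := by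
      simpa using h1.congr e
    exact norm_eq_zero.1 (tendsto_nhds_unique tendsto_const_nhds h2)
  -- b = 0 makes φ parallel to ψ̄, and ψ is orthogonal to ψ̄. To conclude one divides by the first
  -- component of ψ̄, which is nonzero for large times; by unitarity of the flow one time suffices.
  obtain ⟨r, hr⟩ := ((hχl 0).eventually_ne (by simp : (![1, 0] : Fin 2 → ℂ) 0 ≠ 0)).exists
  have hr' : χ r 0 ≠ 0 := fun h => hr (by simp [h])
  have e := hφ.1.herm_eq hψ.1 t r
  rw [e]
  have hWr := hW r
  have hor := congrArg conj (horth r)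
  simp only [herm, wronskian, map_add, map_mul, conj_conj, map_zero] at *
  have hcr : conj (χ r 0) ≠ 0 := by simpa using hr'
  have hWc := congrArg conj hWr
  simp only [map_zero, map_sub, map_mul] at hWc
  refine mul_left_cancel₀ hcr ?_
  rw [mul_zero]
  linear_combination conj (φ r 0) * hor - ψ r 1 * hWc

section Family

variable {q : ℝ → ℂ} {Φ Ψ : ℂ → ℝ → Fin 2 → ℂ}

theorem isPhiFamily_of_jostPhi (hΦ : ∀ z : ℂ, 0 ≤ z.im → IsJostPhi q z (Φ z)) :
    IsPhiFamily q (fun z t => exp (I * z * t) * Φ z t 0) fun z t => exp (I * z * t) * Φ z t 1 :=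
  fun z hz => (hΦ z hz).normalized

theorem isPhiFamily_of_jostPsi (hΨ : ∀ z : ℂ, 0 ≤ z.im → IsJostPsi q z (Ψ z)) :
    IsPhiFamily (fun t => conj (q (-t))) (fun z t => exp (I * z * t) * Ψ z (-t) 1)
      fun z t => exp (I * z * t) * Ψ z (-t) 0 :=
  fun z hz => (hΨ z hz).normalized

theorem IsPhiFamily.isBoundedHolo {X Y : ℂ → ℝ → ℂ} (hq : Continuous q) (hi : Integrable q)
    (h : IsPhiFamily q X Y) (t : ℝ) :
    IsBoundedHolo (fun z => X z t) ∧ IsBoundedHolo fun z => Y z t :=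
  ⟨⟨fun _ hz => (h.differentiableAt hz t).1.differentiableWithinAt, (h.continuousOn hq hi t).1, 1,
      fun z hz => (h z hz).norm_fst_le hz t⟩,
    ⟨fun _ hz => (h.differentiableAt hz t).2.differentiableWithinAt, (h.continuousOn hq hi t).2, 1,
      fun z hz => (h z hz).norm_snd_le hz t⟩⟩

theorem continuous_conj_reverse (hq : Continuous q) : Continuous fun t => conj (q (-t)) :=
  Complex.continuous_conj.comp (hq.comp continuous_neg)

theorem integrable_conj_reverse (hq : Continuous q) (hi : Integrable q) :
    Integrable fun t => conj (q (-t)) := by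
  refine (integrable_norm_iff (continuous_conj_reverse hq).aestronglyMeasurable).1 ?_
  simpa using hi.comp_neg.norm

/-- The normalization multiplies φ by e^{iwt} and ψ by e^{-iwt}, so the norming constants at time t
acquire the factor e^{2iwt}. This factor does not depend on q, so equal constants stay equal. -/
theorem isReflectionlessPair (hq : Continuous q) (hi : Integrable q)
    (hb : IsScatteringB q fun _ => 0) (hΦ : ∀ z : ℂ, 0 ≤ z.im → IsJostPhi q z (Φ z))
    (hΨ : ∀ z : ℂ, 0 ≤ z.im → IsJostPsi q z (Ψ z)) {s : Finset ℂ} {c : ℂ → ℂ}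
    (hc : ∀ w ∈ s, ∀ t, Φ w t = c w • Ψ w t) (t : ℝ) :
    IsReflectionlessPair s (fun w => exp (2 * (I * w * t)) * c w)
      (fun z => exp (I * z * t) • Φ z t) fun z => exp (-(I * z * t)) • Ψ z t := by
  have hF := isPhiFamily_of_jostPhi hΦ
  have hG := isPhiFamily_of_jostPsi hΨ
  have hq' := continuous_conj_reverse hq
  have hi' := integrable_conj_reverse hq hi
  have f1 := hF.isBoundedHolo hq hi t
  have f2 := hG.isBoundedHolo hq' hi' (-t)
  have l1 := hF.tendsto_cobounded hq hi t
  have l2 := hG.tendsto_cobounded hq' hi' (-t)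
  simp only [ofReal_neg, mul_neg, neg_neg] at f2 l2
  refine ⟨fun i => ?_, fun i => ?_, fun x => ⟨?_, ?_, ?_⟩, ?_, ?_, fun w hw => ?_⟩
  · fin_cases i
    · exact f1.1
    · exact f1.2
  · fin_cases i
    · exact f2.2
    · exact f2.1
  · exact (hF x (by simp)).energy_eq (by simp) t
  · have := (hG x (by simp)).energy_eq (by simp) (-t)
    simp only [ofReal_neg, mul_neg, neg_neg] at this
    rw [add_comm] at this
    exact this
  · have h0 := herm_eq_zero_of_isScatteringB hb (hΦ x (by simp)) (hΨ x (by simp)) t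
    have e : herm (exp (I * x * t) • Φ x t) (exp (-(I * x * t)) • Ψ x t)
        = conj (exp (I * x * t)) * exp (-(I * x * t)) * herm (Φ x t) (Ψ x t) := by
      simp only [herm, Pi.smul_apply, smul_eq_mul, map_mul]; ring
    rw [e, h0, mul_zero]
  · refine tendsto_pi_nhds.2 fun i => ?_
    fin_cases i
    · exact l1.1
    · exact l1.2
  · refine tendsto_pi_nhds.2 fun i => ?_
    fin_cases i
    · exact l2.2
    · exact l2.1
  · rw [hc w hw, smul_smul, smul_smul]
    congr 1
    rw [two_mul, Complex.exp_add, Complex.exp_neg]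
    field_simp

end Family

theorem wronskian_smul_smul (c d : ℂ) (u v : Fin 2 → ℂ) :
    wronskian (c • u) (d • v) = c * d * wronskian u v := by
  simp only [wronskian, Pi.smul_apply, smul_eq_mul]; ring

/-- The first row alone decides: q - q' annihilates the second components of u and of v, and these
cannot both vanish. -/
theorem eq_of_mulVec_eq {q q' z : ℂ} {u v : Fin 2 → ℂ}
    (hu : !![-(I * z), q; -conj q, I * z] *ᵥ u = !![-(I * z), q'; -conj q', I * z] *ᵥ u)
    (hv : !![-(I * z), q; -conj q, I * z] *ᵥ v = !![-(I * z), q'; -conj q', I * z] *ᵥ v)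
    (hW : wronskian u v ≠ 0) : q = q' := by
  have h1 := congrFun hu 0
  have h2 := congrFun hv 0
  simp [Matrix.mulVec, dotProduct, Fin.sum_univ_two] at h1 h2
  rcases h1 with h1 | h1
  · exact h1
  rcases h2 with h2 | h2
  · exact h2
  · exact absurd (by simp [wronskian, h1, h2]) hW

/-- A soliton potential is determined by its discrete spectrum, if one with the given discrete
spectrum and a Blaschke product as scattering coefficient exists. -/
theorem IsSolitonPotential.eq_of_blaschke {K : ℕ} {ζ b : ℕ → ℂ} {q q' : ℝ → ℂ}
    (hd : IsSpectralData K ζ b) (h : IsSolitonPotential K ζ b q)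
    (h' : IsSolitonPotential K ζ b q') {Φ' Ψ' : ℂ → ℝ → Fin 2 → ℂ}
    (hΦ' : ∀ z : ℂ, 0 ≤ z.im → IsJostPhi q' z (Φ' z))
    (hΨ' : ∀ z : ℂ, 0 ≤ z.im → IsJostPsi q' z (Ψ' z))
    (hW' : ∀ z : ℂ, 0 ≤ z.im → ∀ t, wronskian (Φ' z t) (Ψ' z t) *
      ∏ k ∈ Finset.Icc 1 K, (z - conj (ζ k)) = ∏ k ∈ Finset.Icc 1 K, (z - ζ k)) :
    q = q' := by
  classical
  obtain ⟨hq, hi, ⟨a, hA, hzero, hsimple⟩, hnorm, hb⟩ := h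
  obtain ⟨hq', hi', -, hnorm', hb'⟩ := h'
  have hA' := hA
  unfold IsScatteringA at hA'
  choose! Φ Ψ hΦ hΨ ha using hA'
  have hinj : Set.InjOn ζ (Finset.Icc 1 K : Finset ℕ) := by simpa using hd.distinct
  set s := (Finset.Icc 1 K).image ζ with hs_def
  have hs : ∀ w ∈ s, 0 < w.im := by
    intro w hw
    obtain ⟨k, hk, rfl⟩ := Finset.mem_image.1 hw
    exact hd.im_pos k hk
  have hp1 : ∀ z, ∏ w ∈ s, (z - w) = ∏ k ∈ Finset.Icc 1 K, (z - ζ k) := fun z =>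
    Finset.prod_image hinj
  have hp2 : ∀ z, ∏ w ∈ s, (z - conj w) = ∏ k ∈ Finset.Icc 1 K, (z - conj (ζ k)) := fun z =>
    Finset.prod_image hinj
  -- Norming constants indexed by the eigenvalue instead of its number; well defined because the
  -- eigenvalues are distinct.
  set c : ℂ → ℂ := fun w => b (Function.invFunOn ζ (Finset.Icc 1 K : Finset ℕ) w)
  have hcζ : ∀ k ∈ Finset.Icc 1 K, c (ζ k) = b k := fun k hk =>
    congrArg b (hinj.leftInvOn_invFunOn hk)
  have hc : ∀ w ∈ s, ∀ t, Φ w t = c w • Ψ w t := by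
    intro w hw t
    obtain ⟨k, hk, rfl⟩ := Finset.mem_image.1 hw
    obtain ⟨φ, ψ, hφ, hψ, hφψ⟩ := hnorm k hk
    have him := (hd.im_pos k hk).le
    rw [hcζ k hk, (hΦ _ him).unique hφ him, (hΨ _ him).unique hψ him, hφψ]
  have hc' : ∀ w ∈ s, ∀ t, Φ' w t = c w • Ψ' w t := by
    intro w hw t
    obtain ⟨k, hk, rfl⟩ := Finset.mem_image.1 hw
    obtain ⟨φ, ψ, hφ, hψ, hφψ⟩ := hnorm' k hk
    have him := (hd.im_pos k hk).le
    rw [hcζ k hk, (hΦ' _ him).unique hφ him, (hΨ' _ him).unique hψ him, hφψ]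
  have hexp : ∀ (z : ℂ) (t : ℝ), exp (I * z * t) * exp (-(I * z * t)) = 1 := fun z t => by
    rw [← Complex.exp_add, add_neg_cancel, Complex.exp_zero]
  -- One spectral parameter off the eigenvalues is enough: if the Jost solutions agree there for all
  -- t, two independent solutions determine the coefficient matrix.
  obtain ⟨z₀, hz₀, hz₀s⟩ : ∃ z₀ : ℂ, 0 < z₀.im ∧ z₀ ∉ s := by
    have h1 : ∀ᶠ z in upperInfinity ⊓ 𝓟 {z : ℂ | 0 < z.im},
        (∏ w ∈ s, (z - w)) / ∏ w ∈ s, (z - conj w) ≠ 0 :=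
      (((tendsto_blaschke s).mono_left inf_le_left).mono_left inf_le_left).eventually_ne one_ne_zero
    obtain ⟨z, hz, hz'⟩ := (h1.and (mem_inf_of_right (mem_principal_self _))).exists
    exact ⟨z, hz', fun hzs => hz (by rw [Finset.prod_eq_zero hzs (sub_self z), zero_div])⟩
  have key : ∀ t, Φ z₀ t = Φ' z₀ t ∧ Ψ z₀ t = Ψ' z₀ t := by
    intro t
    have p := isReflectionlessPair hq hi hb hΦ hΨ hc t
    have p' := isReflectionlessPair hq' hi' hb' hΦ' hΨ' hc' t
    have hWa : ∀ z : ℂ, 0 ≤ z.im →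
        wronskian (exp (I * z * t) • Φ z t) (exp (-(I * z * t)) • Ψ z t) = a z := fun z hz => by
      rw [wronskian_smul_smul, hexp, one_mul, ha z hz]
    have hu := p.unique p' hs (fun z hz => ?_) (fun z hz => ?_) hz₀ hz₀s
    · have he := Complex.exp_ne_zero (I * z₀ * t)
      have he' := Complex.exp_ne_zero (-(I * z₀ * t))
      exact ⟨smul_right_injective _ he hu.1, smul_right_injective _ he' hu.2⟩
    · rw [wronskian_smul_smul, hexp, one_mul, hp1, hp2, hW' z hz]
    · refine norm_eq_blaschke p.holo_wronskian (fun x => (p.real x).norm_wronskian) p.lim_wronskian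
        hs (fun v hv => ?_) (fun w hw => ?_) hz
      · rw [hWa v hv.le, hzero v hv, hs_def, Finset.mem_image]
        exact exists_congr fun k => and_congr_right fun _ => eq_comm
      · have hev : (fun z => wronskian (exp (I * z * t) • Φ z t) (exp (-(I * z * t)) • Ψ z t))
            =ᶠ[𝓝 w] a := by
          filter_upwards [isOpen_upper.mem_nhds (hs w hw)] with z hz
          exact hWa z (le_of_lt hz)
        rw [hev.deriv_eq]
        obtain ⟨k, hk, rfl⟩ := Finset.mem_image.1 hw
        exact hsimple k hk
  funext t
  have hφ : Φ z₀ = Φ' z₀ := funext fun t => (key t).1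
  have hψ : Ψ z₀ = Ψ' z₀ := funext fun t => (key t).2
  have d1 := (hΦ z₀ hz₀.le).1 t
  have d2 := (hΨ z₀ hz₀.le).1 t
  rw [hφ] at d1
  rw [hψ] at d2
  refine eq_of_mulVec_eq (d1.unique ((hΦ' z₀ hz₀.le).1 t)) (d2.unique ((hΨ' z₀ hz₀.le).1 t)) ?_
  intro h0
  have := hW' z₀ hz₀.le t
  rw [h0, zero_mul, ← hp1] at this
  exact prod_sub_ne_zero hz₀s this.symm

end

section

/-! ### Darboux matrices of degree one -/

/-- The real quaternions as a subalgebra of the two by two matrices. -/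
structure IsQuaternionic (A : Matrix (Fin 2) (Fin 2) ℂ) : Prop where
  snd_snd : A 1 1 = conj (A 0 0)
  snd_fst : A 1 0 = -conj (A 0 1)

namespace IsQuaternionic

variable {A B : Matrix (Fin 2) (Fin 2) ℂ}

theorem mul (hA : IsQuaternionic A) (hB : IsQuaternionic B) : IsQuaternionic (A * B) := by
  constructor <;>
  · simp only [Matrix.mul_apply, Fin.sum_univ_two, hA.snd_snd, hA.snd_fst, hB.snd_snd, hB.snd_fst,
      map_add, map_mul, map_neg, conj_conj]
    ring

theorem sub (hA : IsQuaternionic A) (hB : IsQuaternionic B) : IsQuaternionic (A - B) := by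
  constructor <;>
  · simp only [Matrix.sub_apply, hA.snd_snd, hA.snd_fst, hB.snd_snd, hB.snd_fst, map_sub]
    try ring

theorem zero : IsQuaternionic 0 := by constructor <;> simp

theorem one : IsQuaternionic 1 := by constructor <;> simp

theorem ofReal_smul (hA : IsQuaternionic A) (r : ℝ) : IsQuaternionic ((r : ℂ) • A) := by
  constructor <;> simp [hA.snd_snd, hA.snd_fst]

theorem eq_of (hA : IsQuaternionic A) : A = !![A 0 0, A 0 1; -conj (A 0 1), conj (A 0 0)] := by
  rw [← hA.snd_snd, ← hA.snd_fst]
  exact Matrix.eta_fin_two A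

/-- The columns of a multiple of a quaternionic matrix are orthogonal. -/
theorem col_orthogonal (hA : IsQuaternionic A) (c : ℂ) :
    conj ((c • A) 0 1) * (c • A) 0 0 + conj ((c • A) 1 1) * (c • A) 1 0 = 0 := by
  simp only [Matrix.smul_apply, smul_eq_mul, hA.snd_snd, hA.snd_fst, map_mul, conj_conj]
  ring

end IsQuaternionic

theorem norm_sq_add_ne_zero {u : Fin 2 → ℂ} (hu : u ≠ 0) :
    u 0 * conj (u 0) + u 1 * conj (u 1) ≠ 0 := by
  rw [Complex.mul_conj', Complex.mul_conj']
  have h : ‖u 0‖ ^ 2 + ‖u 1‖ ^ 2 ≠ 0 := by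
    intro h
    have h0 : ‖u 0‖ ^ 2 = 0 := by nlinarith [sq_nonneg ‖u 0‖, sq_nonneg ‖u 1‖]
    have h1 : ‖u 1‖ ^ 2 = 0 := by nlinarith [sq_nonneg ‖u 0‖, sq_nonneg ‖u 1‖]
    refine hu (funext fun i => ?_)
    fin_cases i
    · simpa using h0
    · simpa using h1
  exact_mod_cast h

theorem darbouxShift_fst_fst (w : ℂ) (u : Fin 2 → ℂ) :
    darbouxShift w u 0 0 = (u 0 * conj (u 0) * w + u 1 * conj (u 1) * conj w) /
      (u 0 * conj (u 0) + u 1 * conj (u 1)) := by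
  simp [darbouxShift, Complex.mul_conj']
  ring

theorem darbouxShift_fst_snd (w : ℂ) (u : Fin 2 → ℂ) :
    darbouxShift w u 0 1 = (w - conj w) * (u 0 * conj (u 1)) /
      (u 0 * conj (u 0) + u 1 * conj (u 1)) := by
  simp [darbouxShift, Complex.mul_conj']
  ring

theorem isQuaternionic_darbouxShift (w : ℂ) (u : Fin 2 → ℂ) :
    IsQuaternionic (darbouxShift w u) := by
  constructor
  · simp [darbouxShift]
    ring_nf
    tauto
  · simp [darbouxShift]
    ring_nf

theorem darbouxShift_snd_fst (w : ℂ) (u : Fin 2 → ℂ) :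
    darbouxShift w u 1 0 = -conj (darbouxShift w u 0 1) := (isQuaternionic_darbouxShift w u).snd_fst

theorem darbouxShift_snd_snd (w : ℂ) (u : Fin 2 → ℂ) :
    darbouxShift w u 1 1 = conj (darbouxShift w u 0 0) := (isQuaternionic_darbouxShift w u).snd_snd

/-- The matrix depends only on the line spanned by u. This allows growing exponentials and the
constants from time reversal to be dropped. -/
theorem darbouxShift_smul (w : ℂ) {c : ℂ} (hc : c ≠ 0) (u : Fin 2 → ℂ) :
    darbouxShift w (c • u) = darbouxShift w u := by
  have hcc : c * conj c ≠ 0 := mul_ne_zero hc (by simpa using hc)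
  have e : (c • u) 0 * conj ((c • u) 0) + (c • u) 1 * conj ((c • u) 1)
      = c * conj c * (u 0 * conj (u 0) + u 1 * conj (u 1)) := by
    simp only [Pi.smul_apply, smul_eq_mul, map_mul]; ring
  have h00 : darbouxShift w (c • u) 0 0 = darbouxShift w u 0 0 := by
    rw [darbouxShift_fst_fst, darbouxShift_fst_fst, e, ← mul_div_mul_left
      (u 0 * conj (u 0) * w + u 1 * conj (u 1) * conj w) _ hcc]
    simp only [Pi.smul_apply, smul_eq_mul, map_mul]
    congr 1
    ring
  have h01 : darbouxShift w (c • u) 0 1 = darbouxShift w u 0 1 := by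
    rw [darbouxShift_fst_snd, darbouxShift_fst_snd, e, ← mul_div_mul_left
      ((w - conj w) * (u 0 * conj (u 1))) _ hcc]
    simp only [Pi.smul_apply, smul_eq_mul, map_mul]
    congr 1
    ring
  ext i k
  fin_cases i <;> fin_cases k <;> simp only [Fin.zero_eta, Fin.mk_one, darbouxShift_snd_fst,
    darbouxShift_snd_snd, h00, h01]

theorem darbouxShift_mulVec (w : ℂ) {u : Fin 2 → ℂ} (hu : u ≠ 0) :
    darbouxShift w u *ᵥ u = w • u := by
  have hn := norm_sq_add_ne_zero hu
  have hn' : conj (u 0) * u 0 + conj (u 1) * u 1 = u 0 * conj (u 0) + u 1 * conj (u 1) := by ring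
  funext i
  fin_cases i <;>
    simp only [Fin.zero_eta, Fin.mk_one, Matrix.mulVec, dotProduct, Fin.sum_univ_two,
      darbouxShift_snd_fst, darbouxShift_snd_snd, darbouxShift_fst_fst, darbouxShift_fst_snd,
      Pi.smul_apply, smul_eq_mul, map_div₀, map_mul, map_add, map_sub, conj_conj, hn']
  · rw [div_mul_eq_mul_div, div_mul_eq_mul_div, ← add_div, div_eq_iff hn]
    ring
  · rw [neg_mul, div_mul_eq_mul_div, div_mul_eq_mul_div, neg_add_eq_sub, ← sub_div, div_eq_iff hn]
    ring

/-- The eigenvalues of the shift are w on u and conj w on its orthogonal complement. -/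
theorem det_sub_darbouxShift (z w : ℂ) {u : Fin 2 → ℂ} (hu : u ≠ 0) :
    (z • (1 : Matrix (Fin 2) (Fin 2) ℂ) - darbouxShift w u).det = (z - w) * (z - conj w) := by
  have hn := norm_sq_add_ne_zero hu
  have hn' : conj (u 0) * u 0 + conj (u 1) * u 1 ≠ 0 := by
    rwa [mul_comm (conj (u 0)), mul_comm (conj (u 1))]
  rw [Matrix.det_fin_two]
  simp only [Matrix.sub_apply, Matrix.smul_apply, Matrix.one_apply_eq, ne_eq, zero_ne_one,
    one_ne_zero, not_false_eq_true, Matrix.one_apply_ne, smul_eq_mul, mul_one, mul_zero,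
    darbouxShift_snd_fst, darbouxShift_snd_snd, darbouxShift_fst_fst, darbouxShift_fst_snd,
    map_div₀, map_mul, map_add, map_sub, conj_conj]
  field_simp
  ring

theorem darbouxShift_rev (w : ℂ) (u : Fin 2 → ℂ) (i k : Fin 2) :
    darbouxShift w (u ∘ Fin.rev) i k = darbouxShift w u i.rev k.rev := by
  have e0 : (Fin.rev 0 : Fin 2) = 1 := rfl
  have e1 : (Fin.rev 1 : Fin 2) = 0 := rfl
  fin_cases i <;> fin_cases k <;>
    simp [darbouxShift, e0, e1, add_comm, mul_comm]

theorem darbouxShift_fst_fst_sub (w : ℂ) {u : Fin 2 → ℂ} (hu : u ≠ 0) :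
    darbouxShift w u 0 0 - conj w =
      2 * I * (w.im * (‖u 0‖ ^ 2 / (‖u 0‖ ^ 2 + ‖u 1‖ ^ 2) : ℝ) : ℝ) := by
  have hn := norm_sq_add_ne_zero hu
  have hw : w - conj w = 2 * I * (w.im : ℂ) := by rw [Complex.sub_conj]; push_cast; ring
  rw [darbouxShift_fst_fst]
  push_cast
  rw [← Complex.mul_conj', ← Complex.mul_conj']
  field_simp
  linear_combination (u 0 * conj (u 0)) * hw

/-! ### Time evolution of the Darboux matrix -/

section Derivatives

variable {q : ℝ → ℂ} {w z : ℂ} {u v : ℝ → Fin 2 → ℂ}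

theorem IsZSSolution.deriv_fst (h : IsZSSolution q z v) (t : ℝ) :
    HasDerivAt (fun s => v s 0) (-(I * z) * v t 0 + q t * v t 1) t := by
  simpa [zsMatrix, Matrix.mulVec, dotProduct, Fin.sum_univ_two] using hasDerivAt_pi.1 (h t) 0

theorem IsZSSolution.deriv_snd (h : IsZSSolution q z v) (t : ℝ) :
    HasDerivAt (fun s => v s 1) (-conj (q t) * v t 0 + I * z * v t 1) t := by
  simpa [zsMatrix, Matrix.mulVec, dotProduct, Fin.sum_univ_two] using hasDerivAt_pi.1 (h t) 1

theorem isZSSolution_of_deriv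
    (h0 : ∀ t, HasDerivAt (fun s => v s 0) (-(I * z) * v t 0 + q t * v t 1) t)
    (h1 : ∀ t, HasDerivAt (fun s => v s 1) (-conj (q t) * v t 0 + I * z * v t 1) t) :
    IsZSSolution q z v := by
  intro t
  refine hasDerivAt_pi.2 fun i => ?_
  fin_cases i
  · simpa [zsMatrix, Matrix.mulVec, dotProduct, Fin.sum_univ_two] using h0 t
  · simpa [zsMatrix, Matrix.mulVec, dotProduct, Fin.sum_univ_two] using h1 t

theorem hasDerivAt_conj {f : ℝ → ℂ} {f' : ℂ} {t : ℝ} (h : HasDerivAt f f' t) :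
    HasDerivAt (fun s => conj (f s)) (conj f') t := h.star

/-- The evolution of the line spanned by u, written in the entries of the shift: neither u nor w
appears otherwise. This formula serves both the covariance of the system and the energy balance. -/
theorem hasDerivAt_darbouxShift_fst_fst (hu : IsZSSolution q w u) (h0 : ∀ t, u t ≠ 0) (t : ℝ) :
    HasDerivAt (fun s => darbouxShift w (u s) 0 0)
      (2 * I * darbouxShift w (u t) 0 1 * conj (darbouxShift w (u t) 0 1)
        - q t * conj (darbouxShift w (u t) 0 1) + conj (q t) * darbouxShift w (u t) 0 1) t := by
  have hn := norm_sq_add_ne_zero (h0 t)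
  have hn' : conj (u t 0) * u t 0 + conj (u t 1) * u t 1 ≠ 0 := by
    rwa [mul_comm (conj (u t 0)), mul_comm (conj (u t 1))]
  have d0 := hu.deriv_fst t
  have d1 := hu.deriv_snd t
  have e0 := d0.mul (hasDerivAt_conj d0)
  have e1 := d1.mul (hasDerivAt_conj d1)
  simp only [darbouxShift_fst_fst, darbouxShift_fst_snd]
  refine (((e0.mul_const w).add (e1.mul_const (conj w))).div (e0.add e1) hn).congr_deriv ?_
  simp only [Pi.add_apply, Pi.mul_apply, map_add, map_mul, map_neg, map_div₀, map_sub, conj_conj,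
    conj_I]
  field_simp
  ring

theorem hasDerivAt_darbouxShift_fst_snd (hu : IsZSSolution q w u) (h0 : ∀ t, u t ≠ 0) (t : ℝ) :
    HasDerivAt (fun s => darbouxShift w (u s) 0 1)
      (-2 * I * darbouxShift w (u t) 0 1 * conj (darbouxShift w (u t) 0 0)
        + q t * (conj (darbouxShift w (u t) 0 0) - darbouxShift w (u t) 0 0)) t := by
  have hn := norm_sq_add_ne_zero (h0 t)
  have hn' : conj (u t 0) * u t 0 + conj (u t 1) * u t 1 ≠ 0 := by
    rwa [mul_comm (conj (u t 0)), mul_comm (conj (u t 1))]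
  have d0 := hu.deriv_fst t
  have d1 := hu.deriv_snd t
  have e0 := d0.mul (hasDerivAt_conj d0)
  have e1 := d1.mul (hasDerivAt_conj d1)
  simp only [darbouxShift_fst_fst, darbouxShift_fst_snd]
  refine (((d0.mul (hasDerivAt_conj d1)).const_mul (w - conj w)).div (e0.add e1) hn).congr_deriv ?_
  simp only [Pi.add_apply, Pi.mul_apply, map_add, map_mul, map_neg, map_div₀, conj_conj,
    conj_I]
  field_simp
  ring

/-- The Darboux transformation maps solutions to solutions. -/
theorem IsZSSolution.darboux (hu : IsZSSolution q w u) (h0 : ∀ t, u t ≠ 0)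
    (hv : IsZSSolution q z v) (c : ℂ) :
    IsZSSolution (fun t => q t - 2 * I * darbouxShift w (u t) 0 1) z
      fun t => (c • (z • (1 : Matrix (Fin 2) (Fin 2) ℂ) - darbouxShift w (u t))) *ᵥ v t := by
  have m00 := hasDerivAt_darbouxShift_fst_fst hu h0
  have m01 := hasDerivAt_darbouxShift_fst_snd hu h0
  have e0 : ∀ t, ((c • (z • (1 : Matrix (Fin 2) (Fin 2) ℂ) - darbouxShift w (u t))) *ᵥ v t) 0 =
      c * ((z - darbouxShift w (u t) 0 0) * v t 0 - darbouxShift w (u t) 0 1 * v t 1) := by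
    intro t
    simp [Matrix.mulVec, dotProduct, Fin.sum_univ_two]
    ring
  have e1 : ∀ t, ((c • (z • (1 : Matrix (Fin 2) (Fin 2) ℂ) - darbouxShift w (u t))) *ᵥ v t) 1 =
      c * (conj (darbouxShift w (u t) 0 1) * v t 0
        + (z - conj (darbouxShift w (u t) 0 0)) * v t 1) := by
    intro t
    simp [Matrix.mulVec, dotProduct, Fin.sum_univ_two, darbouxShift_snd_fst, darbouxShift_snd_snd]
    ring
  refine isZSSolution_of_deriv (fun t => ?_) fun t => ?_
  · simp only [e0, e1]
    refine (((((m00 t).const_sub z).mul (hv.deriv_fst t)).sub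
      ((m01 t).mul (hv.deriv_snd t))).const_mul c).congr_deriv ?_
    ring
  · simp only [e0, e1]
    refine ((((hasDerivAt_conj (m01 t)).mul (hv.deriv_fst t)).add
      (((hasDerivAt_conj (m00 t)).const_sub z).mul (hv.deriv_snd t))).const_mul c).congr_deriv ?_
    simp only [map_add, map_mul, map_neg, map_sub, conj_conj, conj_I, map_ofNat]
    ring

end Derivatives
end

section

/-! ### The Darboux iteration -/

/-- The potential produced by the Darboux iteration. -/
noncomputable def darbouxPotential (ζ b : ℕ → ℂ) : ℕ → ℝ → ℂ
  | 0 => fun _ => 0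
  | j + 1 => fun t => darbouxPotential ζ b j t
      - 2 * I * darbouxShift (ζ (j + 1)) (betaVector ζ b t j) 0 1

/-- The matrix Jost solution of the Darboux iteration divided by the seed solution. -/
noncomputable def darbouxFactor (ζ b : ℕ → ℂ) (t : ℝ) : ℕ → ℂ → Matrix (Fin 2) (Fin 2) ℂ
  | 0 => fun _ => 1
  | j + 1 => fun z => (z - conj (ζ (j + 1)))⁻¹ •
      ((z • (1 : Matrix (Fin 2) (Fin 2) ℂ) - darbouxShift (ζ (j + 1)) (betaVector ζ b t j)) *
        darbouxFactor ζ b t j z)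

theorem darbouxJost_succ (ζ b : ℕ → ℂ) (t : ℝ) (j : ℕ) (z : ℂ) :
    darbouxJost ζ b t (j + 1) z = (z - conj (ζ (j + 1)))⁻¹ •
      ((z • (1 : Matrix (Fin 2) (Fin 2) ℂ) - darbouxShift (ζ (j + 1)) (betaVector ζ b t j)) *
        darbouxJost ζ b t j z) := rfl

theorem darbouxJost_eq_factor (ζ b : ℕ → ℂ) (t : ℝ) (j : ℕ) (z : ℂ) :
    darbouxJost ζ b t j z = darbouxFactor ζ b t j z * seed t z := by
  induction j with
  | zero => simp [darbouxJost, darbouxFactor]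
  | succ j ih => rw [darbouxJost_succ, darbouxFactor, ih, smul_mul_assoc, mul_assoc]

theorem darbouxPoly_succ (ζ b : ℕ → ℂ) (t : ℝ) (j : ℕ) :
    darbouxPoly ζ b t (j + 1) = (Polynomial.X -
      Polynomial.C (darbouxShift (ζ (j + 1)) (betaVector ζ b t j))) * darbouxPoly ζ b t j := rfl

theorem natDegree_darbouxPoly_le (ζ b : ℕ → ℂ) (t : ℝ) (j : ℕ) :
    (darbouxPoly ζ b t j).natDegree ≤ j := by
  induction j with
  | zero => simp [darbouxPoly]
  | succ j ih =>
    rw [darbouxPoly_succ]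
    refine Polynomial.natDegree_mul_le.trans ?_
    have := Polynomial.natDegree_X_sub_C_le (darbouxShift (ζ (j + 1)) (betaVector ζ b t j))
    omega

theorem darbouxCoeff_succ_zero (ζ b : ℕ → ℂ) (t : ℝ) (j : ℕ) :
    darbouxCoeff ζ b t (j + 1) 0 =
      -(darbouxShift (ζ (j + 1)) (betaVector ζ b t j) * darbouxCoeff ζ b t j 0) := by
  simp [darbouxCoeff, darbouxPoly_succ, sub_mul]

theorem darbouxCoeff_succ_succ (ζ b : ℕ → ℂ) (t : ℝ) (j k : ℕ) :
    darbouxCoeff ζ b t (j + 1) (k + 1) = darbouxCoeff ζ b t j k -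
      darbouxShift (ζ (j + 1)) (betaVector ζ b t j) * darbouxCoeff ζ b t j (k + 1) := by
  simp [darbouxCoeff, darbouxPoly_succ, sub_mul]

theorem darbouxCoeff_eq_zero (ζ b : ℕ → ℂ) (t : ℝ) {j k : ℕ} (h : j < k) :
    darbouxCoeff ζ b t j k = 0 :=
  Polynomial.coeff_eq_zero_of_natDegree_lt ((natDegree_darbouxPoly_le ζ b t j).trans_lt h)

theorem darbouxCoeff_self (ζ b : ℕ → ℂ) (t : ℝ) (j : ℕ) : darbouxCoeff ζ b t j j = 1 := by
  induction j with
  | zero => simp [darbouxCoeff, darbouxPoly]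
  | succ j ih =>
    rw [darbouxCoeff_succ_succ, ih, darbouxCoeff_eq_zero ζ b t (Nat.lt_succ_self j), mul_zero,
      sub_zero]

theorem isQuaternionic_darbouxCoeff (ζ b : ℕ → ℂ) (t : ℝ) (j : ℕ) :
    ∀ k, IsQuaternionic (darbouxCoeff ζ b t j k) := by
  induction j with
  | zero =>
    intro k
    rcases Nat.eq_zero_or_pos k with rfl | hk
    · rw [darbouxCoeff_self]; exact IsQuaternionic.one
    · rw [darbouxCoeff_eq_zero ζ b t hk]; exact IsQuaternionic.zero
  | succ j ih =>
    intro k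
    have hM := isQuaternionic_darbouxShift (ζ (j + 1)) (betaVector ζ b t j)
    cases k with
    | zero => rw [darbouxCoeff_succ_zero, ← zero_sub]; exact IsQuaternionic.zero.sub (hM.mul (ih 0))
    | succ k => rw [darbouxCoeff_succ_succ]; exact (ih k).sub (hM.mul (ih (k + 1)))

/-- The next to leading coefficient is minus the sum of the Darboux shifts. -/
theorem darbouxCoeff_pred (ζ b : ℕ → ℂ) (t : ℝ) (j : ℕ) :
    darbouxCoeff ζ b t (j + 1) j =
      -∑ i ∈ Finset.range (j + 1), darbouxShift (ζ (i + 1)) (betaVector ζ b t i) := by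
  induction j with
  | zero => simp [darbouxCoeff_succ_zero, darbouxCoeff_self]
  | succ j ih =>
    rw [darbouxCoeff_succ_succ, ih, darbouxCoeff_self, mul_one, Finset.sum_range_succ _ (j + 1)]
    abel

theorem darbouxMatrix_succ (ζ b : ℕ → ℂ) (j : ℕ) (t : ℝ) (z : ℂ) :
    darbouxMatrix ζ b (j + 1) t z =
      (z • (1 : Matrix (Fin 2) (Fin 2) ℂ) - darbouxShift (ζ (j + 1)) (betaVector ζ b t j)) *
        darbouxMatrix ζ b j t z := by
  set M := darbouxShift (ζ (j + 1)) (betaVector ζ b t j) with hM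
  have h1 : ∑ k ∈ Finset.range (j + 1), z ^ (k + 1) • darbouxCoeff ζ b t j (k + 1) =
      darbouxMatrix ζ b j t z - darbouxCoeff ζ b t j 0 := by
    have e := Finset.sum_range_succ' (fun k => z ^ k • darbouxCoeff ζ b t j k) (j + 1)
    rw [Finset.sum_range_succ, darbouxCoeff_eq_zero ζ b t (Nat.lt_succ_self j), smul_zero,
      add_zero, pow_zero, one_smul] at e
    rw [darbouxMatrix, e, add_sub_cancel_right]
  have h2 : ∑ k ∈ Finset.range (j + 1), z ^ (k + 1) • darbouxCoeff ζ b t j k =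
      z • darbouxMatrix ζ b j t z := by
    rw [darbouxMatrix, Finset.smul_sum]
    exact Finset.sum_congr rfl fun k _ => by rw [smul_smul, pow_succ']
  rw [darbouxMatrix, Finset.sum_range_succ', darbouxCoeff_succ_zero]
  simp only [darbouxCoeff_succ_succ, smul_sub, ← Matrix.mul_smul, Finset.sum_sub_distrib,
    ← Finset.mul_sum]
  rw [h1, h2, sub_mul, smul_mul_assoc, one_mul, mul_sub, pow_zero, one_smul, ← hM]
  abel

theorem darbouxJost_eq_darbouxSolution (ζ b : ℕ → ℂ) (j : ℕ) (t : ℝ) (z : ℂ) :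
    darbouxJost ζ b t j z = darbouxSolution ζ b j t z := by
  induction j with
  | zero => simp [darbouxJost, darbouxSolution, darbouxMu, darbouxMatrix, darbouxCoeff, darbouxPoly]
  | succ j ih =>
    rw [darbouxJost_succ, ih, darbouxSolution, darbouxSolution, darbouxMatrix_succ, darbouxMu,
      darbouxMu, Finset.prod_Icc_succ_top (by omega), Matrix.mul_smul, smul_smul, mul_assoc,
      mul_comm]

theorem IsSpectralData.mono {K j : ℕ} {ζ b : ℕ → ℂ} (h : IsSpectralData K ζ b) (hj : j ≤ K) :
    IsSpectralData j ζ b :=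
  ⟨fun k hk => h.im_pos k (Finset.Icc_subset_Icc_right hj hk),
    fun k hk => h.norming_ne k (Finset.Icc_subset_Icc_right hj hk),
    h.distinct.mono (Set.Icc_subset_Icc_right hj)⟩

theorem IsSpectralData.im_pos_succ {K j : ℕ} {ζ b : ℕ → ℂ} (h : IsSpectralData K ζ b)
    (hj : j < K) : 0 < (ζ (j + 1)).im :=
  h.im_pos _ (Finset.mem_Icc.2 ⟨by omega, hj⟩)

theorem IsSpectralData.norming_ne_succ {K j : ℕ} {ζ b : ℕ → ℂ} (h : IsSpectralData K ζ b)
    (hj : j < K) : b (j + 1) ≠ 0 :=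
  h.norming_ne _ (Finset.mem_Icc.2 ⟨by omega, hj⟩)

/-- The Blaschke product with zeros `ζ_1, …, ζ_j`. -/
noncomputable def blaschke (ζ : ℕ → ℂ) (j : ℕ) (z : ℂ) : ℂ :=
  ∏ k ∈ Finset.Icc 1 j, (z - ζ k) / (z - conj (ζ k))

theorem blaschke_succ (ζ : ℕ → ℂ) (j : ℕ) (z : ℂ) :
    blaschke ζ (j + 1) z = blaschke ζ j z * ((z - ζ (j + 1)) / (z - conj (ζ (j + 1)))) :=
  Finset.prod_Icc_succ_top (by omega) _

theorem blaschke_eq_zero_iff {K : ℕ} {ζ b : ℕ → ℂ} (h : IsSpectralData K ζ b) {z : ℂ}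
    (hz : 0 ≤ z.im) : blaschke ζ K z = 0 ↔ ∃ k ∈ Finset.Icc 1 K, z = ζ k := by
  rw [blaschke, Finset.prod_eq_zero_iff]
  refine exists_congr fun k => and_congr_right fun hk => ?_
  rw [div_eq_zero_iff, or_iff_left (sub_conj_ne_zero hz (h.im_pos k hk)), sub_eq_zero]

theorem blaschke_succ_ne_zero {K j : ℕ} {ζ b : ℕ → ℂ} (h : IsSpectralData K ζ b) (hj : j < K) :
    blaschke ζ j (ζ (j + 1)) ≠ 0 := by
  rw [Ne, blaschke_eq_zero_iff (h.mono hj.le) (h.im_pos_succ hj).le]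
  rintro ⟨k, hk, hkj⟩
  rw [Finset.mem_Icc] at hk
  have := h.distinct ⟨by omega, hj⟩ ⟨hk.1, by omega⟩ hkj
  omega

theorem det_seed (t : ℝ) (z : ℂ) : (seed t z).det = 1 := by
  rw [seed, Matrix.det_fin_two_of, zero_mul, sub_zero, ← Complex.exp_add, neg_add_cancel,
    Complex.exp_zero]

theorem vec_ne_zero (c : ℂ) : (![1, c] : Fin 2 → ℂ) ≠ 0 := fun h => by simpa using congrFun h 0

/-- The determinant of a Darboux factor is known only if `betaVector` is nonzero. That follows from
the induction hypothesis at `ζ (j + 1)`, which by distinctness is not a zero of the previous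
Blaschke product. -/
theorem det_darbouxJost {K : ℕ} {ζ b : ℕ → ℂ} (h : IsSpectralData K ζ b) (t : ℝ) :
    ∀ j ≤ K, ∀ z : ℂ, 0 ≤ z.im → (darbouxJost ζ b t j z).det = blaschke ζ j z := by
  intro j
  induction j with
  | zero => intro _ z _; simp [darbouxJost, blaschke, det_seed]
  | succ j ih =>
    intro hj z hz
    have hne : betaVector ζ b t j ≠ 0 := by
      intro h0
      have hdet : IsUnit (darbouxJost ζ b t j (ζ (j + 1))) := by
        rw [Matrix.isUnit_iff_isUnit_det, ih (by omega) _ (h.im_pos_succ hj).le]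
        exact (blaschke_succ_ne_zero h hj).isUnit
      exact vec_ne_zero _ (Matrix.mulVec_injective_of_isUnit hdet
        (h0.trans (Matrix.mulVec_zero _).symm))
    have hzc := sub_conj_ne_zero hz (h.im_pos_succ hj)
    rw [darbouxJost_succ, Matrix.det_smul, Matrix.det_mul, det_sub_darbouxShift _ _ hne,
      ih (by omega) z hz, blaschke_succ, Fintype.card_fin]
    field_simp

theorem betaVector_ne_zero {K j : ℕ} {ζ b : ℕ → ℂ} (h : IsSpectralData K ζ b) (hj : j < K)
    (t : ℝ) : betaVector ζ b t j ≠ 0 := by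
  intro h0
  have hdet : IsUnit (darbouxJost ζ b t j (ζ (j + 1))) := by
    rw [Matrix.isUnit_iff_isUnit_det, det_darbouxJost h t j hj.le _ (h.im_pos_succ hj).le]
    exact (blaschke_succ_ne_zero h hj).isUnit
  exact vec_ne_zero _ (Matrix.mulVec_injective_of_isUnit hdet
    (h0.trans (Matrix.mulVec_zero _).symm))

theorem isZSSolution_seed (z : ℂ) (e : Fin 2 → ℂ) :
    IsZSSolution (fun _ => 0) z fun t => seed t z *ᵥ e := by
  have h0 : ∀ t : ℝ, (seed t z *ᵥ e) 0 = exp (-(I * z) * t) * e 0 := fun t => by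
    simp [seed, Matrix.mulVec, dotProduct, Fin.sum_univ_two]
  have h1 : ∀ t : ℝ, (seed t z *ᵥ e) 1 = exp (I * z * t) * e 1 := fun t => by
    simp [seed, Matrix.mulVec, dotProduct, Fin.sum_univ_two]
  refine isZSSolution_of_deriv (fun t => ?_) fun t => ?_
  · simp only [h0, h1]
    refine ((hasDerivAt_exp_mul (-(I * z)) t).mul_const (e 0)).congr_deriv ?_
    ring
  · simp only [h0, h1]
    refine ((hasDerivAt_exp_mul (I * z) t).mul_const (e 1)).congr_deriv ?_
    rw [map_zero]
    ring

theorem isZSSolution_darbouxJost {K : ℕ} {ζ b : ℕ → ℂ} (h : IsSpectralData K ζ b) :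
    ∀ j ≤ K, ∀ (z : ℂ) (e : Fin 2 → ℂ),
      IsZSSolution (darbouxPotential ζ b j) z fun t => darbouxJost ζ b t j z *ᵥ e := by
  intro j
  induction j with
  | zero => intro _ z e; exact isZSSolution_seed z e
  | succ j ih =>
    intro hj z e
    have hu : IsZSSolution (darbouxPotential ζ b j) (ζ (j + 1)) fun t => betaVector ζ b t j :=
      ih (by omega) _ _
    have := hu.darboux (fun t => betaVector_ne_zero h hj t) (ih (by omega) z e)
      (z - conj (ζ (j + 1)))⁻¹
    simp only [Matrix.mulVec_mulVec, smul_mul_assoc] at this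
    exact this

theorem isZSSolution_betaVector {K j : ℕ} {ζ b : ℕ → ℂ} (h : IsSpectralData K ζ b) (hj : j < K) :
    IsZSSolution (darbouxPotential ζ b j) (ζ (j + 1)) fun t => betaVector ζ b t j :=
  isZSSolution_darbouxJost h j hj.le _ _

theorem continuous_darbouxShift {K j : ℕ} {ζ b : ℕ → ℂ} (h : IsSpectralData K ζ b) (hj : j < K) :
    Continuous fun t => darbouxShift (ζ (j + 1)) (betaVector ζ b t j) 0 1 :=
  continuous_iff_continuousAt.2 fun t => (hasDerivAt_darbouxShift_fst_snd
    (isZSSolution_betaVector h hj) (betaVector_ne_zero h hj) t).continuousAt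

theorem continuous_darbouxPotential {K : ℕ} {ζ b : ℕ → ℂ} (h : IsSpectralData K ζ b) :
    ∀ j ≤ K, Continuous (darbouxPotential ζ b j) := by
  intro j
  induction j with
  | zero => intro _; exact continuous_const
  | succ j ih =>
    intro hj
    exact (ih (by omega)).sub ((continuous_darbouxShift h hj).const_mul (2 * I))

/-- `φ = b_k ψ` at the eigenvalues. -/
theorem darbouxJost_eigenvector {K : ℕ} {ζ b : ℕ → ℂ} (h : IsSpectralData K ζ b) (t : ℝ)
    (j : ℕ) (hj : j ≤ K) : ∀ k ∈ Finset.Icc 1 j, darbouxJost ζ b t j (ζ k) *ᵥ ![1, -b k] = 0 := by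
  induction j with
  | zero => intro k hk; simp at hk
  | succ j ih =>
    intro k hk
    rw [darbouxJost_succ, Matrix.smul_mulVec, ← Matrix.mulVec_mulVec]
    -- The new factor annihilates `betaVector` at the newest eigenvalue; at the older ones the
    -- vector is already zero.
    rcases (Finset.mem_Icc.1 hk).2.eq_or_lt with rfl | hlt
    · have := darbouxShift_mulVec (ζ (j + 1)) (betaVector_ne_zero h hj t)
      rw [← betaVector, Matrix.sub_mulVec, this, Matrix.smul_mulVec, Matrix.one_mulVec, sub_self,
        smul_zero]
    · rw [ih (by omega) k (Finset.mem_Icc.2 ⟨(Finset.mem_Icc.1 hk).1, by omega⟩),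
        Matrix.mulVec_zero, smul_zero]

/-! ### Time reversal -/

/-- Reversing time swaps the two exponentials of the seed, so (1, -b) becomes -b times the swapped
(1, -b⁻¹). -/
theorem darbouxFactor_reverse_step (ζ b : ℕ → ℂ) (t : ℝ) (j : ℕ)
    (hj : ∀ z i k, darbouxFactor ζ b (-t) j z i k = darbouxFactor ζ b⁻¹ t j z i.rev k.rev)
    (hb : b (j + 1) ≠ 0) :
    betaVector ζ b (-t) j = -b (j + 1) • (betaVector ζ b⁻¹ t j ∘ Fin.rev) := by
  have e0 : (Fin.rev 0 : Fin 2) = 1 := rfl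
  have e1 : (Fin.rev 1 : Fin 2) = 0 := rfl
  funext i
  simp only [betaVector, darbouxJost_eq_factor, ← Matrix.mulVec_mulVec]
  fin_cases i <;>
  · simp [Matrix.mulVec, dotProduct, Fin.sum_univ_two, seed, hj, e0, e1]
    field_simp
    ring

/-- Reduces every statement about t → +∞ to the one about t → -∞ for the data with inverted norming
constants. -/
theorem darbouxFactor_reverse {K : ℕ} {ζ b : ℕ → ℂ} (h : IsSpectralData K ζ b) (t : ℝ) :
    ∀ j ≤ K, ∀ z i k, darbouxFactor ζ b (-t) j z i k = darbouxFactor ζ b⁻¹ t j z i.rev k.rev := by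
  have e0 : (Fin.rev 0 : Fin 2) = 1 := rfl
  have e1 : (Fin.rev 1 : Fin 2) = 0 := rfl
  have o0 : (1 : Matrix (Fin 2) (Fin 2) ℂ) (Fin.rev 0) 1 = 1 := Matrix.one_apply_eq 1
  have o1 : (1 : Matrix (Fin 2) (Fin 2) ℂ) (Fin.rev 1) 0 = 1 := Matrix.one_apply_eq 0
  have o2 : (1 : Matrix (Fin 2) (Fin 2) ℂ) (Fin.rev 0) 0 = 0 := Matrix.one_apply_ne one_ne_zero
  have o3 : (1 : Matrix (Fin 2) (Fin 2) ℂ) (Fin.rev 1) 1 = 0 := Matrix.one_apply_ne zero_ne_one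
  intro j
  induction j with
  | zero => intro _ z i k; fin_cases i <;> fin_cases k <;> simp [darbouxFactor, e0, e1]
  | succ j ih =>
    intro hj z i k
    have hb := h.norming_ne_succ hj
    have hstep := darbouxFactor_reverse_step ζ b t j (ih (by omega)) hb
    have hM : ∀ i k, darbouxShift (ζ (j + 1)) (betaVector ζ b (-t) j) i k =
        darbouxShift (ζ (j + 1)) (betaVector ζ b⁻¹ t j) i.rev k.rev := fun i k => by
      rw [hstep, darbouxShift_smul _ (neg_ne_zero.2 hb), darbouxShift_rev]
    simp only [darbouxFactor, Matrix.smul_apply, Matrix.mul_apply, Fin.sum_univ_two,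
      Matrix.sub_apply, hM, ih (by omega) z]
    rcases (by decide : ∀ i : Fin 2, i = 0 ∨ i = 1) i with rfl | rfl <;>
    · simp only [o0, o1, o2, o3, e0, e1, Matrix.one_apply_eq, ne_eq, zero_ne_one,
        one_ne_zero, not_false_eq_true, Matrix.one_apply_ne]
      ring

theorem darbouxShift_reverse {K j : ℕ} {ζ b : ℕ → ℂ} (h : IsSpectralData K ζ b) (hj : j < K)
    (t : ℝ) (i k : Fin 2) : darbouxShift (ζ (j + 1)) (betaVector ζ b (-t) j) i k =
      darbouxShift (ζ (j + 1)) (betaVector ζ b⁻¹ t j) i.rev k.rev := by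
  rw [darbouxFactor_reverse_step ζ b t j (darbouxFactor_reverse h t j hj.le) (h.norming_ne_succ hj),
    darbouxShift_smul _ (neg_ne_zero.2 (h.norming_ne_succ hj)), darbouxShift_rev]

theorem IsSpectralData.inv {K : ℕ} {ζ b : ℕ → ℂ} (h : IsSpectralData K ζ b) :
    IsSpectralData K ζ b⁻¹ :=
  ⟨h.im_pos, fun k hk => inv_ne_zero (h.norming_ne k hk), h.distinct⟩

end

section

/-! ### Exponential asymptotics -/

/-- `f` tends to `L` at an exponential rate as `t → -∞`. -/
def ExpTendsto (f : ℝ → ℂ) (L : ℂ) : Prop :=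
  ∃ c > 0, (fun t => f t - L) =O[atBot] fun t => Real.exp (c * t)

namespace ExpTendsto

variable {f g : ℝ → ℂ} {L M : ℂ}

theorem isBigO_exp_of_le {c d : ℝ} (h : c ≤ d) :
    (fun t => Real.exp (d * t)) =O[atBot] fun t => Real.exp (c * t) := by
  refine Asymptotics.IsBigO.of_bound 1 ?_
  filter_upwards [eventually_le_atBot 0] with t ht
  rw [one_mul, Real.norm_of_nonneg (Real.exp_nonneg _), Real.norm_of_nonneg (Real.exp_nonneg _),
    Real.exp_le_exp]
  nlinarith

theorem tendsto (h : ExpTendsto f L) : Tendsto f atBot (𝓝 L) := by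
  obtain ⟨c, hc, hf⟩ := h
  have h1 : Tendsto (fun t => Real.exp (c * t)) atBot (𝓝 0) :=
    Real.tendsto_exp_atBot.comp (tendsto_id.const_mul_atBot hc)
  simpa using (hf.trans_tendsto h1).add_const L

theorem const (L : ℂ) : ExpTendsto (fun _ => L) L :=
  ⟨1, one_pos, by simpa using Asymptotics.isBigO_zero _ _⟩

theorem of_isBigO {F : ℝ → ℂ} {c d : ℝ} (hc : 0 < c) (hd : 0 < d) {G : ℝ → ℂ}
    (hF : F =O[atBot] fun t => Real.exp (c * t)) (hG : G =O[atBot] fun t => Real.exp (d * t))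
    (h : ∀ t, f t - L = F t + G t) : ExpTendsto f L := by
  refine ⟨min c d, lt_min hc hd, ?_⟩
  simp only [h]
  exact (hF.trans (isBigO_exp_of_le (min_le_left _ _))).add
    (hG.trans (isBigO_exp_of_le (min_le_right _ _)))

theorem add (hf : ExpTendsto f L) (hg : ExpTendsto g M) :
    ExpTendsto (fun t => f t + g t) (L + M) := by
  obtain ⟨c, hc, hf⟩ := hf
  obtain ⟨d, hd, hg⟩ := hg
  exact of_isBigO hc hd hf hg fun t => by ring

theorem mul (hf : ExpTendsto f L) (hg : ExpTendsto g M) :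
    ExpTendsto (fun t => f t * g t) (L * M) := by
  have hg1 : g =O[atBot] fun _ => (1 : ℝ) := hg.tendsto.isBigO_one ℝ
  obtain ⟨c, hc, hf⟩ := hf
  obtain ⟨d, hd, hg⟩ := hg
  have h1 : (fun t => (f t - L) * g t) =O[atBot] fun t => Real.exp (c * t) := by
    simpa using hf.mul hg1
  have h2 : (fun t => L * (g t - M)) =O[atBot] fun t => Real.exp (d * t) :=
    hg.const_mul_left L
  exact of_isBigO hc hd h1 h2 fun t => by ring

theorem const_mul (a : ℂ) (hf : ExpTendsto f L) : ExpTendsto (fun t => a * f t) (a * L) :=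
  (const a).mul hf

theorem sub (hf : ExpTendsto f L) (hg : ExpTendsto g M) :
    ExpTendsto (fun t => f t - g t) (L - M) := by
  simpa [sub_eq_add_neg] using hf.add (hg.const_mul (-1))

theorem star (hf : ExpTendsto f L) :
    ExpTendsto (fun t => starRingEnd ℂ (f t)) (starRingEnd ℂ L) := by
  obtain ⟨c, hc, hf⟩ := hf
  refine ⟨c, hc, ?_⟩
  refine (Asymptotics.isBigO_of_le _ fun t => ?_).trans hf
  rw [← map_sub, RCLike.norm_conj]

theorem inv (hf : ExpTendsto f L) (hL : L ≠ 0) : ExpTendsto (fun t => (f t)⁻¹) L⁻¹ := by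
  have hne := hf.tendsto.eventually_ne hL
  have hi : (fun t => (f t)⁻¹) =O[atBot] fun _ => (1 : ℝ) := (hf.tendsto.inv₀ hL).isBigO_one ℝ
  obtain ⟨c, hc, hf⟩ := hf
  refine ⟨c, hc, ?_⟩
  have h1 : (fun t => -L⁻¹ * ((f t - L) * (f t)⁻¹)) =O[atBot] fun t => Real.exp (c * t) := by
    simpa using (hf.mul hi).const_mul_left (-L⁻¹)
  refine h1.congr' ?_ EventuallyEq.rfl
  filter_upwards [hne] with t ht
  field_simp
  ring

theorem div (hf : ExpTendsto f L) (hg : ExpTendsto g M) (hM : M ≠ 0) :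
    ExpTendsto (fun t => f t / g t) (L / M) := by
  simpa [div_eq_mul_inv] using hf.mul (hg.inv hM)

theorem exp {a : ℂ} (ha : 0 < a.re) : ExpTendsto (fun t => Complex.exp (a * t)) 0 := by
  refine ⟨a.re, ha, Asymptotics.isBigO_of_le _ fun t => ?_⟩
  rw [sub_zero, Complex.norm_exp, Real.norm_of_nonneg (Real.exp_nonneg _)]
  simp

end ExpTendsto

/-- The line spanned by u converges to the second coordinate axis, so the shift converges to
diag(conj w, w). -/
theorem expTendsto_darbouxShift {w : ℂ} {u : ℝ → Fin 2 → ℂ} {L : ℂ}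
    (h0 : ExpTendsto (fun t => u t 0) 0) (h1 : ExpTendsto (fun t => u t 1) L) (hL : L ≠ 0) :
    ExpTendsto (fun t => darbouxShift w (u t) 0 0) (conj w) ∧
      ExpTendsto (fun t => darbouxShift w (u t) 0 1) 0 := by
  have hLc : conj L ≠ 0 := by simpa using hL
  have hn := (h0.mul h0.star).add (h1.mul h1.star)
  have hne : (0 : ℂ) * conj (0 : ℂ) + L * conj L ≠ 0 := by
    rw [zero_mul, zero_add]; exact mul_ne_zero hL hLc
  have hd := ExpTendsto.div
    (((h0.mul h0.star).mul (ExpTendsto.const w)).add ((h1.mul h1.star).mul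
      (ExpTendsto.const (conj w)))) hn hne
  have hd1 := ExpTendsto.div ((h0.mul h1.star).const_mul (w - conj w)) hn hne
  simp only [zero_mul, zero_add, mul_zero, zero_div] at hd hd1
  rw [mul_div_cancel_left₀ _ (mul_ne_zero hL hLc)] at hd
  simp only [darbouxShift_fst_fst, darbouxShift_fst_snd]
  exact ⟨hd, hd1⟩

section Asymptotics

variable {K : ℕ} {ζ b : ℕ → ℂ}

/-- The asymptotics of the Jost solutions, up to a scalar factor, at the next eigenvalue. -/
theorem expTendsto_shift_of_factor (h : IsSpectralData K ζ b) {j : ℕ} (hj : j < K)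
    (hf : ∀ z : ℂ, 0 ≤ z.im →
      ExpTendsto (fun t => darbouxFactor ζ b t j z 0 0) 1 ∧
      ExpTendsto (fun t => darbouxFactor ζ b t j z 0 1) 0 ∧
      ExpTendsto (fun t => darbouxFactor ζ b t j z 1 0) 0 ∧
      ExpTendsto (fun t => darbouxFactor ζ b t j z 1 1) (blaschke ζ j z)) :
    ExpTendsto (fun t => darbouxShift (ζ (j + 1)) (betaVector ζ b t j) 0 0) (conj (ζ (j + 1))) ∧
      ExpTendsto (fun t => darbouxShift (ζ (j + 1)) (betaVector ζ b t j) 0 1) 0 := by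
  set w := ζ (j + 1)
  have hw := h.im_pos_succ hj
  obtain ⟨f00, f01, f10, f11⟩ := hf w hw.le
  have he : ExpTendsto (fun t => exp (-(2 * I * w) * t)) 0 := ExpTendsto.exp (by simpa using hw)
  -- As Im w > 0, the factor e^{iwt} dominates at -∞. After removing it, the contribution of φ
  -- carries e^{-2iwt} → 0 and that of ψ converges to a nonzero multiple of (0, 1).
  have hscale : ∀ t, betaVector ζ b t j = exp (I * w * t) •
      ![darbouxFactor ζ b t j w 0 0 * exp (-(2 * I * w) * t) + -b (j + 1) * darbouxFactor ζ b t j w 0 1,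
        darbouxFactor ζ b t j w 1 0 * exp (-(2 * I * w) * t)
          + -b (j + 1) * darbouxFactor ζ b t j w 1 1] := by
    intro t
    have e : exp (-(I * w * t)) = exp (I * w * t) * exp (-(2 * I * w) * t) := by
      rw [← Complex.exp_add]; congr 1; ring
    rw [betaVector, darbouxJost_eq_factor, ← Matrix.mulVec_mulVec]
    funext i
    fin_cases i <;>
    · simp [Matrix.mulVec, dotProduct, Fin.sum_univ_two, seed, w, e]
      ring
  simp only [hscale, darbouxShift_smul w (Complex.exp_ne_zero _)]
  refine expTendsto_darbouxShift (L := -b (j + 1) * blaschke ζ j w) ?_ ?_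
    (mul_ne_zero (neg_ne_zero.2 (h.norming_ne_succ hj)) (blaschke_succ_ne_zero h hj))
  · simpa using (f00.mul he).add (f01.const_mul (-b (j + 1)))
  · simpa using (f10.mul he).add (f11.const_mul (-b (j + 1)))

/-- Each Darboux factor, divided by z - conj w, tends to diag(1, (z - w) / (z - conj w)). The
induction alternates with the asymptotics of the next shift, which needs the factor at the next
eigenvalue. -/
theorem expTendsto_darbouxFactor (h : IsSpectralData K ζ b) : ∀ j ≤ K, ∀ z : ℂ, 0 ≤ z.im →
    ExpTendsto (fun t => darbouxFactor ζ b t j z 0 0) 1 ∧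
    ExpTendsto (fun t => darbouxFactor ζ b t j z 0 1) 0 ∧
    ExpTendsto (fun t => darbouxFactor ζ b t j z 1 0) 0 ∧
    ExpTendsto (fun t => darbouxFactor ζ b t j z 1 1) (blaschke ζ j z) := by
  intro j
  induction j with
  | zero =>
    intro _ z _
    simp only [darbouxFactor, blaschke]
    simpa using ⟨ExpTendsto.const 1, ExpTendsto.const 0, ExpTendsto.const 1⟩
  | succ j ih =>
    intro hj z hz
    obtain ⟨m00, m01⟩ := expTendsto_shift_of_factor h hj (ih (by omega))
    obtain ⟨f00, f01, f10, f11⟩ := ih (by omega) z hz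
    set w := ζ (j + 1) with hw
    have hzw := sub_conj_ne_zero hz (h.im_pos_succ hj)
    have e : ∀ t i k, darbouxFactor ζ b t (j + 1) z i k = (z - conj w)⁻¹ *
        ((z * (1 : Matrix (Fin 2) (Fin 2) ℂ) i 0 - darbouxShift w (betaVector ζ b t j) i 0) *
          darbouxFactor ζ b t j z 0 k +
        (z * (1 : Matrix (Fin 2) (Fin 2) ℂ) i 1 - darbouxShift w (betaVector ζ b t j) i 1) *
          darbouxFactor ζ b t j z 1 k) := by
      intro t i k
      simp [darbouxFactor, Matrix.mul_apply, Fin.sum_univ_two, hw]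
    have c := ExpTendsto.const z
    simp only [e, darbouxShift_snd_fst, darbouxShift_snd_snd, Matrix.one_apply_eq, ne_eq,
      zero_ne_one, one_ne_zero, not_false_eq_true, Matrix.one_apply_ne, mul_one, mul_zero, zero_sub,
      neg_neg]
    refine ⟨?_, ?_, ?_, ?_⟩
    · have := (((c.sub m00).mul f00).add ((m01.const_mul (-1)).mul f10)).const_mul (z - conj w)⁻¹
      have e2 : (z - conj w)⁻¹ * ((z - conj w) * 1 + -1 * 0 * 0) = 1 := by
        rw [mul_one, mul_zero, add_zero, inv_mul_cancel₀ hzw]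
      rw [e2] at this
      simpa only [neg_one_mul] using this
    · have := (((c.sub m00).mul f01).add ((m01.const_mul (-1)).mul f11)).const_mul (z - conj w)⁻¹
      simpa using this
    · have := ((m01.star.mul f00).add ((c.sub m00.star).mul f10)).const_mul (z - conj w)⁻¹
      simpa using this
    · have := ((m01.star.mul f01).add ((c.sub m00.star).mul f11)).const_mul (z - conj w)⁻¹
      rw [blaschke_succ]
      have e2 : blaschke ζ j z * ((z - w) / (z - conj w)) = (z - conj w)⁻¹ *
          (conj 0 * 0 + (z - conj (conj w)) * blaschke ζ j z) := by
        rw [conj_conj, map_zero, zero_mul, zero_add]; ring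
      rw [← hw, e2]
      exact this

theorem expTendsto_darbouxShift_iteration (h : IsSpectralData K ζ b) {j : ℕ} (hj : j < K) :
    ExpTendsto (fun t => darbouxShift (ζ (j + 1)) (betaVector ζ b t j) 0 0) (conj (ζ (j + 1))) ∧
      ExpTendsto (fun t => darbouxShift (ζ (j + 1)) (betaVector ζ b t j) 0 1) 0 :=
  expTendsto_shift_of_factor h hj (expTendsto_darbouxFactor h j hj.le)

theorem expTendsto_darbouxPotential (h : IsSpectralData K ζ b) :
    ∀ j ≤ K, ExpTendsto (darbouxPotential ζ b j) 0 := by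
  intro j
  induction j with
  | zero => intro _; exact ExpTendsto.const 0
  | succ j ih =>
    intro hj
    have := (ih (by omega)).sub ((expTendsto_darbouxShift_iteration h hj).2.const_mul (2 * I))
    simpa [darbouxPotential] using this

theorem darbouxPotential_reverse (h : IsSpectralData K ζ b) (t : ℝ) :
    ∀ j ≤ K, darbouxPotential ζ b j (-t) = conj (darbouxPotential ζ b⁻¹ j t) := by
  intro j
  induction j with
  | zero => intro _; simp [darbouxPotential]
  | succ j ih =>
    intro hj
    have e0 : (Fin.rev 0 : Fin 2) = 1 := rfl
    have e1 : (Fin.rev 1 : Fin 2) = 0 := rfl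
    simp only [darbouxPotential, ih (by omega), darbouxShift_reverse h hj, e0, e1,
      darbouxShift_snd_fst, map_sub, map_mul, conj_I, map_ofNat]
    ring

theorem isBigO_exp_atTop_of_reverse {f : ℝ → ℂ} (h : ExpTendsto (fun t => f (-t)) 0) :
    ∃ c > 0, f =O[atTop] fun t => Real.exp (-c * t) := by
  obtain ⟨c, hc, hf⟩ := h
  refine ⟨c, hc, ?_⟩
  have := hf.comp_tendsto tendsto_neg_atTop_atBot
  simpa [Function.comp_def] using this

theorem integrable_of_expTendsto {f : ℝ → ℂ} (hc : Continuous f) (h : ExpTendsto f 0)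
    (h' : ExpTendsto (fun t => f (-t)) 0) : Integrable f := by
  obtain ⟨c, hc0, hf⟩ := h
  obtain ⟨d, hd0, hg⟩ := isBigO_exp_atTop_of_reverse h'
  simp only [sub_zero] at hf
  exact hc.locallyIntegrable.integrable_of_isBigO_atBot_atTop hf
    ⟨Set.Iic 0, Iic_mem_atBot 0, integrableOn_exp_mul_Iic hc0 0⟩ hg
    ⟨Set.Ioi 0, Ioi_mem_atTop 0, integrableOn_exp_mul_Ioi (neg_lt_zero.2 hd0) 0⟩

theorem expTendsto_darbouxPotential_reverse (h : IsSpectralData K ζ b) {j : ℕ} (hj : j ≤ K) :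
    ExpTendsto (fun t => darbouxPotential ζ b j (-t)) 0 := by
  simp only [darbouxPotential_reverse h _ j hj]
  simpa using (expTendsto_darbouxPotential h.inv j hj).star

theorem integrable_darbouxPotential (h : IsSpectralData K ζ b) {j : ℕ} (hj : j ≤ K) :
    Integrable (darbouxPotential ζ b j) :=
  integrable_of_expTendsto (continuous_darbouxPotential h j hj)
    (expTendsto_darbouxPotential h j hj) (expTendsto_darbouxPotential_reverse h hj)

theorem integrable_darbouxPotential_sq (h : IsSpectralData K ζ b) {j : ℕ} (hj : j ≤ K) :
    Integrable fun t => ‖darbouxPotential ζ b j t‖ ^ 2 := by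
  have h1 := expTendsto_darbouxPotential h j hj
  have h2 := expTendsto_darbouxPotential_reverse h hj
  have hc := continuous_darbouxPotential h j hj
  have := (integrable_of_expTendsto (f := fun t => darbouxPotential ζ b j t * darbouxPotential ζ b j t)
    (hc.mul hc) (by simpa using h1.mul h1)
    (by simpa using h2.mul h2)).norm
  simpa [pow_two] using this

end Asymptotics
end

section

/-! ### Soliton potentials -/

section Soliton

variable {K : ℕ} {ζ b : ℕ → ℂ}

theorem col_zero_eq_mulVec (A : Matrix (Fin 2) (Fin 2) ℂ) : A.col 0 = A *ᵥ ![1, 0] := by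
  funext i; simp [Matrix.mulVec, dotProduct, Fin.sum_univ_two]

theorem col_one_eq_mulVec (A : Matrix (Fin 2) (Fin 2) ℂ) : A.col 1 = A *ᵥ ![0, 1] := by
  funext i; simp [Matrix.mulVec, dotProduct, Fin.sum_univ_two]

theorem darbouxJost_apply_zero (t : ℝ) (j : ℕ) (z : ℂ) (i : Fin 2) :
    darbouxJost ζ b t j z i 0 = darbouxFactor ζ b t j z i 0 * exp (-(I * z * t)) := by
  rw [darbouxJost_eq_factor, Matrix.mul_apply, Fin.sum_univ_two]; simp [seed]

theorem darbouxJost_apply_one (t : ℝ) (j : ℕ) (z : ℂ) (i : Fin 2) :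
    darbouxJost ζ b t j z i 1 = darbouxFactor ζ b t j z i 1 * exp (I * z * t) := by
  rw [darbouxJost_eq_factor, Matrix.mul_apply, Fin.sum_univ_two]; simp [seed]

theorem isJostPhi_darboux (h : IsSpectralData K ζ b) {j : ℕ} (hj : j ≤ K) {z : ℂ}
    (hz : 0 ≤ z.im) :
    IsJostPhi (darbouxPotential ζ b j) z fun t => (darbouxJost ζ b t j z).col 0 := by
  refine ⟨?_, ?_⟩
  · simp only [col_zero_eq_mulVec]
    exact isZSSolution_darbouxJost h j hj z _
  · obtain ⟨f00, -, f10, -⟩ := expTendsto_darbouxFactor h j hj z hz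
    have e : ∀ (t : ℝ) i, (exp (I * z * t) • (darbouxJost ζ b t j z).col 0) i
        = darbouxFactor ζ b t j z i 0 := by
      intro t i
      rw [Pi.smul_apply, Matrix.col_apply, darbouxJost_apply_zero, smul_eq_mul, Complex.exp_neg]
      field_simp
    refine tendsto_pi_nhds.2 fun i => ?_
    simp only [e]
    fin_cases i
    · exact f00.tendsto
    · exact f10.tendsto

/-- By time reversal ψ at +∞ is the swapped φ at -∞ of the iteration with b⁻¹. -/
theorem isJostPsi_darboux (h : IsSpectralData K ζ b) {j : ℕ} (hj : j ≤ K) {z : ℂ}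
    (hz : 0 ≤ z.im) :
    IsJostPsi (darbouxPotential ζ b j) z fun t => (darbouxJost ζ b t j z).col 1 := by
  refine ⟨?_, ?_⟩
  · simp only [col_one_eq_mulVec]
    exact isZSSolution_darbouxJost h j hj z _
  · obtain ⟨f00, -, f10, -⟩ := expTendsto_darbouxFactor h.inv j hj z hz
    have e : ∀ (t : ℝ) i, (exp (-(I * z * t)) • (darbouxJost ζ b t j z).col 1) i
        = darbouxFactor ζ b⁻¹ (-t) j z i.rev 0 := by
      intro t i
      have := darbouxFactor_reverse h (-t) j hj z i 1
      rw [neg_neg] at this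
      rw [Pi.smul_apply, Matrix.col_apply, darbouxJost_apply_one, smul_eq_mul, Complex.exp_neg,
        this]
      field_simp
      rfl
    refine tendsto_pi_nhds.2 fun i => ?_
    simp only [e]
    fin_cases i
    · exact f10.tendsto.comp tendsto_neg_atTop_atBot
    · exact f00.tendsto.comp tendsto_neg_atTop_atBot

/-- Real multiples of the identity are quaternionic, so at real ξ all factors are; this is the
source of b = 0. -/
theorem isQuaternionic_darbouxMatrix (j : ℕ) (t ξ : ℝ) :
    IsQuaternionic (darbouxMatrix ζ b j t ξ) := by
  induction j with
  | zero =>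
    simpa [darbouxMatrix, darbouxCoeff, darbouxPoly] using IsQuaternionic.one
  | succ j ih =>
    rw [darbouxMatrix_succ]
    exact ((IsQuaternionic.one.ofReal_smul ξ).sub (isQuaternionic_darbouxShift _ _)).mul ih

theorem isQuaternionic_seed (t ξ : ℝ) : IsQuaternionic (seed t ξ) := by
  constructor
  · simp [seed, ← Complex.exp_conj]
  · simp [seed]

theorem darbouxJost_col_orthogonal (j : ℕ) (t ξ : ℝ) :
    conj (darbouxJost ζ b t j ξ 0 1) * darbouxJost ζ b t j ξ 0 0 +
      conj (darbouxJost ζ b t j ξ 1 1) * darbouxJost ζ b t j ξ 1 0 = 0 := by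
  rw [darbouxJost_eq_darbouxSolution]
  exact ((isQuaternionic_darbouxMatrix j t ξ).mul (isQuaternionic_seed t ξ)).col_orthogonal _

/-- On the real line the first kind Jost solution `ψ̄` is obtained from `ψ` by conjugation. -/
theorem IsJostPsi.isJostPsiBar {q : ℝ → ℂ} {ξ : ℝ} {ψ : ℝ → Fin 2 → ℂ} (h : IsJostPsi q ξ ψ) :
    IsJostPsiBar q ξ fun t => ![conj (ψ t 1), -conj (ψ t 0)] := by
  refine ⟨isZSSolution_of_deriv (fun t => ?_) fun t => ?_, ?_⟩
  · refine (hasDerivAt_conj (h.1.deriv_snd t)).congr_deriv ?_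
    simp
    ring
  · refine (hasDerivAt_conj (h.1.deriv_fst t)).neg.congr_deriv ?_
    simp
  · have hl := tendsto_pi_nhds.1 h.2
    have l0 := (Complex.continuous_conj.tendsto _).comp (hl 0)
    have l1 := (Complex.continuous_conj.tendsto _).comp (hl 1)
    have e : ∀ t : ℝ, conj (exp (-(I * ξ * t))) = exp (I * ξ * t) := fun t => by
      rw [← Complex.exp_conj]; simp
    refine tendsto_pi_nhds.2 fun i => ?_
    fin_cases i
    · simpa [Function.comp_def, e] using l1
    · simpa [Function.comp_def, e] using l0.neg

theorem wronskian_darbouxJost (h : IsSpectralData K ζ b) {j : ℕ} (hj : j ≤ K) {z : ℂ}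
    (hz : 0 ≤ z.im) (t : ℝ) :
    wronskian ((darbouxJost ζ b t j z).col 0) ((darbouxJost ζ b t j z).col 1) = blaschke ζ j z := by
  rw [← det_darbouxJost h t j hj z hz, Matrix.det_fin_two]
  simp only [wronskian, Matrix.col_apply]
  ring

theorem deriv_blaschke_ne_zero (h : IsSpectralData K ζ b) {k : ℕ} (hk : k ∈ Finset.Icc 1 K) :
    deriv (blaschke ζ K) (ζ k) ≠ 0 := by
  have him := h.im_pos k hk
  -- The cofactor of z - ζ_k; its value at ζ_k is the derivative there, nonzero because the
  -- eigenvalues are distinct.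
  set g : ℂ → ℂ := fun z => (∏ i ∈ (Finset.Icc 1 K).erase k, (z - ζ i) / (z - conj (ζ i))) /
    (z - conj (ζ k)) with hg
  have e : blaschke ζ K = fun z => (z - ζ k) * g z := by
    funext z
    rw [blaschke, ← Finset.mul_prod_erase _ _ hk, hg]
    ring
  have hne : ∀ i ∈ Finset.Icc 1 K, ζ k - conj (ζ i) ≠ 0 := fun i hi =>
    sub_conj_ne_zero him.le (h.im_pos i hi)
  have hd : DifferentiableAt ℂ g (ζ k) := by
    refine DifferentiableAt.div ?_ (by fun_prop) (hne k hk)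
    refine DifferentiableAt.fun_finsetProd fun i hi => ?_
    exact DifferentiableAt.div (by fun_prop) (by fun_prop) (hne i (Finset.mem_of_mem_erase hi))
  have h1 := ((hasDerivAt_id (ζ k)).sub_const (ζ k)).mul hd.hasDerivAt
  have h2 : HasDerivAt (blaschke ζ K) (g (ζ k)) (ζ k) := by
    rw [e]
    refine h1.congr_deriv ?_
    simp
  rw [h2.deriv, hg]
  refine div_ne_zero (Finset.prod_ne_zero_iff.2 fun i hi => ?_) (hne k hk)
  refine div_ne_zero (sub_ne_zero.2 fun hik => ?_) (hne i (Finset.mem_of_mem_erase hi))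
  have hi' := Finset.mem_of_mem_erase hi
  exact Finset.ne_of_mem_erase hi (h.distinct (by simpa using hi') (by simpa using hk) hik.symm)

/-- The Darboux iteration produces soliton potentials. -/
theorem isSolitonPotential_darboux (h : IsSpectralData K ζ b) {j : ℕ} (hj : j ≤ K) :
    IsSolitonPotential j ζ b (darbouxPotential ζ b j) := by
  refine ⟨continuous_darbouxPotential h j hj, integrable_darbouxPotential h hj,
    ⟨blaschke ζ j, fun z hz => ⟨_, _, isJostPhi_darboux h hj hz, isJostPsi_darboux h hj hz,
      fun t => (wronskian_darbouxJost h hj hz t).symm⟩,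
      fun z hz => blaschke_eq_zero_iff (h.mono hj) hz.le,
      fun k hk => deriv_blaschke_ne_zero (h.mono hj) hk⟩, fun k hk => ?_, fun ξ => ?_⟩
  · have him := ((h.mono hj).im_pos k hk).le
    refine ⟨_, _, isJostPhi_darboux h hj him, isJostPsi_darboux h hj him, fun t => ?_⟩
    have := darbouxJost_eigenvector h t j hj k hk
    funext i
    have hi := congrFun this i
    simp only [Matrix.mulVec, dotProduct, Fin.sum_univ_two, Matrix.cons_val_zero,
      Matrix.cons_val_one, Matrix.cons_val_fin_one, Pi.zero_apply] at hi
    simp only [Matrix.col_apply, Pi.smul_apply, smul_eq_mul]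
    linear_combination hi
  · have him : 0 ≤ (ξ : ℂ).im := by simp
    refine ⟨_, _, isJostPhi_darboux h hj him, (isJostPsi_darboux h hj him).isJostPsiBar,
      fun t => ?_⟩
    have := darbouxJost_col_orthogonal (ζ := ζ) (b := b) j t ξ
    simp only [wronskian, Matrix.col_apply, Matrix.cons_val_zero, Matrix.cons_val_one,
      Matrix.cons_val_fin_one]
    linear_combination -this

/-- Soliton potentials are determined by their discrete spectrum. -/
theorem IsSolitonPotential.eq_darbouxPotential (h : IsSpectralData K ζ b) {j : ℕ} (hj : j ≤ K)
    {q : ℝ → ℂ} (hq : IsSolitonPotential j ζ b q) : q = darbouxPotential ζ b j := by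
  refine hq.eq_of_blaschke (h.mono hj) (isSolitonPotential_darboux h hj)
    (fun z hz => isJostPhi_darboux h hj hz) (fun z hz => isJostPsi_darboux h hj hz)
    fun z hz t => ?_
  rw [wronskian_darbouxJost h hj hz, blaschke, Finset.prod_div_distrib, div_mul_cancel₀]
  exact Finset.prod_ne_zero_iff.2 fun k hk => sub_conj_ne_zero hz ((h.mono hj).im_pos k hk)

/-! ### Energies -/

/-- The fraction `|β_j|² / (1 + |β_j|²)`. -/
noncomputable def energyFraction (ζ b : ℕ → ℂ) (j : ℕ) (t : ℝ) : ℝ :=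
  ‖betaVector ζ b t j 0‖ ^ 2 / (‖betaVector ζ b t j 0‖ ^ 2 + ‖betaVector ζ b t j 1‖ ^ 2)

/-- The energy to the left of `t`, as computed by the Darboux iteration. -/
noncomputable def darbouxEnergy (ζ b : ℕ → ℂ) (j : ℕ) (t : ℝ) : ℝ :=
  ∑ i ∈ Finset.range j, 4 * (ζ (i + 1)).im * energyFraction ζ b i t

theorem darbouxShift_iteration_fst_fst (h : IsSpectralData K ζ b) {j : ℕ} (hj : j < K) (t : ℝ) :
    darbouxShift (ζ (j + 1)) (betaVector ζ b t j) 0 0 = conj (ζ (j + 1)) +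
      2 * I * ((ζ (j + 1)).im * energyFraction ζ b j t : ℝ) := by
  rw [energyFraction, ← darbouxShift_fst_fst_sub _ (betaVector_ne_zero h hj t)]
  ring

/-- Transfers the derivative and the limits of the shift entry to the energy increment. -/
theorem energyFraction_eq_im (h : IsSpectralData K ζ b) {j : ℕ} (hj : j < K) (t : ℝ) :
    4 * (ζ (j + 1)).im * energyFraction ζ b j t =
      2 * (darbouxShift (ζ (j + 1)) (betaVector ζ b t j) 0 0).im + 2 * (ζ (j + 1)).im := by
  rw [darbouxShift_iteration_fst_fst h hj]
  have e : (2 * I * ((ζ (j + 1)).im * energyFraction ζ b j t : ℝ) : ℂ).im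
      = 2 * ((ζ (j + 1)).im * energyFraction ζ b j t) := by
    simp [mul_assoc]
  rw [Complex.add_im, e, Complex.conj_im]
  ring

end Soliton
end

/-! ### The energy as a telescoping sum -/

section

section Energy

variable {K : ℕ} {ζ b : ℕ → ℂ}

/-- With m = M₁₂ the expression inside the imaginary part is the derivative of M₁₁ found in
`hasDerivAt_darbouxShift_fst_fst`. Thus the gain of |q|² in one step is a total derivative. -/
theorem norm_sub_two_I_mul_sq (q m : ℂ) :
    ‖q - 2 * I * m‖ ^ 2 =
      ‖q‖ ^ 2 + 2 * (2 * I * m * conj m - q * conj m + conj q * m).im := by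
  rw [← Complex.normSq_eq_norm_sq, ← Complex.normSq_eq_norm_sq, Complex.normSq_apply,
    Complex.normSq_apply]
  simp
  ring

theorem darbouxEnergy_succ (j : ℕ) (t : ℝ) : darbouxEnergy ζ b (j + 1) t =
    darbouxEnergy ζ b j t + 4 * (ζ (j + 1)).im * energyFraction ζ b j t :=
  Finset.sum_range_succ _ _

theorem hasDerivAt_darbouxEnergy (h : IsSpectralData K ζ b) (t : ℝ) :
    ∀ j ≤ K, HasDerivAt (darbouxEnergy ζ b j) (‖darbouxPotential ζ b j t‖ ^ 2) t := by
  intro j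
  induction j with
  | zero =>
    intro _
    have : darbouxEnergy ζ b 0 = fun _ => 0 := funext fun t => by simp [darbouxEnergy]
    rw [this]
    simpa [darbouxPotential] using hasDerivAt_const t (0 : ℝ)
  | succ j ih =>
    intro hj
    have e : darbouxEnergy ζ b (j + 1) = fun t => darbouxEnergy ζ b j t +
        (2 * (darbouxShift (ζ (j + 1)) (betaVector ζ b t j) 0 0).im + 2 * (ζ (j + 1)).im) :=
      funext fun t => by rw [darbouxEnergy_succ, energyFraction_eq_im h hj]
    have hM := Complex.imCLM.hasFDerivAt.comp_hasDerivAt t (hasDerivAt_darbouxShift_fst_fst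
      (isZSSolution_betaVector h hj) (betaVector_ne_zero h hj) t)
    rw [e]
    refine ((ih (by omega)).add ((hM.const_mul 2).add_const _)).congr_deriv ?_
    rw [darbouxPotential, norm_sub_two_I_mul_sq]
    rfl

theorem tendsto_energyFraction_atBot (h : IsSpectralData K ζ b) {j : ℕ} (hj : j < K) :
    Tendsto (fun t => 4 * (ζ (j + 1)).im * energyFraction ζ b j t) atBot (𝓝 0) := by
  simp only [energyFraction_eq_im h hj]
  have := (((Complex.continuous_im.tendsto _).comp
    (expTendsto_darbouxShift_iteration h hj).1.tendsto).const_mul 2).add_const (2 * (ζ (j + 1)).im)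
  simpa [Function.comp_def] using this

theorem tendsto_energyFraction_atTop (h : IsSpectralData K ζ b) {j : ℕ} (hj : j < K) :
    Tendsto (fun t => 4 * (ζ (j + 1)).im * energyFraction ζ b j t) atTop
      (𝓝 (4 * (ζ (j + 1)).im)) := by
  simp only [energyFraction_eq_im h hj]
  have e : ∀ t, (darbouxShift (ζ (j + 1)) (betaVector ζ b t j) 0 0).im =
      -(darbouxShift (ζ (j + 1)) (betaVector ζ b⁻¹ (-t) j) 0 0).im := by
    intro t
    have e0 : (Fin.rev 0 : Fin 2) = 1 := rfl
    have := darbouxShift_reverse h hj (-t) 0 0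
    rw [neg_neg, e0, darbouxShift_snd_snd] at this
    rw [this, Complex.conj_im]
  simp only [e]
  have := (((Complex.continuous_im.tendsto _).comp
    ((expTendsto_darbouxShift_iteration h.inv hj).1.tendsto.comp
      tendsto_neg_atTop_atBot)).neg.const_mul 2).add_const (2 * (ζ (j + 1)).im)
  rw [Complex.conj_im, neg_neg, ← two_mul, ← mul_assoc, show (2 : ℝ) * 2 = 4 by norm_num] at this
  exact this

theorem sum_Icc_eq_sum_range {M : Type*} [AddCommMonoid M] (f : ℕ → M) (j : ℕ) :
    ∑ k ∈ Finset.Icc 1 j, f k = ∑ i ∈ Finset.range j, f (i + 1) := by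
  induction j with
  | zero => simp
  | succ j ih => rw [Finset.sum_Icc_succ_top (by omega), ih, Finset.sum_range_succ]

theorem tendsto_darbouxEnergy_atBot (h : IsSpectralData K ζ b) {j : ℕ} (hj : j ≤ K) :
    Tendsto (darbouxEnergy ζ b j) atBot (𝓝 0) := by
  have := tendsto_finsetSum (Finset.range j) fun i hi =>
    tendsto_energyFraction_atBot h (lt_of_lt_of_le (Finset.mem_range.1 hi) hj)
  rw [Finset.sum_const_zero] at this
  exact this

theorem tendsto_darbouxEnergy_atTop (h : IsSpectralData K ζ b) {j : ℕ} (hj : j ≤ K) :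
    Tendsto (darbouxEnergy ζ b j) atTop (𝓝 (4 * ∑ k ∈ Finset.Icc 1 j, (ζ k).im)) := by
  have := tendsto_finsetSum (Finset.range j) fun i hi =>
    tendsto_energyFraction_atTop h (lt_of_lt_of_le (Finset.mem_range.1 hi) hj)
  rw [sum_Icc_eq_sum_range, Finset.mul_sum]
  exact this

theorem energyLeft_darboux (h : IsSpectralData K ζ b) {j : ℕ} (hj : j ≤ K) (t : ℝ) :
    energyLeft (darbouxPotential ζ b j) t = darbouxEnergy ζ b j t := by
  rw [energyLeft, integral_Iic_of_hasDerivAt_of_tendsto'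
    (fun s _ => hasDerivAt_darbouxEnergy h s j hj)
    (integrable_darbouxPotential_sq h hj).integrableOn (tendsto_darbouxEnergy_atBot h hj), sub_zero]

theorem energyRight_darboux (h : IsSpectralData K ζ b) {j : ℕ} (hj : j ≤ K) (t : ℝ) :
    energyRight (darbouxPotential ζ b j) t =
      4 * ∑ k ∈ Finset.Icc 1 j, (ζ k).im - darbouxEnergy ζ b j t := by
  rw [energyRight, integral_Ioi_of_hasDerivAt_of_tendsto'
    (fun s _ => hasDerivAt_darbouxEnergy h s j hj)
    (integrable_darbouxPotential_sq h hj).integrableOn (tendsto_darbouxEnergy_atTop h hj)]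

theorem totalEnergy_darboux (h : IsSpectralData K ζ b) {j : ℕ} (hj : j ≤ K) :
    totalEnergy (darbouxPotential ζ b j) = 4 * ∑ k ∈ Finset.Icc 1 j, (ζ k).im := by
  have h1 := intervalIntegral.integral_Iic_add_Ioi (b := (0 : ℝ))
    (integrable_darbouxPotential_sq h hj).integrableOn
    (integrable_darbouxPotential_sq h hj).integrableOn
  have h2 := energyLeft_darboux h hj 0
  have h3 := energyRight_darboux h hj 0
  rw [energyLeft] at h2
  rw [energyRight] at h3
  rw [totalEnergy, ← h1, h2, h3]
  ring

theorem tailEnergy_eq {q : ℝ → ℂ} (hq : Integrable fun t => ‖q t‖ ^ 2) {Tm Tp : ℝ} (hm : 0 < Tm)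
    (hp : 0 < Tp) : tailEnergy q Tm Tp = energyLeft q (-Tm) + energyRight q Tp := by
  have e : (Set.Icc (-Tm) Tp)ᶜ = Set.Iio (-Tm) ∪ Set.Ioi Tp := by
    ext s
    simp only [Set.mem_compl_iff, Set.mem_Icc, Set.mem_union, Set.mem_Iio, Set.mem_Ioi]
    rw [not_and_or, not_le, not_le]
  have hd : Disjoint (Set.Iio (-Tm)) (Set.Ioi Tp) :=
    Set.disjoint_left.2 fun s h1 h2 => by
      simp only [Set.mem_Iio, Set.mem_Ioi] at h1 h2
      linarith
  rw [tailEnergy, e, setIntegral_union hd measurableSet_Ioi hq.integrableOn hq.integrableOn,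
    energyLeft, energyRight, integral_Iic_eq_integral_Iio]

/-! ### The formulas of the Darboux iteration -/

theorem darbouxPotential_eq_sum (j : ℕ) (t : ℝ) : darbouxPotential ζ b j t =
    -(2 * I * ∑ i ∈ Finset.range j, darbouxShift (ζ (i + 1)) (betaVector ζ b t i) 0 1) := by
  induction j with
  | zero => simp [darbouxPotential]
  | succ j ih =>
    rw [Finset.sum_range_succ, mul_add, neg_add, ← ih, ← sub_eq_add_neg]
    rfl

theorem darbouxPotential_eq_dOne {j : ℕ} (hj : 1 ≤ j) (t : ℝ) :
    darbouxPotential ζ b j t = 2 * I * dOne ζ b j (j - 1) t := by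
  obtain ⟨j, rfl⟩ := Nat.exists_eq_add_of_le' hj
  rw [darbouxPotential_eq_sum, dOne, Nat.add_sub_cancel, darbouxCoeff_pred, Matrix.neg_apply,
    Matrix.sum_apply, mul_neg]

theorem darbouxEnergy_eq_dZero (h : IsSpectralData K ζ b) {j : ℕ} (hj : 1 ≤ j) (hjK : j ≤ K)
    (t : ℝ) : (darbouxEnergy ζ b j t : ℂ) = 2 * I * dZero ζ b j (j - 1) t
      + 2 * I * ∑ k ∈ Finset.Icc 1 j, conj (ζ k) := by
  obtain ⟨j, rfl⟩ := Nat.exists_eq_add_of_le' hj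
  rw [dZero, Nat.add_sub_cancel, darbouxCoeff_pred, Matrix.neg_apply, Matrix.sum_apply,
    sum_Icc_eq_sum_range, mul_neg, neg_add_eq_sub, ← mul_sub, ← Finset.sum_sub_distrib,
    darbouxEnergy, ofReal_sum, Finset.mul_sum]
  refine Finset.sum_congr rfl fun i hi => ?_
  rw [darbouxShift_iteration_fst_fst h (lt_of_lt_of_le (Finset.mem_range.1 hi) hjK)]
  push_cast
  linear_combination (4 * ((ζ (i + 1)).im : ℂ) * (energyFraction ζ b i t : ℂ)) * I_mul_I

/-- The left energy is real, so its formula may be conjugated; then 4 Im ζ = 2i (conj ζ - ζ)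
exchanges the sums. -/
theorem energyRight_eq_dZero (h : IsSpectralData K ζ b) {j : ℕ} (hj : 1 ≤ j) (hjK : j ≤ K)
    (t : ℝ) : ((4 * ∑ k ∈ Finset.Icc 1 j, (ζ k).im - darbouxEnergy ζ b j t : ℝ) : ℂ) =
      2 * I * conj (dZero ζ b j (j - 1) t) + 2 * I * ∑ k ∈ Finset.Icc 1 j, conj (ζ k) := by
  have h1 := congrArg conj (darbouxEnergy_eq_dZero h hj hjK t)
  simp only [map_add, map_mul, conj_ofReal, conj_I, map_ofNat, map_sum, conj_conj] at h1
  have h2 : ((4 * ∑ k ∈ Finset.Icc 1 j, (ζ k).im : ℝ) : ℂ) =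
      2 * I * (∑ k ∈ Finset.Icc 1 j, conj (ζ k)) - 2 * I * ∑ k ∈ Finset.Icc 1 j, ζ k := by
    rw [← mul_sub, ← Finset.sum_sub_distrib]
    push_cast
    rw [Finset.mul_sum, Finset.mul_sum]
    refine Finset.sum_congr rfl fun k _ => ?_
    have e := Complex.sub_conj (ζ k)
    push_cast at e
    linear_combination (2 * I) * e + 4 * ((ζ k).im : ℂ) * I_mul_I
  rw [ofReal_sub, h1, h2]
  ring

theorem darbouxShift_eq_beta (j : ℕ) (t : ℝ) :
    2 * I * darbouxShift (ζ (j + 1)) (betaVector ζ b t j) 0 1 =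
      2 * I * ((ζ (j + 1) - conj (ζ (j + 1))) * beta ζ b t j) / (1 + (‖beta ζ b t j‖ : ℂ) ^ 2) := by
  -- At β = ∞ the value of `beta` is 0 by the convention for division, and M₁₂ vanishes as well.
  by_cases h1 : betaVector ζ b t j 1 = 0
  · rw [darbouxShift_fst_snd, beta, h1]
    simp
  · rw [darbouxShift_eq _ _ _ h1 rfl, ← beta]
    simp
    ring

theorem toReal_one_add_zpow (x y : ℂ) (hxy : x ≠ 0 ∨ y ≠ 0) :
    ((1 + (‖x‖ₑ / ‖y‖ₑ) ^ (-2 : ℤ))⁻¹).toReal = ‖x‖ ^ 2 / (‖x‖ ^ 2 + ‖y‖ ^ 2) ∧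
      ((1 + (‖x‖ₑ / ‖y‖ₑ) ^ (2 : ℤ))⁻¹).toReal = ‖y‖ ^ 2 / (‖x‖ ^ 2 + ‖y‖ ^ 2) := by
  have e2 : ∀ r : ℝ≥0∞, r ^ (-2 : ℤ) = (r ^ 2)⁻¹ := fun r => by
    rw [ENNReal.zpow_neg, zpow_ofNat]
  have e3 : ∀ r : ℝ≥0∞, r ^ (2 : ℤ) = r ^ 2 := fun r => zpow_ofNat r 2
  rw [e2, e3]
  -- The cases y = 0 and x = 0 are |β| = ∞ and |β| = 0, settled by arithmetic in [0, ∞]; `hxy`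
  -- excludes 0/0.
  rcases eq_or_ne y 0 with rfl | hy
  · have hx : x ≠ 0 := by simpa using hxy
    have hx' : ‖x‖ₑ ≠ 0 := by simpa using hx
    rw [enorm_zero, ENNReal.div_zero hx']
    simp [hx]
  · rcases eq_or_ne x 0 with rfl | hx
    · simp [hy]
    · have hx' : 0 < ‖x‖ := norm_pos_iff.2 hx
      have hy' : 0 < ‖y‖ := norm_pos_iff.2 hy
      rw [← ofReal_norm, ← ofReal_norm, ← ENNReal.ofReal_div_of_pos hy',
        ← ENNReal.ofReal_pow (by positivity), ← ENNReal.ofReal_inv_of_pos (by positivity),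
        ← ENNReal.ofReal_one, ← ENNReal.ofReal_add (by positivity) (by positivity),
        ← ENNReal.ofReal_add (by positivity) (by positivity), ENNReal.toReal_inv,
        ENNReal.toReal_inv, ENNReal.toReal_ofReal (by positivity),
        ENNReal.toReal_ofReal (by positivity)]
      constructor
      · field_simp
      · field_simp
        ring

theorem toReal_betaAbs (h : IsSpectralData K ζ b) {j : ℕ} (hj : j < K) (t : ℝ) :
    ((1 + betaAbs ζ b t j ^ (-2 : ℤ))⁻¹).toReal = energyFraction ζ b j t ∧
      ((1 + betaAbs ζ b t j ^ (2 : ℤ))⁻¹).toReal = 1 - energyFraction ζ b j t := by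
  have hne : betaVector ζ b t j 0 ≠ 0 ∨ betaVector ζ b t j 1 ≠ 0 := by
    by_contra! h0
    exact betaVector_ne_zero h hj t (funext fun i => by fin_cases i <;> simp [h0.1, h0.2])
  have hpos : ‖betaVector ζ b t j 0‖ ^ 2 + ‖betaVector ζ b t j 1‖ ^ 2 ≠ 0 := by
    rcases hne with h0 | h0
    · have := norm_pos_iff.2 h0; positivity
    · have := norm_pos_iff.2 h0; positivity
  obtain ⟨e1, e2⟩ := toReal_one_add_zpow _ _ hne
  refine ⟨e1, ?_⟩
  rw [betaAbs, e2, energyFraction, eq_sub_iff_add_eq, ← add_div, add_comm, div_self hpos]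

end Energy
end

section

/-! ### A calculus of operation counts -/

theorem runProgram_append (p p' : List Instr) (m : List ℂ) :
    runProgram (p ++ p') m = (runProgram p m).bind (runProgram p') := by
  induction p generalizing m with
  | nil => rfl
  | cons c p ih =>
    simp only [List.cons_append, runProgram, ih]
    cases c.value m <;> rfl

section Calculus

variable {α : Type*} {inp : α → List ℂ}

/-- Some program with at most `N` instructions computes all functions in `S` from the input. -/
def Runs (inp : α → List ℂ) (S : Set (α → ℂ)) (N : ℕ) : Prop :=
  ∃ prog : List Instr, prog.length ≤ N ∧ ∃ (m : α → List ℂ) (l : ℕ),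
    (∀ x, runProgram prog (inp x) = some (m x)) ∧ (∀ x, (m x).length = l) ∧
    ∀ f ∈ S, ∃ i : ℕ, ∀ x, (m x)[i]? = some (f x)

theorem Runs.mono {S T : Set (α → ℂ)} {N N' : ℕ} (h : Runs inp S N) (hT : T ⊆ S) (hN : N ≤ N') :
    Runs inp T N' := by
  obtain ⟨prog, hp, m, l, h1, h2, h3⟩ := h
  exact ⟨prog, hp.trans hN, m, l, h1, h2, fun f hf => h3 f (hT hf)⟩

theorem Runs.instr {S : Set (α → ℂ)} {N : ℕ} (h : Runs inp S N) (f : α → ℂ)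
    (hf : ∀ m : α → List ℂ, (∀ g ∈ S, ∃ i : ℕ, ∀ x, (m x)[i]? = some (g x)) →
      ∃ c : Instr, ∀ x, c.value (m x) = some (f x)) : Runs inp (insert f S) (N + 1) := by
  obtain ⟨prog, hp, m, l, h1, h2, h3⟩ := h
  obtain ⟨c, hc⟩ := hf m h3
  -- The memory has the same length l for every input, so the new value has the same address l for
  -- all of them.
  refine ⟨prog ++ [c], by simpa using hp, fun x => m x ++ [f x], l + 1, fun x => ?_, fun x => ?_, ?_⟩
  · simp [runProgram_append, h1, runProgram, hc]
  · simp [h2]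
  · rintro g (rfl | hg)
    · exact ⟨l, fun x => by rw [← h2 x]; simp⟩
    · obtain ⟨i, hi⟩ := h3 g hg
      refine ⟨i, fun x => ?_⟩
      have hlt : i < (m x).length := (List.getElem?_eq_some_iff.1 (hi x)).1
      rw [List.getElem?_append_left hlt, hi]

theorem Runs.exists_program {S : Set (α → ℂ)} {N : ℕ} (h : Runs inp S N) (F : List (α → ℂ))
    (hF : ∀ f ∈ F, f ∈ S) : ∃ (prog : List Instr) (outs : List ℕ), prog.length ≤ N ∧
      ∀ x, ProgramComputes prog outs (inp x) (F.map fun f => f x) := by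
  obtain ⟨prog, hp, m, l, h1, -, h3⟩ := h
  have : ∃ outs : List ℕ, ∀ x, outs.map (fun i => (m x)[i]?) = (F.map fun f => f x).map some := by
    induction F with
    | nil => exact ⟨[], fun x => rfl⟩
    | cons f F ih =>
      obtain ⟨outs, ho⟩ := ih fun g hg => hF g (List.mem_cons_of_mem f hg)
      obtain ⟨i, hi⟩ := h3 f (hF f List.mem_cons_self)
      exact ⟨i :: outs, fun x => by simp only [List.map_cons, hi, ho]⟩
  obtain ⟨outs, ho⟩ := this
  exact ⟨prog, outs, hp, fun x => ⟨m x, h1 x, ho x⟩⟩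

/-- With the functions in `S` at hand, those in `T` take at most `c` further instructions. -/
def Step (inp : α → List ℂ) (S T : Set (α → ℂ)) (c : ℕ) : Prop :=
  ∀ S', S ⊆ S' → ∀ N, Runs inp S' N → Runs inp (S' ∪ T) (N + c)

namespace Step

variable {S S₁ T T' : Set (α → ℂ)} {c c' : ℕ}

theorem mono (h : Step inp S T c) (hS : S ⊆ S₁) (hT : T' ⊆ T) (hc : c ≤ c') :
    Step inp S₁ T' c' := fun S' hS' N hN =>
  (h S' (hS.trans hS') N hN).mono (Set.union_subset_union_right _ hT) (by omega)

/-- Costs add because `Step` quantifies over all larger sets of available functions: earlier results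
stay in memory. -/
theorem trans (h : Step inp S T c) (h' : Step inp (S ∪ T) T' c') :
    Step inp S (T ∪ T') (c + c') := fun S' hS' N hN => by
  have := h' (S' ∪ T) (Set.union_subset_union_left _ hS') _ (h S' hS' N hN)
  rwa [Set.union_assoc, add_assoc] at this

theorem union (h : Step inp S T c) (h' : Step inp S T' c') : Step inp S (T ∪ T') (c + c') :=
  h.trans (h'.mono Set.subset_union_left le_rfl le_rfl)

theorem refl (S : Set (α → ℂ)) : Step inp S S 0 := fun _ hS' _ hN =>
  hN.mono (Set.union_subset le_rfl hS') le_rfl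

theorem list {L : List (α → ℂ)} (h : ∀ f ∈ L, Step inp S {f} c) :
    Step inp S {f | f ∈ L} (L.length * c) := by
  induction L with
  | nil => exact (refl S).mono le_rfl (by simp) (Nat.zero_le _)
  | cons f L ih =>
    refine ((h f List.mem_cons_self).union
      (ih fun g hg => h g (List.mem_cons_of_mem f hg))).mono le_rfl (fun g hg => ?_) ?_
    · exact List.mem_cons.1 hg
    · rw [List.length_cons]; linarith

/-- Each stage uses only S and the preceding stage, yet all stages are kept; the partial energies
are read off from every one of them. -/
theorem iterate {T : ℕ → Set (α → ℂ)} {n : ℕ} (h0 : Step inp S (T 0) c)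
    (h : ∀ j < n, Step inp (S ∪ T j) (T (j + 1)) c) :
    Step inp S (⋃ j ≤ n, T j) ((n + 1) * c) := by
  induction n with
  | zero => exact h0.mono le_rfl (by simp) (by omega)
  | succ n ih =>
    have h1 := ih fun j hj => h j (by omega)
    have h2 : Step inp (S ∪ ⋃ j ≤ n, T j) (T (n + 1)) c :=
      (h n (Nat.lt_succ_self n)).mono
        (Set.union_subset_union_right _ (Set.subset_iUnion₂ (s := fun j (_ : j ≤ n) => T j) n le_rfl))
        le_rfl le_rfl
    refine (h1.trans h2).mono le_rfl (Set.iUnion₂_subset fun j hj => ?_) (by ring_nf; omega)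
    rcases Nat.le_succ_iff.1 hj with hj' | rfl
    · exact (Set.subset_iUnion₂ (s := fun j (_ : j ≤ n) => T j) j hj').trans Set.subset_union_left
    · exact Set.subset_union_right

end Step

/-- The cost of a single function. -/
def Cost (inp : α → List ℂ) (S : Set (α → ℂ)) (f : α → ℂ) (c : ℕ) : Prop := Step inp S {f} c

namespace Cost

variable {S : Set (α → ℂ)} {f g : α → ℂ} {c d : ℕ}

theorem mem (hf : f ∈ S) : Cost inp S f 0 :=
  (Step.refl S).mono le_rfl (Set.singleton_subset_iff.2 hf) le_rfl

theorem le (h : Cost inp S f c) (hcd : c ≤ d) : Cost inp S f d := Step.mono h le_rfl le_rfl hcd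

theorem congr (h : Cost inp S f c) (e : ∀ x, f x = g x) : Cost inp S g c := by
  rwa [← (funext e : f = g)]

theorem constOne : Cost inp S (fun _ => 1) 1 := fun S' _ N hN =>
  (hN.instr (fun _ => 1) fun _ _ => ⟨.one, fun _ => rfl⟩).mono
    (by rw [Set.union_comm, Set.singleton_union]) le_rfl

theorem constI : Cost inp S (fun _ => I) 1 := fun S' _ N hN =>
  (hN.instr (fun _ => I) fun _ _ => ⟨.imag, fun _ => rfl⟩).mono
    (by rw [Set.union_comm, Set.singleton_union]) le_rfl

theorem unary (hf : Cost inp S f c) (op : ℂ → ℂ) (ins : ℕ → Instr)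
    (hins : ∀ (m : List ℂ) i a, m[i]? = some a → (ins i).value m = some (op a)) :
    Cost inp S (fun x => op (f x)) (c + 1) := fun S' hS' N hN => by
  refine ((hf S' hS' N hN).instr (fun x => op (f x)) fun m hm => ?_).mono ?_ (by omega)
  · obtain ⟨i, hi⟩ := hm f (Or.inr rfl)
    exact ⟨ins i, fun x => hins _ _ _ (hi x)⟩
  · rintro h (hh | hh)
    · exact Or.inr (Or.inl hh)
    · exact Or.inl hh

theorem binary (hf : Cost inp S f c) (hg : Cost inp S g d) (op : ℂ → ℂ → ℂ) (ins : ℕ → ℕ → Instr)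
    (hins : ∀ (m : List ℂ) i j x, m[i]? = some (f x) → m[j]? = some (g x) →
      (ins i j).value m = some (op (f x) (g x))) :
    Cost inp S (fun x => op (f x) (g x)) (c + d + 1) := fun S' hS' N hN => by
  refine (((Step.union hf hg) S' hS' N hN).instr (fun x => op (f x) (g x)) fun m hm => ?_).mono ?_
    (by omega)
  · obtain ⟨i, hi⟩ := hm f (Or.inr (Or.inl rfl))
    obtain ⟨j, hj⟩ := hm g (Or.inr (Or.inr rfl))
    exact ⟨ins i j, fun x => hins _ _ _ x (hi x) (hj x)⟩
  · rintro h (hh | hh)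
    · exact Or.inr (Or.inl hh)
    · exact Or.inl hh

theorem add (hf : Cost inp S f c) (hg : Cost inp S g d) :
    Cost inp S (fun x => f x + g x) (c + d + 1) :=
  binary hf hg (· + ·) .add fun m i j x hi hj => by simp [Instr.value, hi, hj]

theorem sub (hf : Cost inp S f c) (hg : Cost inp S g d) :
    Cost inp S (fun x => f x - g x) (c + d + 1) :=
  binary hf hg (· - ·) .sub fun m i j x hi hj => by simp [Instr.value, hi, hj]

theorem mul (hf : Cost inp S f c) (hg : Cost inp S g d) :
    Cost inp S (fun x => f x * g x) (c + d + 1) :=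
  binary hf hg (· * ·) .mul fun m i j x hi hj => by simp [Instr.value, hi, hj]

theorem div (hf : Cost inp S f c) (hg : Cost inp S g d) (hne : ∀ x, g x ≠ 0) :
    Cost inp S (fun x => f x / g x) (c + d + 1) :=
  binary hf hg (· / ·) .div fun m i j x hi hj => by simp [Instr.value, hi, hj, hne x]

theorem star (hf : Cost inp S f c) : Cost inp S (fun x => conj (f x)) (c + 1) :=
  unary hf _ .conj fun m i a hi => by simp [Instr.value, hi]

theorem exp (hf : Cost inp S f c) : Cost inp S (fun x => Complex.exp (f x)) (c + 1) :=
  unary hf _ .exp fun m i a hi => by simp [Instr.value, hi]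

theorem constZero : Cost inp S (fun _ => 0) 3 :=
  (constOne.sub constOne).congr fun _ => sub_self _

theorem neg (hf : Cost inp S f c) : Cost inp S (fun x => -f x) (c + 4) :=
  ((constZero.sub hf).le (by omega)).congr fun _ => zero_sub _

end Cost
end Calculus
end

section

/-! ### The program of the Darboux iteration -/

/-- The energy of a potential with the eigenvalues `ζ_1, …, ζ_j`. -/
noncomputable def spectralEnergy (ζ : ℕ → ℂ) (j : ℕ) : ℝ :=
  4 * ∑ k ∈ Finset.Icc 1 j, (ζ k).im

section Machine

variable {α : Type*} {inp : α → List ℂ}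

/-- The input of the iteration. -/
def iterationData (K : ℕ) (Z B : α → ℕ → ℂ) (τ : α → ℝ) : Set (α → ℂ) :=
  {f | (∃ k < K, f = fun x => Z x (k + 1)) ∨ (∃ k < K, f = fun x => B x (k + 1)) ∨
    f = fun x => (τ x : ℂ)}

/-- The vector `v_j(t; ζ_{k+1}) (1, -b_{k+1})`; for `k = j` it is `betaVector`. -/
noncomputable def eigenVector (ζ b : ℕ → ℂ) (t : ℝ) (j k : ℕ) : Fin 2 → ℂ :=
  darbouxJost ζ b t j (ζ (k + 1)) *ᵥ ![1, -b (k + 1)]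

/-- The quantities which the iteration holds after `j` steps. -/
noncomputable def iterationState (K : ℕ) (Z B : α → ℕ → ℂ) (τ : α → ℝ) (j : ℕ) : List (α → ℂ) :=
  (List.range K).map (fun k x => eigenVector (Z x) (B x) (τ x) j k 0) ++
  (List.range K).map (fun k x => eigenVector (Z x) (B x) (τ x) j k 1) ++
  (List.range (K + 1)).map (fun k x => dZero (Z x) (B x) j k (τ x)) ++
  (List.range (K + 1)).map (fun k x => dOne (Z x) (B x) j k (τ x)) ++
  [fun x => (darbouxEnergy (Z x) (B x) j (τ x) : ℂ), fun x => (spectralEnergy (Z x) j : ℂ)]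

theorem length_iterationState (K : ℕ) (Z B : α → ℕ → ℂ) (τ : α → ℝ) (j : ℕ) :
    (iterationState K Z B τ j).length = 4 * K + 4 := by
  simp [iterationState]; ring

theorem mem_iterationState {K : ℕ} {Z B : α → ℕ → ℂ} {τ : α → ℝ} {j : ℕ} {f : α → ℂ} :
    f ∈ iterationState K Z B τ j ↔
      (∃ k < K, f = fun x => eigenVector (Z x) (B x) (τ x) j k 0) ∨
      (∃ k < K, f = fun x => eigenVector (Z x) (B x) (τ x) j k 1) ∨
      (∃ k ≤ K, f = fun x => dZero (Z x) (B x) j k (τ x)) ∨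
      (∃ k ≤ K, f = fun x => dOne (Z x) (B x) j k (τ x)) ∨
      (f = fun x => (darbouxEnergy (Z x) (B x) j (τ x) : ℂ)) ∨
      (f = fun x => (spectralEnergy (Z x) j : ℂ)) := by
  simp only [iterationState, List.mem_append, List.mem_map, List.mem_range, List.mem_cons,
    List.not_mem_nil, or_false, Nat.lt_succ_iff, eq_comm (b := f), or_assoc]

theorem eigenVector_zero (ζ b : ℕ → ℂ) (t : ℝ) (k : ℕ) :
    eigenVector ζ b t 0 k 0 = exp (-(I * ζ (k + 1) * t)) ∧
    eigenVector ζ b t 0 k 1 = exp (I * ζ (k + 1) * t) * -b (k + 1) := by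
  constructor <;> simp [eigenVector, darbouxJost, seed, mul_comm]

theorem eigenVector_succ (ζ b : ℕ → ℂ) (t : ℝ) (j k : ℕ) :
    eigenVector ζ b t (j + 1) k 0 =
      ((ζ (k + 1) - darbouxShift (ζ (j + 1)) (betaVector ζ b t j) 0 0) * eigenVector ζ b t j k 0 -
        darbouxShift (ζ (j + 1)) (betaVector ζ b t j) 0 1 * eigenVector ζ b t j k 1) /
        (ζ (k + 1) - conj (ζ (j + 1))) ∧
    eigenVector ζ b t (j + 1) k 1 =
      (conj (darbouxShift (ζ (j + 1)) (betaVector ζ b t j) 0 1) * eigenVector ζ b t j k 0 +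
        (ζ (k + 1) - conj (darbouxShift (ζ (j + 1)) (betaVector ζ b t j) 0 0)) *
          eigenVector ζ b t j k 1) / (ζ (k + 1) - conj (ζ (j + 1))) := by
  have e : eigenVector ζ b t (j + 1) k = (ζ (k + 1) - conj (ζ (j + 1)))⁻¹ •
      ((ζ (k + 1) • (1 : Matrix (Fin 2) (Fin 2) ℂ) -
        darbouxShift (ζ (j + 1)) (betaVector ζ b t j)) *ᵥ eigenVector ζ b t j k) := by
    rw [eigenVector, darbouxJost_succ, Matrix.smul_mulVec, ← Matrix.mulVec_mulVec, ← eigenVector]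
  rw [e, ← darbouxShift_snd_snd]
  have e' : conj (darbouxShift (ζ (j + 1)) (betaVector ζ b t j) 0 1) =
    -darbouxShift (ζ (j + 1)) (betaVector ζ b t j) 1 0 := by rw [darbouxShift_snd_fst, neg_neg]
  rw [e']
  generalize darbouxShift (ζ (j + 1)) (betaVector ζ b t j) = M
  generalize eigenVector ζ b t j k = w
  constructor <;> simp <;> ring

theorem mul_darbouxCoeff (ζ b : ℕ → ℂ) (t : ℝ) (M : Matrix (Fin 2) (Fin 2) ℂ) (j k : ℕ) :
    (M * darbouxCoeff ζ b t j k) 0 0 =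
      M 0 0 * dZero ζ b j k t - M 0 1 * conj (dOne ζ b j k t) ∧
    (M * darbouxCoeff ζ b t j k) 0 1 =
      M 0 0 * dOne ζ b j k t + M 0 1 * conj (dZero ζ b j k t) := by
  rw [Matrix.mul_apply, Matrix.mul_apply, Fin.sum_univ_two, Fin.sum_univ_two,
    (isQuaternionic_darbouxCoeff ζ b t j k).snd_fst, (isQuaternionic_darbouxCoeff ζ b t j k).snd_snd,
    dZero, dOne]
  exact ⟨by ring, rfl⟩

theorem dZero_dOne_succ_zero (ζ b : ℕ → ℂ) (t : ℝ) (j : ℕ) :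
    dZero ζ b (j + 1) 0 t =
      -(darbouxShift (ζ (j + 1)) (betaVector ζ b t j) 0 0 * dZero ζ b j 0 t -
        darbouxShift (ζ (j + 1)) (betaVector ζ b t j) 0 1 * conj (dOne ζ b j 0 t)) ∧
    dOne ζ b (j + 1) 0 t =
      -(darbouxShift (ζ (j + 1)) (betaVector ζ b t j) 0 0 * dOne ζ b j 0 t +
        darbouxShift (ζ (j + 1)) (betaVector ζ b t j) 0 1 * conj (dZero ζ b j 0 t)) := by
  rw [← (mul_darbouxCoeff ..).1, ← (mul_darbouxCoeff ..).2, dZero, dOne, darbouxCoeff_succ_zero]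
  exact ⟨rfl, rfl⟩

theorem dZero_dOne_succ_succ (ζ b : ℕ → ℂ) (t : ℝ) (j k : ℕ) :
    dZero ζ b (j + 1) (k + 1) t = dZero ζ b j k t -
      (darbouxShift (ζ (j + 1)) (betaVector ζ b t j) 0 0 * dZero ζ b j (k + 1) t -
        darbouxShift (ζ (j + 1)) (betaVector ζ b t j) 0 1 * conj (dOne ζ b j (k + 1) t)) ∧
    dOne ζ b (j + 1) (k + 1) t = dOne ζ b j k t -
      (darbouxShift (ζ (j + 1)) (betaVector ζ b t j) 0 0 * dOne ζ b j (k + 1) t +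
        darbouxShift (ζ (j + 1)) (betaVector ζ b t j) 0 1 * conj (dZero ζ b j (k + 1) t)) := by
  rw [← (mul_darbouxCoeff ..).1, ← (mul_darbouxCoeff ..).2, dZero, dOne, darbouxCoeff_succ_succ]
  exact ⟨rfl, rfl⟩

/-- Written with the admitted operations and constants only: 4 Im ζ = 2 (ζ - conj ζ) / i. -/
theorem spectralEnergy_succ (ζ : ℕ → ℂ) (j : ℕ) : (spectralEnergy ζ (j + 1) : ℂ) =
    spectralEnergy ζ j + (1 + 1) * ((ζ (j + 1) - conj (ζ (j + 1))) / I) := by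
  rw [spectralEnergy, spectralEnergy, Finset.sum_Icc_succ_top (by omega), Complex.sub_conj]
  push_cast
  field_simp
  ring

theorem ofReal_darbouxEnergy_succ {K : ℕ} {ζ b : ℕ → ℂ} (h : IsSpectralData K ζ b) {j : ℕ}
    (hj : j < K) (t : ℝ) : (darbouxEnergy ζ b (j + 1) t : ℂ) = darbouxEnergy ζ b j t +
      (1 + 1) * ((darbouxShift (ζ (j + 1)) (betaVector ζ b t j) 0 0 - conj (ζ (j + 1))) / I) := by
  rw [darbouxEnergy_succ, darbouxShift_iteration_fst_fst h hj]
  push_cast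
  field_simp
  ring

variable {K : ℕ} {Z B : α → ℕ → ℂ} {τ : α → ℝ}

theorem step_iterationState_zero {S : Set (α → ℂ)} (hS : iterationData K Z B τ ⊆ S) :
    Step inp S {f | f ∈ iterationState K Z B τ 0} ((4 * K + 4) * 100) := by
  rw [← length_iterationState K Z B τ 0]
  have hZ : ∀ k < K, Cost inp S (fun x => Z x (k + 1)) 0 := fun k hk =>
    .mem (hS (Or.inl ⟨k, hk, rfl⟩))
  have hB : ∀ k < K, Cost inp S (fun x => B x (k + 1)) 0 := fun k hk =>
    .mem (hS (Or.inr (Or.inl ⟨k, hk, rfl⟩)))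
  have ht : Cost inp S (fun x => (τ x : ℂ)) 0 := .mem (hS (Or.inr (Or.inr rfl)))
  have h0 : Cost inp S (fun _ => 0) 100 := Cost.constZero.le (by norm_num)
  have h1 : Cost inp S (fun _ => 1) 100 := Cost.constOne.le (by norm_num)
  refine Step.list fun f hf => ?_
  change Cost inp S f 100
  rcases mem_iterationState.1 hf with ⟨k, hk, rfl⟩ | ⟨k, hk, rfl⟩ | ⟨k, -, rfl⟩ | ⟨k, -, rfl⟩ |
    rfl | rfl
  · exact (((Cost.constI.mul (hZ k hk)).mul ht).neg.exp.le (by norm_num)).congr fun x =>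
      (eigenVector_zero ..).1.symm
  · exact ((((Cost.constI.mul (hZ k hk)).mul ht).exp.mul (hB k hk).neg).le (by norm_num)).congr
      fun x => (eigenVector_zero ..).2.symm
  · rcases Nat.eq_zero_or_pos k with rfl | hk
    · exact h1.congr fun x => by simp [dZero, darbouxCoeff_self]
    · exact h0.congr fun x => by simp [dZero, darbouxCoeff_eq_zero _ _ _ hk]
  · rcases Nat.eq_zero_or_pos k with rfl | hk
    · exact h0.congr fun x => by simp [dOne, darbouxCoeff_self]
    · exact h0.congr fun x => by simp [dOne, darbouxCoeff_eq_zero _ _ _ hk]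
  · exact h0.congr fun x => by simp [darbouxEnergy]
  · exact h0.congr fun x => by simp [spectralEnergy]

/-- Every new entry is an expression of bounded size in the shift and a few old entries. The shift
is recomputed for each entry, so 100 instructions per entry is a crude bound. No polynomial is
evaluated at an eigenvalue, since the vectors at all ζ_k are updated along the way. -/
theorem step_iterationState_succ (hyp : ∀ x, IsSpectralData K (Z x) (B x)) {j : ℕ} (hj : j < K)
    {S : Set (α → ℂ)} (hS : iterationData K Z B τ ⊆ S)
    (hS' : {f | f ∈ iterationState K Z B τ j} ⊆ S) :
    Step inp S {f | f ∈ iterationState K Z B τ (j + 1)} ((4 * K + 4) * 100) := by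
  rw [← length_iterationState K Z B τ (j + 1)]
  have hZ : ∀ k < K, Cost inp S (fun x => Z x (k + 1)) 0 := fun k hk =>
    .mem (hS (Or.inl ⟨k, hk, rfl⟩))
  have hw0 : ∀ k < K, Cost inp S (fun x => eigenVector (Z x) (B x) (τ x) j k 0) 0 := fun k hk =>
    .mem (hS' (mem_iterationState.2 (Or.inl ⟨k, hk, rfl⟩)))
  have hw1 : ∀ k < K, Cost inp S (fun x => eigenVector (Z x) (B x) (τ x) j k 1) 0 := fun k hk =>
    .mem (hS' (mem_iterationState.2 (Or.inr (Or.inl ⟨k, hk, rfl⟩))))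
  have hd0 : ∀ k ≤ K, Cost inp S (fun x => dZero (Z x) (B x) j k (τ x)) 0 := fun k hk =>
    .mem (hS' (mem_iterationState.2 (Or.inr (Or.inr (Or.inl ⟨k, hk, rfl⟩)))))
  have hd1 : ∀ k ≤ K, Cost inp S (fun x => dOne (Z x) (B x) j k (τ x)) 0 := fun k hk =>
    .mem (hS' (mem_iterationState.2 (Or.inr (Or.inr (Or.inr (Or.inl ⟨k, hk, rfl⟩))))))
  have hE : Cost inp S (fun x => (darbouxEnergy (Z x) (B x) j (τ x) : ℂ)) 0 :=
    .mem (hS' (mem_iterationState.2 (Or.inr (Or.inr (Or.inr (Or.inr (Or.inl rfl)))))))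
  have hT : Cost inp S (fun x => (spectralEnergy (Z x) j : ℂ)) 0 :=
    .mem (hS' (mem_iterationState.2 (Or.inr (Or.inr (Or.inr (Or.inr (Or.inr rfl)))))))
  -- No division fails: the squared norm of `betaVector` is positive, and ζ_k differs from the
  -- conjugate of ζ_{j+1} since both lie in the upper half-plane.
  have hn : ∀ x, betaVector (Z x) (B x) (τ x) j 0 * conj (betaVector (Z x) (B x) (τ x) j 0) +
      betaVector (Z x) (B x) (τ x) j 1 * conj (betaVector (Z x) (B x) (τ x) j 1) ≠ 0 := fun x =>
    norm_sq_add_ne_zero (betaVector_ne_zero (hyp x) hj _)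
  have hN : Cost inp S (fun x => betaVector (Z x) (B x) (τ x) j 0 *
      conj (betaVector (Z x) (B x) (τ x) j 0) + betaVector (Z x) (B x) (τ x) j 1 *
        conj (betaVector (Z x) (B x) (τ x) j 1)) 5 :=
    ((hw0 j hj).mul (hw0 j hj).star).add ((hw1 j hj).mul (hw1 j hj).star)
  have hM0 : Cost inp S
      (fun x => darbouxShift (Z x (j + 1)) (betaVector (Z x) (B x) (τ x) j) 0 0) 14 :=
    ((((((hw0 j hj).mul (hw0 j hj).star).mul (hZ j hj)).add
      (((hw1 j hj).mul (hw1 j hj).star).mul (hZ j hj).star)).div hN hn).le (by norm_num)).congr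
      fun x => (darbouxShift_fst_fst ..).symm
  have hM1 : Cost inp S
      (fun x => darbouxShift (Z x (j + 1)) (betaVector (Z x) (B x) (τ x) j) 0 1) 14 :=
    (((((hZ j hj).sub (hZ j hj).star).mul ((hw0 j hj).mul (hw1 j hj).star)).div hN hn).le
      (by norm_num)).congr fun x => (darbouxShift_fst_snd ..).symm
  have hne : ∀ k < K, ∀ x, Z x (k + 1) - conj (Z x (j + 1)) ≠ 0 := fun k hk x =>
    sub_conj_ne_zero ((hyp x).im_pos_succ hk).le ((hyp x).im_pos_succ hj)
  have h2 : Cost inp S (fun _ => 1 + 1) 3 := Cost.constOne.add Cost.constOne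
  refine Step.list fun f hf => ?_
  change Cost inp S f 100
  rcases mem_iterationState.1 hf with ⟨k, hk, rfl⟩ | ⟨k, hk, rfl⟩ | ⟨k, hk, rfl⟩ | ⟨k, hk, rfl⟩ |
    rfl | rfl
  · exact ((((((hZ k hk).sub hM0).mul (hw0 k hk)).sub (hM1.mul (hw1 k hk))).div
      ((hZ k hk).sub (hZ j hj).star) (hne k hk)).le (by norm_num)).congr fun x =>
      (eigenVector_succ ..).1.symm
  · exact ((((hM1.star.mul (hw0 k hk)).add (((hZ k hk).sub hM0.star).mul (hw1 k hk))).div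
      ((hZ k hk).sub (hZ j hj).star) (hne k hk)).le (by norm_num)).congr fun x =>
      (eigenVector_succ ..).2.symm
  · have hp : ∀ k ≤ K, Cost inp S (fun x => _) _ := fun k hk =>
      (hM0.mul (hd0 k hk)).sub (hM1.mul (hd1 k hk).star)
    rcases k with - | k
    · exact ((hp 0 hk).neg.le (by norm_num)).congr fun x =>
        (dZero_dOne_succ_zero ..).1.symm
    · exact (((hd0 k (by omega)).sub (hp (k + 1) hk)).le (by norm_num)).congr fun x =>
        (dZero_dOne_succ_succ ..).1.symm
  · have hp : ∀ k ≤ K, Cost inp S (fun x => _) _ := fun k hk =>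
      (hM0.mul (hd1 k hk)).add (hM1.mul (hd0 k hk).star)
    rcases k with - | k
    · exact ((hp 0 hk).neg.le (by norm_num)).congr fun x =>
        (dZero_dOne_succ_zero ..).2.symm
    · exact (((hd1 k (by omega)).sub (hp (k + 1) hk)).le (by norm_num)).congr fun x =>
        (dZero_dOne_succ_succ ..).2.symm
  · exact ((hE.add (h2.mul ((hM0.sub (hZ j hj).star).div Cost.constI fun _ => I_ne_zero))).le
      (by norm_num)).congr fun x => (ofReal_darbouxEnergy_succ (hyp x) hj _).symm
  · exact ((hT.add (h2.mul (((hZ j hj).sub (hZ j hj).star).div Cost.constI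
      fun _ => I_ne_zero))).le (by norm_num)).congr fun x => (spectralEnergy_succ ..).symm

/-- The first `K` steps of the iteration take `O(K²)` operations. -/
theorem step_iteration (hK : 1 ≤ K) (hyp : ∀ x, IsSpectralData K (Z x) (B x)) :
    Step inp (iterationData K Z B τ) (⋃ j ≤ K, {f | f ∈ iterationState K Z B τ j})
      (1600 * K ^ 2) :=
  -- K + 1 stages of (4K + 4) · 100 instructions, and 400 (K + 1)² ≤ 1600 K² for K ≥ 1.
  (Step.iterate (step_iterationState_zero le_rfl) fun _ hj =>
    step_iterationState_succ hyp hj Set.subset_union_left Set.subset_union_right).mono le_rfl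
    le_rfl (by nlinarith)

theorem Step.runs {S T : Set (α → ℂ)} {c : ℕ} (h : Step inp S T c) (hS : Runs inp S 0) :
    Runs inp T c :=
  (h S le_rfl 0 hS).mono Set.subset_union_right (by omega)

/-- What stands in the input needs no instructions. -/
theorem runs_input {l : ℕ} (hl : ∀ x, (inp x).length = l) {S : Set (α → ℂ)}
    (hS : ∀ f ∈ S, ∃ i : ℕ, ∀ x, (inp x)[i]? = some (f x)) : Runs inp S 0 :=
  ⟨[], le_rfl, inp, l, fun _ => rfl, hl, hS⟩

theorem length_dataList (K : ℕ) (ζ b : ℕ → ℂ) : (dataList K ζ b).length = K + K := by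
  simp [dataList]

theorem getElem?_dataList {K k : ℕ} (hk : k < K) (ζ b : ℕ → ℂ) (l : List ℂ) :
    (dataList K ζ b ++ l)[k]? = some (ζ (k + 1)) ∧
    (dataList K ζ b ++ l)[K + k]? = some (b (k + 1)) := by
  constructor
  · rw [List.getElem?_append_left (by rw [length_dataList]; omega), dataList,
      List.getElem?_append_left (by simpa using hk)]
    simp [hk]
  · rw [List.getElem?_append_left (by rw [length_dataList]; omega), dataList,
      List.getElem?_append_right (by simp)]
    simp [hk]

end Machine

/-- The coefficients of the Darboux matrix take `O(K²)` operations. -/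
theorem exists_program_darbouxCoeff {K : ℕ} (hK : 1 ≤ K) :
    ∃ (prog : List Instr) (outs : List ℕ), prog.length ≤ 1600 * K ^ 2 ∧
      ∀ (ζ b : ℕ → ℂ) (t : ℝ), IsSpectralData K ζ b →
        ProgramComputes prog outs (dataList K ζ b ++ [(t : ℂ)])
          ((List.range K).map (fun k => dZero ζ b K k t) ++
            (List.range K).map (fun k => dOne ζ b K k t)) := by
  -- All admissible inputs at once, so that the program obtained depends on K only.
  let α := {x : (ℕ → ℂ) × (ℕ → ℂ) × ℝ // IsSpectralData K x.1 x.2.1}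
  let Z : α → ℕ → ℂ := fun x => x.1.1
  let B : α → ℕ → ℂ := fun x => x.1.2.1
  let τ : α → ℝ := fun x => x.1.2.2
  let inp : α → List ℂ := fun x => dataList K (Z x) (B x) ++ [(τ x : ℂ)]
  have h0 : Runs inp (iterationData K Z B τ) 0 := by
    refine runs_input (l := K + K + 1) (fun x => by simp [inp, length_dataList]) ?_
    rintro f (⟨k, hk, rfl⟩ | ⟨k, hk, rfl⟩ | rfl)
    · exact ⟨k, fun x => (getElem?_dataList hk _ _ _).1⟩
    · exact ⟨K + k, fun x => (getElem?_dataList hk _ _ _).2⟩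
    · exact ⟨K + K, fun x => by
        rw [List.getElem?_append_right (by rw [length_dataList]), length_dataList]; simp⟩
  have h1 := (step_iteration hK fun x : α => x.2).runs h0
  obtain ⟨prog, outs, hp, h⟩ := h1.exists_program
    ((List.range K).map (fun k x => dZero (Z x) (B x) K k (τ x)) ++
      (List.range K).map (fun k x => dOne (Z x) (B x) K k (τ x))) fun f hf => by
    refine Set.mem_iUnion₂.2 ⟨K, le_rfl, mem_iterationState.2 ?_⟩
    simp only [List.mem_append, List.mem_map, List.mem_range] at hf
    rcases hf with ⟨k, hk, rfl⟩ | ⟨k, hk, rfl⟩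
    · exact Or.inr (Or.inr (Or.inl ⟨k, hk.le, rfl⟩))
    · exact Or.inr (Or.inr (Or.inr (Or.inl ⟨k, hk.le, rfl⟩)))
  refine ⟨prog, outs, hp, fun ζ b t hd => ?_⟩
  simpa [Function.comp_def] using h ⟨(ζ, b, t), hd⟩

/-- The partial energies and the fraction of the energy in the tails take `O(K²)` operations. -/
theorem exists_program_energy {K : ℕ} (hK : 1 ≤ K) :
    ∃ (prog : List Instr) (outs : List ℕ), prog.length ≤ 4000 * K ^ 2 ∧
      ∀ (ζ b : ℕ → ℂ) (Tm Tp : ℝ), IsSpectralData K ζ b →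
        ProgramComputes prog outs (dataList K ζ b ++ [(Tm : ℂ), (Tp : ℂ)])
          ((List.range K).map (fun j => (darbouxEnergy ζ b (j + 1) (-Tm) : ℂ)) ++
            (List.range K).map
              (fun j => (spectralEnergy ζ (j + 1) : ℂ) - darbouxEnergy ζ b (j + 1) Tp) ++
            [(darbouxEnergy ζ b K (-Tm) : ℂ) + (spectralEnergy ζ K - darbouxEnergy ζ b K Tp),
              ((darbouxEnergy ζ b K (-Tm) : ℂ) + (spectralEnergy ζ K - darbouxEnergy ζ b K Tp)) /
                spectralEnergy ζ K]) := by
  let α := {x : (ℕ → ℂ) × (ℕ → ℂ) × ℝ × ℝ // IsSpectralData K x.1 x.2.1}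
  let Z : α → ℕ → ℂ := fun x => x.1.1
  let B : α → ℕ → ℂ := fun x => x.1.2.1
  let τm : α → ℝ := fun x => x.1.2.2.1
  let τp : α → ℝ := fun x => x.1.2.2.2
  let inp : α → List ℂ := fun x => dataList K (Z x) (B x) ++ [(τm x : ℂ), (τp x : ℂ)]
  let S₀ : Set (α → ℂ) := iterationData K Z B τp ∪ {fun x => (τm x : ℂ)}
  have h0 : Runs inp S₀ 0 := by
    refine runs_input (l := K + K + 2) (fun x => by simp [inp, length_dataList]) ?_
    rintro f ((⟨k, hk, rfl⟩ | ⟨k, hk, rfl⟩ | rfl) | rfl)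
    · exact ⟨k, fun x => (getElem?_dataList hk _ _ _).1⟩
    · exact ⟨K + k, fun x => (getElem?_dataList hk _ _ _).2⟩
    · exact ⟨K + K + 1, fun x => by
        rw [List.getElem?_append_right (by rw [length_dataList]; omega), length_dataList]; simp⟩
    · exact ⟨K + K, fun x => by
        rw [List.getElem?_append_right (by rw [length_dataList]), length_dataList]; simp⟩
  -- The iteration runs twice, at T₊ and at -T₋; the second time is computed first.
  have h1 : Step inp S₀ {fun x => ((-τm x : ℝ) : ℂ)} 4 :=
    (Cost.neg (Cost.mem (Or.inr rfl))).congr fun x => by simp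
  have h2 : Step inp S₀ _ _ := (step_iteration (τ := τp) hK fun x : α => x.2).mono
    Set.subset_union_left le_rfl le_rfl
  have h3 := h1.trans ((step_iteration (τ := fun x => -τm x) hK fun x : α => x.2).mono
    (S₁ := S₀ ∪ {fun x => ((-τm x : ℝ) : ℂ)}) (by
      rintro f (hf | hf | rfl)
      · exact Or.inl (Or.inl (Or.inl hf))
      · exact Or.inl (Or.inl (Or.inr (Or.inl hf)))
      · exact Or.inr rfl) le_rfl le_rfl)
  have h4 := h2.union h3
  obtain ⟨T, hT⟩ : ∃ T, T = (⋃ j ≤ K, {f | f ∈ iterationState K Z B τp j}) ∪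
    ({fun x => ((-τm x : ℝ) : ℂ)} ∪ ⋃ j ≤ K, {f | f ∈ iterationState K Z B (fun x => -τm x) j}) :=
    ⟨_, rfl⟩
  rw [← hT] at h4
  have hL : ∀ j ≤ K, (fun x => (darbouxEnergy (Z x) (B x) j (-τm x) : ℂ)) ∈ T := fun j hj =>
    hT ▸ Or.inr (Or.inr (Set.mem_iUnion₂.2 ⟨j, hj, mem_iterationState.2
      (Or.inr (Or.inr (Or.inr (Or.inr (Or.inl rfl)))))⟩))
  have hR : ∀ j ≤ K, (fun x => (darbouxEnergy (Z x) (B x) j (τp x) : ℂ)) ∈ T := fun j hj =>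
    hT ▸ Or.inl (Set.mem_iUnion₂.2 ⟨j, hj, mem_iterationState.2
      (Or.inr (Or.inr (Or.inr (Or.inr (Or.inl rfl)))))⟩)
  have hE : ∀ j ≤ K, (fun x => (spectralEnergy (Z x) j : ℂ)) ∈ T := fun j hj =>
    hT ▸ Or.inl (Set.mem_iUnion₂.2 ⟨j, hj, mem_iterationState.2
      (Or.inr (Or.inr (Or.inr (Or.inr (Or.inr rfl)))))⟩)
  have hne : ∀ x : α, (spectralEnergy (Z x) K : ℂ) ≠ 0 := fun x => by
    have : 0 < ∑ k ∈ Finset.Icc 1 K, (Z x k).im :=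
      Finset.sum_pos (fun k hk => x.2.im_pos k hk) ⟨1, Finset.mem_Icc.2 ⟨le_rfl, hK⟩⟩
    rw [Ne, ofReal_eq_zero, spectralEnergy]
    positivity
  have hRc : ∀ j ≤ K, Cost inp T (fun x => (spectralEnergy (Z x) j : ℂ) -
      darbouxEnergy (Z x) (B x) j (τp x)) 1 := fun j hj =>
    (Cost.mem (hE j hj)).sub (Cost.mem (hR j hj))
  have hTc := (Cost.mem (inp := inp) (hL K le_rfl)).add (hRc K le_rfl)
  let F : List (α → ℂ) :=
    (List.range K).map (fun j x => (darbouxEnergy (Z x) (B x) (j + 1) (-τm x) : ℂ)) ++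
    (List.range K).map
      (fun j x => (spectralEnergy (Z x) (j + 1) : ℂ) - darbouxEnergy (Z x) (B x) (j + 1) (τp x)) ++
    [fun x => (darbouxEnergy (Z x) (B x) K (-τm x) : ℂ) +
        (spectralEnergy (Z x) K - darbouxEnergy (Z x) (B x) K (τp x)),
      fun x => ((darbouxEnergy (Z x) (B x) K (-τm x) : ℂ) +
        (spectralEnergy (Z x) K - darbouxEnergy (Z x) (B x) K (τp x))) / spectralEnergy (Z x) K]
  have h5 : Step inp T {f | f ∈ F} (F.length * 10) := Step.list fun f hf => by
    change Cost inp T f 10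
    simp only [F, List.mem_append, List.mem_map, List.mem_range, List.mem_cons,
      List.not_mem_nil, or_false] at hf
    rcases hf with (⟨j, hj, rfl⟩ | ⟨j, hj, rfl⟩) | rfl | rfl
    · exact (Cost.mem (hL (j + 1) hj)).le (by norm_num)
    · exact (hRc (j + 1) hj).le (by norm_num)
    · exact hTc.le (by norm_num)
    · exact (hTc.div (Cost.mem (hE K le_rfl)) hne).le (by norm_num)
  have hF : F.length = 2 * K + 2 := by simp [F]; ring
  rw [hF] at h5
  obtain ⟨prog, outs, hp, h⟩ := ((h4.trans (h5.mono Set.subset_union_right le_rfl le_rfl)).runs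
    h0).exists_program F fun f hf => Or.inr hf
  -- Two iterations of 1600 K², four instructions for -T₋, and ten for each of the 2K + 2 outputs.
  refine ⟨prog, outs, hp.trans (by nlinarith), fun ζ b Tm Tp hd => ?_⟩
  simpa [F, Function.comp_def] using h ⟨(ζ, b, Tm, Tp), hd⟩

end

/-! ### Assembly of the statements -/

section

theorem darbouxCoeff_eq (ζ b : ℕ → ℂ) (t : ℝ) (j k : ℕ) : darbouxCoeff ζ b t j k =
    !![dZero ζ b j k t, dOne ζ b j k t; -conj (dOne ζ b j k t), conj (dZero ζ b j k t)] :=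
  (isQuaternionic_darbouxCoeff ζ b t j k).eq_of

theorem darbouxPotential_succ_eq_beta (ζ b : ℕ → ℂ) (j : ℕ) (t : ℝ) :
    darbouxPotential ζ b (j + 1) t = darbouxPotential ζ b j t -
      2 * I * ((ζ (j + 1) - conj (ζ (j + 1))) * beta ζ b t j) / (1 + (‖beta ζ b t j‖ : ℂ) ^ 2) := by
  rw [← darbouxShift_eq_beta, darbouxPotential]

theorem energy_darboux_succ {K : ℕ} {ζ b : ℕ → ℂ} (h : IsSpectralData K ζ b) {j : ℕ} (hj : j < K)
    (t : ℝ) :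
    energyLeft (darbouxPotential ζ b (j + 1)) t = energyLeft (darbouxPotential ζ b j) t
      + 4 * (ζ (j + 1)).im * ((1 + betaAbs ζ b t j ^ (-2 : ℤ))⁻¹).toReal ∧
    energyRight (darbouxPotential ζ b (j + 1)) t = energyRight (darbouxPotential ζ b j) t
      + 4 * (ζ (j + 1)).im * ((1 + betaAbs ζ b t j ^ (2 : ℤ))⁻¹).toReal := by
  rw [(toReal_betaAbs h hj t).1, (toReal_betaAbs h hj t).2, energyLeft_darboux h hj,
    energyLeft_darboux h hj.le, energyRight_darboux h hj, energyRight_darboux h hj.le,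
    darbouxEnergy_succ, Finset.sum_Icc_succ_top (by omega)]
  exact ⟨rfl, by ring⟩

end

end ZakharovShabat

theorem mainTheorem5 :
    -- identities, for every choice of admissible discrete data
    (∀ (K : ℕ) (ζ b : ℕ → ℂ), IsSpectralData K ζ b →
      -- the multi-soliton potentials with the discrete spectra `S_0 ⊂ S_1 ⊂ … ⊂ S_K` exist
      (∀ j ≤ K, ∃ p : ℝ → ℂ, IsSolitonPotential j ζ b p) ∧
      ∀ q : ℕ → ℝ → ℂ, (∀ j ≤ K, IsSolitonPotential j ζ b (q j)) →
        -- the matrix Jost solution of `q_j` is `v_j = μ_j D_j v_0`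
        (∀ j ≤ K, ∀ z : ℂ, 0 ≤ z.im →
          (∀ t, darbouxJost ζ b t j z = darbouxSolution ζ b j t z) ∧
          IsJostPhi (q j) z (fun t => (darbouxSolution ζ b j t z).col 0) ∧
          IsJostPsi (q j) z (fun t => (darbouxSolution ζ b j t z).col 1)) ∧
        -- the form of the coefficient matrices
        (∀ j ≤ K, ∀ t, darbouxCoeff ζ b t j j = 1 ∧ ∀ k < j,
          darbouxCoeff ζ b t j k =
            !![dZero ζ b j k t, dOne ζ b j k t;
               -starRingEnd ℂ (dOne ζ b j k t), starRingEnd ℂ (dZero ζ b j k t)]) ∧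
        -- potential and partial energies from the Darboux matrix
        (∀ j, 1 ≤ j → j ≤ K → ∀ t : ℝ,
          q j t = 2 * I * dOne ζ b j (j - 1) t ∧
          (energyLeft (q j) t : ℂ) = 2 * I * dZero ζ b j (j - 1) t
            + 2 * I * ∑ k ∈ Finset.Icc 1 j, starRingEnd ℂ (ζ k) ∧
          (energyRight (q j) t : ℂ) = 2 * I * starRingEnd ℂ (dZero ζ b j (j - 1) t)
            + 2 * I * ∑ k ∈ Finset.Icc 1 j, starRingEnd ℂ (ζ k)) ∧
        -- recursions, started from the null potential
        (∀ t, q 0 t = 0 ∧ energyLeft (q 0) t = 0 ∧ energyRight (q 0) t = 0) ∧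
        (∀ j < K, ∀ t : ℝ,
          q (j + 1) t = q j t - 2 * I * ((ζ (j + 1) - starRingEnd ℂ (ζ (j + 1))) * beta ζ b t j)
            / (1 + (‖beta ζ b t j‖ : ℂ) ^ 2) ∧
          betaVector ζ b t j ≠ 0 ∧
          energyLeft (q (j + 1)) t = energyLeft (q j) t
            + 4 * (ζ (j + 1)).im * ((1 + betaAbs ζ b t j ^ (-2 : ℤ))⁻¹).toReal ∧
          energyRight (q (j + 1)) t = energyRight (q j) t
            + 4 * (ζ (j + 1)).im * ((1 + betaAbs ζ b t j ^ (2 : ℤ))⁻¹).toReal) ∧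
        -- total energy and energy in the tails
        (∀ j ≤ K, Integrable (fun t => ‖q j t‖ ^ 2) ∧
          totalEnergy (q j) = 4 * ∑ k ∈ Finset.Icc 1 j, (ζ k).im) ∧
        (∀ Tm Tp : ℝ, 0 < Tm → 0 < Tp →
          tailEnergy (q K) Tm Tp = energyLeft (q K) (-Tm) + energyRight (q K) Tp)) ∧
    -- the Darboux matrix coefficients at a point are computed in `O(K²)` operations
    (∃ C : ℕ, ∀ K : ℕ, 1 ≤ K → ∃ (prog : List Instr) (outs : List ℕ),
      prog.length ≤ C * K ^ 2 ∧
      ∀ (ζ b : ℕ → ℂ) (t : ℝ), IsSpectralData K ζ b →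
        ProgramComputes prog outs (dataList K ζ b ++ [(t : ℂ)])
          ((List.range K).map (fun k => dZero ζ b K k t) ++
            (List.range K).map (fun k => dOne ζ b K k t))) ∧
    -- the partial energies, the tail energy and its fraction are computed in `O(K²)` operations
    (∃ C : ℕ, ∀ K : ℕ, 1 ≤ K → ∃ (prog : List Instr) (outs : List ℕ),
      prog.length ≤ C * K ^ 2 ∧
      ∀ (ζ b : ℕ → ℂ) (q : ℕ → ℝ → ℂ) (Tm Tp : ℝ), IsSpectralData K ζ b →
        (∀ j ≤ K, IsSolitonPotential j ζ b (q j)) → 0 < Tm → 0 < Tp →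
        ProgramComputes prog outs (dataList K ζ b ++ [(Tm : ℂ), (Tp : ℂ)])
          ((List.range K).map (fun j => (energyLeft (q (j + 1)) (-Tm) : ℂ)) ++
            (List.range K).map (fun j => (energyRight (q (j + 1)) Tp : ℂ)) ++
            [(tailEnergy (q K) Tm Tp : ℂ),
              ((tailEnergy (q K) Tm Tp / totalEnergy (q K) : ℝ) : ℂ)])) := by
  refine ⟨fun K ζ b h => ⟨fun j hj => ⟨_, isSolitonPotential_darboux h hj⟩, fun q hq => ?_⟩,
    ⟨1600, fun K hK => exists_program_darbouxCoeff hK⟩, ⟨4000, fun K hK => ?_⟩⟩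
  -- By uniqueness an arbitrary soliton potential is the one produced by the iteration.
  · have e : ∀ j ≤ K, q j = darbouxPotential ζ b j := fun j hj => (hq j hj).eq_darbouxPotential h hj
    refine ⟨fun j hj z hz => ⟨fun t => darbouxJost_eq_darbouxSolution ζ b j t z, ?_, ?_⟩,
      fun j _ t => ⟨darbouxCoeff_self ζ b t j, fun k _ => darbouxCoeff_eq ζ b t j k⟩,
      fun j h1 hj t => ?_, fun t => ?_, fun j hj t => ?_, fun j hj => ?_, fun Tm Tp hm hp => ?_⟩
    · simpa only [e j hj, ← darbouxJost_eq_darbouxSolution] using isJostPhi_darboux h hj hz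
    · simpa only [e j hj, ← darbouxJost_eq_darbouxSolution] using isJostPsi_darboux h hj hz
    · rw [e j hj, energyLeft_darboux h hj, energyRight_darboux h hj]
      exact ⟨darbouxPotential_eq_dOne h1 t, darbouxEnergy_eq_dZero h h1 hj t,
        energyRight_eq_dZero h h1 hj t⟩
    · rw [e 0 (Nat.zero_le K)]
      exact ⟨rfl, by simp [energyLeft, darbouxPotential], by simp [energyRight, darbouxPotential]⟩
    · rw [e (j + 1) hj, e j hj.le]
      exact ⟨darbouxPotential_succ_eq_beta ζ b j t, betaVector_ne_zero h hj t,
        energy_darboux_succ h hj t⟩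
    · rw [e j hj]
      exact ⟨integrable_darbouxPotential_sq h hj, totalEnergy_darboux h hj⟩
    · rw [e K le_rfl]
      exact tailEnergy_eq (integrable_darbouxPotential_sq h le_rfl) hm hp
  · obtain ⟨prog, outs, hlen, hrun⟩ := exists_program_energy hK
    refine ⟨prog, outs, hlen, fun ζ b q Tm Tp h hq hm hp => ?_⟩
    have e : ∀ j ≤ K, q j = darbouxPotential ζ b j := fun j hj => (hq j hj).eq_darbouxPotential h hj
    have hL : ∀ j ≤ K, energyLeft (q j) (-Tm) = darbouxEnergy ζ b j (-Tm) := fun j hj => by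
      rw [e j hj, energyLeft_darboux h hj]
    have hR : ∀ j ≤ K, energyRight (q j) Tp = spectralEnergy ζ j - darbouxEnergy ζ b j Tp :=
      fun j hj => by rw [e j hj, energyRight_darboux h hj, spectralEnergy]
    have hT : tailEnergy (q K) Tm Tp =
        darbouxEnergy ζ b K (-Tm) + (spectralEnergy ζ K - darbouxEnergy ζ b K Tp) := by
      rw [← hL K le_rfl, ← hR K le_rfl, e K le_rfl]
      exact tailEnergy_eq (integrable_darbouxPotential_sq h le_rfl) hm hp
    have hE : totalEnergy (q K) = spectralEnergy ζ K := by
      rw [e K le_rfl, totalEnergy_darboux h le_rfl, spectralEnergy]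
    have h1 : (List.range K).map (fun j => (energyLeft (q (j + 1)) (-Tm) : ℂ)) =
        (List.range K).map (fun j => (darbouxEnergy ζ b (j + 1) (-Tm) : ℂ)) :=
      List.map_congr_left fun j hj => by rw [hL (j + 1) (List.mem_range.1 hj)]
    have h2 : (List.range K).map (fun j => (energyRight (q (j + 1)) Tp : ℂ)) =
        (List.range K).map
          (fun j => (spectralEnergy ζ (j + 1) : ℂ) - darbouxEnergy ζ b (j + 1) Tp) :=
      List.map_congr_left fun j hj => by rw [hR (j + 1) (List.mem_range.1 hj), ofReal_sub]
    rw [h1, h2, hT, hE]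
    simpa only [ofReal_div, ofReal_add, ofReal_sub] using hrun ζ b Tm Tp h
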